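/- **Definitions.** A generalized Boolean algebra is a distributive lattice $\mathcal B$ with relative complements and least element $\emptyset$; morphisms preserve $\cup,\cap,\setminus,\emptyset$; an ideal is a non-empty downward closed subset that is closed under $\cup$; and $\mathcal B/\mathcal I$ is the quotient by $A\sim A'\iff \exists U\in\mathcal I:\ A\cup U=A'\cup U$. A generalized Boolean dynamical system $(\mathcal B,\mathcal L,\theta,\mathcal I)$ consists of a generalized Boolean algebra $\mathcal B$, a set $\mathcal L$ of letters, and for every $a\in\mathcal L$ a morphism $\theta_a:\mathcal B\to\mathcal B$ and an ideal $\mathcal I_a$ of $\mathcal B$ containing $\{A: A\subseteq\theta_a(A')\text{ for some }A'\in\mathcal B\}$. Put $\Delta_A=\{a\in\mathcal L:\theta_a(A)\neq\emptyset\}$. A set $A\in\mathcal B$ is regular, $A\in\mathcal B_{\rm reg}$, if $0<|\Delta_{A'}|<\infty$ for every $\emptyset\ne A'\subseteq A$, and singular otherwise. A set $V$ is a sink if $\Delta_V=\emptyset$, and $U$ has no sinks if $U\cap V=\emptyset$ for every sink $V$. For a commutative unital ring $R$, $L_R(\mathcal B,\mathcal L,\theta,\mathcal I)$ is the (not necessarily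 unital) associative $R$-algebra generated by symbols $p_A$ $(A\in\mathcal B)$ and $s_{a,C},s_{a,C}^*$ $(a\in\mathcal L,\ C\in\mathcal I_a)$ with the relations 1. $p_\emptyset=0$, $p_{A\cap A'}=p_Ap_{A'}$, $p_{A\cup A'}=p_A+p_{A'}-p_{A\cap A'}$; 2. $p_As_{a,C}=s_{a,C}\,p_{\theta_a(A)}$, $s_{a,C}^*p_A=p_{\theta_a(A)}s_{a,C}^*$; 3. $s_{a,C}^*s_{a',C'}=\delta_{a,a'}\,p_{C\cap C'}$; 4. $s_{a,C}\,p_A=s_{a,C\cap A}$, $p_As_{a,C}^*=s_{a,C\cap A}^*$; 5. $p_A=\sum_{a\in\Delta_A}s_{a,\theta_a(A)}s_{a,\theta_a(A)}^*$ for $A\in\mathcal B_{\rm reg}$. **Construction.** Let $\mathcal L=\{a_i: i\in N\}$ be countable, enumerated without repetitions by a set $N\subseteq\{1,2,\dots\}$ ($N=\{1,2,\dots\}$ is the typical case; finite alphabets are allowed). Let $X_0=\{\emptyset\}$ and, for $i\ge 1$, $X_i=\{U\in\mathcal B: U\text{ has no sinks and }\Delta_U\subseteq\{a_j: j\in N,\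 j<i\}\}$. These are ideals with $X_i\subseteq X_{i+1}$. Let $\mathcal B_i=\mathcal B/X_i$, write $[A]_i$ for the class of $A$ in $\mathcal B_i$, and let $\mathcal B^F=\bigoplus_{i\ge0}\mathcal B_i$ be the generalized Boolean algebra of families $(x_i)_{i\ge 0}$, $x_i\in\mathcal B_i$, with $x_i=\emptyset$ for all but finitely many $i$ (componentwise operations; $\mathcal B_i$ is regarded as the $i$-th summand). Let $\mathcal L^F=\mathcal L\sqcup\{b_1,b_2,\dots\}$. Let $\theta^F_{b_i}([A]_{i-1})=[A]_i$ for $i\ge 1$ and $\theta^F_{a_i}([A]_i)=[\theta_{a_i}(A)]_0$ for $i\in N$, where $\theta^F_{b_i}$ is $\emptyset$ on all summands other than $\mathcal B_{i-1}$ and $\theta^F_{a_i}$ is $\emptyset$ on all summands other than $\mathcal B_i$. Let $\mathcal I^F_{a_i}=\{[A]_0:A\in\mathcal I_{a_i}\}$ and $\mathcal I^F_{b_i}=\mathcal B_i$. Then $(\mathcal B^F,\mathcal L^F,\theta^F,\mathcal I^F)$ is a generalized Boolean dynamical system. **Theorem.** Let $R$ be a commutative unital ring and $(\mathcal B,\mathcal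 L,\theta,\mathcal I)$ a generalized Boolean dynamical system with countable alphabet, enumerated as above. Then $(\mathcal B^F)_{\rm reg}=\mathcal B^F$, and the $R$-algebras $L_R(\mathcal B,\mathcal L,\theta,\mathcal I)$ and $L_R(\mathcal B^F,\mathcal L^F,\theta^F,\mathcal I^F)$ are Morita equivalent. Here $R$-algebras $A$ and $C$, not necessarily unital, are called Morita equivalent if they are related by a surjective Morita context: there are $R$-linear bimodules ${}_AM_C$ and ${}_CN_A$ with $AM=M=MC$ and $CN=N=NA$, and surjective $R$-linear bimodule maps $\varphi:M\otimes_CN\to A$ and $\psi:N\otimes_AM\to C$ with $\varphi(m\otimes n)m'=m\,\psi(n\otimes m')$ and $\psi(n\otimes m)n'=n\,\varphi(m\otimes n')$ for all $m,m'\in M$ and $n,n'\in N$. -/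

import Mathlib

noncomputable section

namespace BooleanDynamics

universe u v w

/-! ### Generalized Boolean algebras: morphisms and quotients by ideals -/

/-- A morphism of generalized Boolean algebras: it preserves joins, meets, relative complements
and the minimal element. -/
structure GBAHom (B : Type u) (C : Type v) [GeneralizedBooleanAlgebra B]
    [GeneralizedBooleanAlgebra C] where
  toFun : B → C
  map_sup : ∀ x y, toFun (x ⊔ y) = toFun x ⊔ toFun y
  map_inf : ∀ x y, toFun (x ⊓ y) = toFun x ⊓ toFun y
  map_sdiff : ∀ x y, toFun (x \ y) = toFun x \ toFun y
  map_bot : toFun ⊥ = ⊥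

instance {B : Type u} {C : Type v} [GeneralizedBooleanAlgebra B] [GeneralizedBooleanAlgebra C] :
    CoeFun (GBAHom B C) (fun _ => B → C) := ⟨GBAHom.toFun⟩

section Quotient

variable {B : Type v} [GeneralizedBooleanAlgebra B]

/-- `A ∼ A'` if and only if `A ∪ U = A' ∪ U` for some `U` in the ideal. -/
def idealSetoid (I : Order.Ideal B) : Setoid B where
  r A A' := ∃ U ∈ I, A ⊔ U = A' ⊔ U
  iseqv :=
    { refl := fun _ => ⟨⊥, I.bot_mem, rfl⟩
      symm := fun ⟨U, hU, h⟩ => ⟨U, hU, h.symm⟩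
      trans := by
        rintro A₁ A₂ A₃ ⟨U, hU, h⟩ ⟨V, hV, h'⟩
        refine ⟨U ⊔ V, I.sup_mem hU hV, ?_⟩
        rw [← sup_assoc, h, sup_right_comm, h', sup_assoc, sup_comm V U] }

/-- The quotient `B / I` of a generalized Boolean algebra by an ideal. -/
def IdealQuotient (I : Order.Ideal B) : Type v := Quotient (idealSetoid I)

/-- The class `[A]` of `A` in `B / I`. -/
def IdealQuotient.mk (I : Order.Ideal B) (A : B) : IdealQuotient I :=
  Quotient.mk (idealSetoid I) A

theorem IdealQuotient.mk_eq {I : Order.Ideal B} {A A' : B} :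
    IdealQuotient.mk I A = IdealQuotient.mk I A' ↔ ∃ U ∈ I, A ⊔ U = A' ⊔ U :=
  Quotient.eq (r := idealSetoid I)

theorem sup_congr_ideal {I : Order.Ideal B} {a b c d : B} (h : ∃ U ∈ I, a ⊔ U = b ⊔ U)
    (h' : ∃ U ∈ I, c ⊔ U = d ⊔ U) : ∃ U ∈ I, (a ⊔ c) ⊔ U = (b ⊔ d) ⊔ U := by
  obtain ⟨U, hU, h⟩ := h
  obtain ⟨V, hV, h'⟩ := h'
  refine ⟨U ⊔ V, I.sup_mem hU hV, ?_⟩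
  rw [sup_sup_sup_comm, h, h', sup_sup_sup_comm]

theorem inf_congr_ideal {I : Order.Ideal B} {a b c d : B} (h : ∃ U ∈ I, a ⊔ U = b ⊔ U)
    (h' : ∃ U ∈ I, c ⊔ U = d ⊔ U) : ∃ U ∈ I, (a ⊓ c) ⊔ U = (b ⊓ d) ⊔ U := by
  obtain ⟨U, hU, h⟩ := h
  obtain ⟨V, hV, h'⟩ := h'
  refine ⟨U ⊔ V, I.sup_mem hU hV, ?_⟩
  have e1 : a ⊔ (U ⊔ V) = b ⊔ (U ⊔ V) := by rw [← sup_assoc, h, sup_assoc]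
  have e2 : c ⊔ (U ⊔ V) = d ⊔ (U ⊔ V) := by
    rw [sup_comm U V, ← sup_assoc, h', sup_assoc]
  rw [sup_inf_right, sup_inf_right, e1, e2]

theorem sdiff_congr_ideal {I : Order.Ideal B} {a b c d : B} (h : ∃ U ∈ I, a ⊔ U = b ⊔ U)
    (h' : ∃ U ∈ I, c ⊔ U = d ⊔ U) : ∃ U ∈ I, (a \ c) ⊔ U = (b \ d) ⊔ U := by
  obtain ⟨U, hU, h⟩ := h
  obtain ⟨V, hV, h'⟩ := h'
  refine ⟨U ⊔ V, I.sup_mem hU hV, ?_⟩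
  have key : ∀ x y W : B, (x \ y) ⊔ W = ((x ⊔ W) \ (y ⊔ W)) ⊔ W := by
    intro x y W
    rw [sup_sdiff, sdiff_eq_bot_iff.2 (le_sup_right : W ≤ y ⊔ W), sup_bot_eq,
      ← sdiff_sdiff_left, sdiff_sup_self]
  have e1 : a ⊔ (U ⊔ V) = b ⊔ (U ⊔ V) := by rw [← sup_assoc, h, sup_assoc]
  have e2 : c ⊔ (U ⊔ V) = d ⊔ (U ⊔ V) := by
    rw [sup_comm U V, ← sup_assoc, h', sup_assoc]
  rw [key a c, key b d, e1, e2]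

/-- The quotient carries the operations induced on representatives. -/
instance (I : Order.Ideal B) : Max (IdealQuotient I) :=
  ⟨Quotient.map₂ (· ⊔ ·) (fun _ _ h _ _ h' => sup_congr_ideal h h')⟩

instance (I : Order.Ideal B) : Min (IdealQuotient I) :=
  ⟨Quotient.map₂ (· ⊓ ·) (fun _ _ h _ _ h' => inf_congr_ideal h h')⟩

instance (I : Order.Ideal B) : SDiff (IdealQuotient I) :=
  ⟨Quotient.map₂ (· \ ·) (fun _ _ h _ _ h' => sdiff_congr_ideal h h')⟩

instance (I : Order.Ideal B) : Bot (IdealQuotient I) := ⟨IdealQuotient.mk I ⊥⟩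

/-- `B / I` is again a generalized Boolean algebra. -/
instance (I : Order.Ideal B) : GeneralizedBooleanAlgebra (IdealQuotient I) where
  __ := Lattice.mk' (α := IdealQuotient I)
    (by rintro ⟨a⟩ ⟨b⟩; exact congrArg (IdealQuotient.mk I) (sup_comm a b))
    (by rintro ⟨a⟩ ⟨b⟩ ⟨c⟩; exact congrArg (IdealQuotient.mk I) (sup_assoc a b c))
    (by rintro ⟨a⟩ ⟨b⟩; exact congrArg (IdealQuotient.mk I) (inf_comm a b))
    (by rintro ⟨a⟩ ⟨b⟩ ⟨c⟩; exact congrArg (IdealQuotient.mk I) (inf_assoc a b c))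
    (by rintro ⟨a⟩ ⟨b⟩; exact congrArg (IdealQuotient.mk I) sup_inf_self)
    (by rintro ⟨a⟩ ⟨b⟩; exact congrArg (IdealQuotient.mk I) inf_sup_self)
  le_sup_inf := by
    rintro ⟨a⟩ ⟨b⟩ ⟨c⟩
    refine congrArg (IdealQuotient.mk I) (?_ : (a ⊔ b) ⊓ (a ⊔ c) ⊔ (a ⊔ b ⊓ c) = a ⊔ b ⊓ c)
    rw [← sup_inf_left, sup_idem]
  sdiff := (· \ ·)
  bot := ⊥
  sup_inf_sdiff := by
    rintro ⟨a⟩ ⟨b⟩; exact congrArg (IdealQuotient.mk I) (sup_inf_sdiff a b)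
  inf_inf_sdiff := by
    rintro ⟨a⟩ ⟨b⟩; exact congrArg (IdealQuotient.mk I) (inf_inf_sdiff a b)

/-- A morphism `f : B → C` such that for `U ∈ I` one has `f U ∈ J` induces `B / I → C / J`. -/
def IdealQuotient.map {C : Type w} [GeneralizedBooleanAlgebra C] (I : Order.Ideal B)
    (J : Order.Ideal C) (f : GBAHom B C) (h : ∀ U ∈ I, f U ∈ J) :
    GBAHom (IdealQuotient I) (IdealQuotient J) where
  toFun := Quotient.map f (by
    rintro A A' ⟨U, hU, e⟩
    exact ⟨f U, h U hU, by rw [← f.map_sup, e, f.map_sup]⟩)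
  map_sup := by
    rintro ⟨a⟩ ⟨b⟩; exact congrArg (IdealQuotient.mk J) (f.map_sup a b)
  map_inf := by
    rintro ⟨a⟩ ⟨b⟩; exact congrArg (IdealQuotient.mk J) (f.map_inf a b)
  map_sdiff := by
    rintro ⟨a⟩ ⟨b⟩; exact congrArg (IdealQuotient.mk J) (f.map_sdiff a b)
  map_bot := congrArg (IdealQuotient.mk J) f.map_bot

theorem IdealQuotient.map_mk {C : Type w} [GeneralizedBooleanAlgebra C] (I : Order.Ideal B)
    (J : Order.Ideal C) (f : GBAHom B C) (h : ∀ U ∈ I, f U ∈ J) (A : B) :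
    IdealQuotient.map I J f h (IdealQuotient.mk I A) = IdealQuotient.mk J (f A) := rfl

/-- The identity morphism. -/
def GBAHom.id (B : Type v) [GeneralizedBooleanAlgebra B] : GBAHom B B where
  toFun A := A
  map_sup _ _ := rfl
  map_inf _ _ := rfl
  map_sdiff _ _ := rfl
  map_bot := rfl

end Quotient

/-! ### Direct sums of generalized Boolean algebras -/

section DirectSum

variable {B : ℕ → Type v} [∀ i, GeneralizedBooleanAlgebra (B i)]

variable (B) in
/-- `⨁ i, B i`: the formal finite disjoint unions `⨆ i, x i` with `x i ∈ B i`, that is, the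
families `x` with `x i = ∅` for all but finitely many `i`. -/
def FinSum : Type v := {x : ∀ i, B i // {i | x i ≠ ⊥}.Finite}

instance : LE (FinSum B) := ⟨fun x y => x.1 ≤ y.1⟩
instance : LT (FinSum B) := ⟨fun x y => x.1 < y.1⟩
instance : Bot (FinSum B) := ⟨⟨⊥, by simp⟩⟩

instance : Max (FinSum B) := ⟨fun x y => ⟨x.1 ⊔ y.1, (x.2.union y.2).subset (by
  intro i hi
  by_contra h
  simp only [Set.mem_union, Set.mem_ofPred_eq, not_or, not_not] at h
  exact hi (by simp [h.1, h.2]))⟩⟩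

instance : Min (FinSum B) := ⟨fun x y => ⟨x.1 ⊓ y.1, x.2.subset (by
  intro i hi h
  exact hi (by simp [h]))⟩⟩

instance : SDiff (FinSum B) := ⟨fun x y => ⟨x.1 \ y.1, x.2.subset (by
  intro i hi h
  exact hi (by simp [h]))⟩⟩

/-- The operations of `⨁ i, B i` are computed level by level. -/
instance : GeneralizedBooleanAlgebra (FinSum B) :=
  Function.Injective.generalizedBooleanAlgebra (fun x : FinSum B => x.1) Subtype.val_injective
    Iff.rfl Iff.rfl (fun _ _ => rfl) (fun _ _ => rfl) rfl (fun _ _ => rfl)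

/-- The copy of `x ∈ B i` in the `i`-th level of `⨁ i, B i`. -/
def FinSum.single (i : ℕ) (x : B i) : FinSum B :=
  ⟨Function.update ⊥ i x, (Set.finite_singleton i).subset (by
    intro j hj
    by_contra h
    exact hj (by rw [Function.update_of_ne h]; rfl))⟩

theorem FinSum.single_val (i : ℕ) (x : B i) :
    (FinSum.single i x).1 = Function.update (⊥ : ∀ i, B i) i x := rfl

theorem FinSum.ext_iff' {x y : FinSum B} : x = y ↔ ∀ i, x.1 i = y.1 i :=
  ⟨fun h _ => by rw [h], fun h => Subtype.ext (funext h)⟩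

theorem FinSum.single_op (f : ∀ i, B i → B i → B i) (hf : ∀ i, f i ⊥ ⊥ = ⊥) (i : ℕ) (x y : B i)
    (j : ℕ) : (FinSum.single i (f i x y)).1 j
      = f j ((FinSum.single i x).1 j) ((FinSum.single i y).1 j) := by
  simp only [FinSum.single_val]
  by_cases h : j = i
  · subst h; simp
  · simp [Function.update_of_ne h, hf]

/-- The endomorphism of `⨁ i, B i` that is `g : B i → B j` on level `i` (with values in level
`j`) and `∅` on all other levels. -/
def FinSum.shift (i j : ℕ) (g : GBAHom (B i) (B j)) : GBAHom (FinSum B) (FinSum B) where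
  toFun x := FinSum.single j (g (x.1 i))
  map_sup x y := FinSum.ext_iff'.2 fun k => by
    change (FinSum.single j (g (x.1 i ⊔ y.1 i))).1 k = _
    rw [g.map_sup]
    exact FinSum.single_op (fun _ a b => a ⊔ b) (fun _ => sup_idem _) j _ _ k
  map_inf x y := FinSum.ext_iff'.2 fun k => by
    change (FinSum.single j (g (x.1 i ⊓ y.1 i))).1 k = _
    rw [g.map_inf]
    exact FinSum.single_op (fun _ a b => a ⊓ b) (fun _ => inf_idem _) j _ _ k
  map_sdiff x y := FinSum.ext_iff'.2 fun k => by
    change (FinSum.single j (g (x.1 i \ y.1 i))).1 k = _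
    rw [g.map_sdiff]
    exact FinSum.single_op (fun _ a b => a \ b) (fun _ => sdiff_self) j _ _ k
  map_bot := FinSum.ext_iff'.2 fun k => by
    change (FinSum.single j (g ⊥)).1 k = ⊥
    rw [g.map_bot, FinSum.single_val]
    by_cases h : k = j
    · subst h; simp
    · simp [Function.update_of_ne h]

end DirectSum

/-! ### Generalized Boolean dynamical systems -/

/-- A generalized Boolean dynamical system `(B, L, θ, I)`: an action `θ a` of every letter and
ideals `I a` containing `{A | ∃ A', A ⊆ θ a A'}`. -/
structure GBDS (B : Type v) (L : Type w) [GeneralizedBooleanAlgebra B] where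
  θ : L → GBAHom B B
  I : L → Order.Ideal B
  mem_I : ∀ (a : L) (A A' : B), A ≤ θ a A' → A ∈ I a

namespace GBDS

variable {B : Type v} {L : Type w} [GeneralizedBooleanAlgebra B] (S : GBDS B L)

/-- `Δ_A`, the set of letters that act nontrivially on `A`. -/
def Δ (A : B) : Set L := {a | S.θ a A ≠ ⊥}

/-- The regular sets: every nonempty `A' ⊆ A` satisfies `0 < |Δ_{A'}| < ∞`. -/
def regular : Set B := {A | ∀ A' ≤ A, A' ≠ ⊥ → (S.Δ A').Nonempty ∧ (S.Δ A').Finite}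

/-- The sinks: `|Δ_A| = 0`. -/
def sink : Set B := {A | S.Δ A = ∅}

/-- `U` has no sinks: it has empty intersection with every sink. -/
def NoSinks (U : B) : Prop := ∀ V ∈ S.sink, U ⊓ V = ⊥

/-! ### The algebra of a generalized Boolean dynamical system -/

/-- The generators `p_A` for `A ∈ B`, and `s_{a,A}`, `s_{a,A}^*` for `a ∈ L` and `A ∈ I a`. -/
inductive Gen : Type (max v w)
  | p (A : B) : Gen
  | s (a : L) (A : {A // A ∈ S.I a}) : Gen
  | sStar (a : L) (A : {A // A ∈ S.I a}) : Gen

variable (R : Type u) [CommRing R]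

/-- The free (non-unital) associative `R`-algebra on the generators. -/
abbrev FreeAlg : Type (max u v w) := MonoidAlgebra R (FreeSemigroup S.Gen)

/-- The free generator `p_A`. -/
def fp (A : B) : S.FreeAlg R := MonoidAlgebra.single (FreeSemigroup.of (Gen.p A)) 1

/-- The free generator `s_{a,A}`. -/
def fs (a : L) (A : B) (h : A ∈ S.I a) : S.FreeAlg R :=
  MonoidAlgebra.single (FreeSemigroup.of (Gen.s a ⟨A, h⟩)) 1

/-- The free generator `s_{a,A}^*`. -/
def fsStar (a : L) (A : B) (h : A ∈ S.I a) : S.FreeAlg R :=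
  MonoidAlgebra.single (FreeSemigroup.of (Gen.sStar a ⟨A, h⟩)) 1

theorem inf_mem_I {a : L} {A : B} (h : A ∈ S.I a) (A' : B) : A ⊓ A' ∈ S.I a :=
  (S.I a).lower inf_le_left h

theorem θ_mem_I (a : L) (A : B) : S.θ a A ∈ S.I a := S.mem_I a _ A le_rfl

/-- The defining relations. -/
inductive Rel : S.FreeAlg R → S.FreeAlg R → Prop
  | p_bot : Rel (S.fp R ⊥) 0
  | p_inf (A A' : B) : Rel (S.fp R (A ⊓ A')) (S.fp R A * S.fp R A')
  | p_sup (A A' : B) : Rel (S.fp R (A ⊔ A')) (S.fp R A + S.fp R A' - S.fp R (A ⊓ A'))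
  | p_s (A : B) (a : L) (C : B) (hC : C ∈ S.I a) :
      Rel (S.fp R A * S.fs R a C hC) (S.fs R a C hC * S.fp R (S.θ a A))
  | sStar_p (A : B) (a : L) (C : B) (hC : C ∈ S.I a) :
      Rel (S.fsStar R a C hC * S.fp R A) (S.fp R (S.θ a A) * S.fsStar R a C hC)
  | sStar_s_self (a : L) (C C' : B) (hC : C ∈ S.I a) (hC' : C' ∈ S.I a) :
      Rel (S.fsStar R a C hC * S.fs R a C' hC') (S.fp R (C ⊓ C'))
  | sStar_s_ne (a a' : L) (h : a ≠ a') (C C' : B) (hC : C ∈ S.I a) (hC' : C' ∈ S.I a') :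
      Rel (S.fsStar R a C hC * S.fs R a' C' hC') 0
  | s_p (a : L) (C C' : B) (hC : C ∈ S.I a) :
      Rel (S.fs R a C hC * S.fp R C') (S.fs R a (C ⊓ C') (S.inf_mem_I hC C'))
  | p_sStar (a : L) (C C' : B) (hC : C ∈ S.I a) :
      Rel (S.fp R C' * S.fsStar R a C hC) (S.fsStar R a (C ⊓ C') (S.inf_mem_I hC C'))
  | cuntzKrieger (A : B) (hA : A ∈ S.regular) (F : Finset L) (hF : ∀ a, a ∈ F ↔ a ∈ S.Δ A) :
      Rel (S.fp R A) (∑ a ∈ F, S.fs R a (S.θ a A) (S.θ_mem_I a A) *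
        S.fsStar R a (S.θ a A) (S.θ_mem_I a A))

/-- The congruence of `R`-algebras generated by the relations. (In a non-unital algebra the
scalar multiples of the relations have to be included.) -/
def con : RingCon (S.FreeAlg R) :=
  ringConGen fun x y => ∃ (r : R) (x' y' : S.FreeAlg R), S.Rel R x' y' ∧ x = r • x' ∧ y = r • y'

theorem con_smul (r : R) {x y : S.FreeAlg R} (h : S.con R x y) : S.con R (r • x) (r • y) := by
  change RingConGen.Rel _ _ _ at h
  change RingConGen.Rel _ _ _
  induction h with
  | of x y h =>
    obtain ⟨t, x', y', h, rfl, rfl⟩ := h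
    exact .of _ _ ⟨r * t, x', y', h, by rw [mul_smul], by rw [mul_smul]⟩
  | refl x => exact .refl _
  | symm _ ih => exact .symm ih
  | trans _ _ ih ih' => exact .trans ih ih'
  | add _ _ ih ih' => rw [smul_add, smul_add]; exact .add ih ih'
  | mul _ h' ih _ => rw [← smul_mul_assoc, ← smul_mul_assoc]; exact .mul ih h'

/-- `L_R(B, L, θ, I)`: the (non-unital, associative) `R`-algebra generated by the symbols `p_A`,
`s_{a,A}`, `s_{a,A}^*` subject to the defining relations. -/
def Alg : Type (max u v w) := (S.con R).Quotient

instance : NonUnitalRing (S.Alg R) := inferInstanceAs (NonUnitalRing (S.con R).Quotient)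

/-- The quotient map from the free algebra. -/
def toAlg (x : S.FreeAlg R) : S.Alg R := ((x : (S.con R).Quotient))

theorem toAlg_surjective : Function.Surjective (S.toAlg R) := Quotient.mk''_surjective

instance : SMul R (S.Alg R) :=
  ⟨fun r => Quotient.map' (fun x => r • x) (fun _ _ h => S.con_smul R r h)⟩

theorem toAlg_smul (r : R) (x : S.FreeAlg R) : S.toAlg R (r • x) = r • S.toAlg R x := rfl
theorem toAlg_add (x y : S.FreeAlg R) : S.toAlg R (x + y) = S.toAlg R x + S.toAlg R y := rfl
theorem toAlg_mul (x y : S.FreeAlg R) : S.toAlg R (x * y) = S.toAlg R x * S.toAlg R y := rfl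
theorem toAlg_zero : S.toAlg R 0 = 0 := rfl

instance : Module R (S.Alg R) where
  one_smul x := by
    obtain ⟨x, rfl⟩ := S.toAlg_surjective R x
    rw [← toAlg_smul, one_smul]
  mul_smul r t x := by
    obtain ⟨x, rfl⟩ := S.toAlg_surjective R x
    simp only [← toAlg_smul, mul_smul]
  smul_zero r := by rw [← toAlg_zero, ← toAlg_smul, smul_zero]
  smul_add r x y := by
    obtain ⟨x, rfl⟩ := S.toAlg_surjective R x
    obtain ⟨y, rfl⟩ := S.toAlg_surjective R y
    simp only [← toAlg_smul, ← toAlg_add, smul_add]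
  add_smul r t x := by
    obtain ⟨x, rfl⟩ := S.toAlg_surjective R x
    simp only [← toAlg_smul, ← toAlg_add, add_smul]
  zero_smul x := by
    obtain ⟨x, rfl⟩ := S.toAlg_surjective R x
    rw [← toAlg_smul, zero_smul, toAlg_zero]

instance : IsScalarTower R (S.Alg R) (S.Alg R) where
  smul_assoc r x y := by
    obtain ⟨x, rfl⟩ := S.toAlg_surjective R x
    obtain ⟨y, rfl⟩ := S.toAlg_surjective R y
    simp only [smul_eq_mul, ← toAlg_smul, ← toAlg_mul, smul_mul_assoc]

instance : SMulCommClass R (S.Alg R) (S.Alg R) where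
  smul_comm r x y := by
    obtain ⟨x, rfl⟩ := S.toAlg_surjective R x
    obtain ⟨y, rfl⟩ := S.toAlg_surjective R y
    simp only [smul_eq_mul, ← toAlg_smul, ← toAlg_mul, mul_smul_comm]

/-! ### Desingularization -/

/-- `X_i`, with respect to the enumeration `e` of the alphabet in which the letter `a` is
`a_{e a + 1}`: the sets `U` without sinks such that `Δ_U ⊆ {a_1, …, a_{i-1}}`. For `i = 0, 1` the
second condition says `Δ_U = ∅`, so that `U = ∅`. -/
def X (e : L ↪ ℕ) (i : ℕ) : Order.Ideal B where
  carrier := {U | S.NoSinks U ∧ ∀ a ∈ S.Δ U, e a + 1 < i}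
  lower' := by
    rintro U V hVU ⟨h, h'⟩
    refine ⟨fun W hW => le_bot_iff.1 ((inf_le_inf_right W hVU).trans (h W hW).le),
      fun a ha => h' a fun hU => ha ?_⟩
    have := (S.θ a).map_inf V U
    rwa [inf_eq_left.2 hVU, hU, inf_bot_eq] at this
  nonempty' := ⟨⊥, fun _ _ => bot_inf_eq _, fun a ha => (ha (S.θ a).map_bot).elim⟩
  directed' := by
    rintro U ⟨hU, hU'⟩ V ⟨hV, hV'⟩
    refine ⟨U ⊔ V, ⟨fun W hW => ?_, fun a ha => ?_⟩, le_sup_left, le_sup_right⟩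
    · rw [inf_sup_right, hU W hW, hV W hW, sup_idem]
    · by_contra h
      refine ha ?_
      rw [(S.θ a).map_sup, not_not.1 fun h1 => h (hU' a h1), not_not.1 fun h1 => h (hV' a h1),
        sup_idem]

theorem mem_X {e : L ↪ ℕ} {i : ℕ} {U : B} :
    U ∈ S.X e i ↔ S.NoSinks U ∧ ∀ a ∈ S.Δ U, e a + 1 < i := Iff.rfl

theorem mem_X_zero {e : L ↪ ℕ} {U : B} : U ∈ S.X e 0 ↔ U = ⊥ := by
  refine ⟨fun ⟨h, h'⟩ => ?_, fun h => h ▸ (S.X e 0).bot_mem⟩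
  rw [← inf_idem U]
  exact h U (Set.eq_empty_of_forall_notMem fun a ha => absurd (h' a ha) (Nat.not_lt_zero _))

theorem X_mono (e : L ↪ ℕ) (i : ℕ) : ∀ U ∈ S.X e i, U ∈ S.X e (i + 1) :=
  fun _ hU => ⟨hU.1, fun a ha => (hU.2 a ha).trans (Nat.lt_succ_self i)⟩

theorem θ_mem_X_zero (e : L ↪ ℕ) (a : L) : ∀ U ∈ S.X e (e a + 1), S.θ a U ∈ S.X e 0 := by
  intro U hU
  rw [mem_X_zero]
  exact not_not.1 fun h => lt_irrefl _ (hU.2 a h)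

/-- `B_i = B / X_i`. -/
abbrev Level (e : L ↪ ℕ) (i : ℕ) : Type v := IdealQuotient (S.X e i)

/-- `B^F = ⨁ i, B / X_i`. -/
abbrev BF (e : L ↪ ℕ) : Type v := FinSum (S.Level e)

/-- `[A]_i`, viewed in the `i`-th level of `B^F`. -/
def cls (e : L ↪ ℕ) (i : ℕ) (A : B) : S.BF e := FinSum.single i (IdealQuotient.mk (S.X e i) A)

/-- The ideal `[K]_i = {[A]_i | A ∈ K}` of `B^F`, for an ideal `K` of `B`. -/
def clsIdeal (e : L ↪ ℕ) (i : ℕ) (K : Order.Ideal B) : Order.Ideal (S.BF e) where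
  carrier := {x | ∃ A ∈ K, x = S.cls e i A}
  lower' := by
    rintro _ y hy ⟨A, hA, rfl⟩
    obtain ⟨C, hC⟩ : ∃ C, y.1 i = IdealQuotient.mk (S.X e i) C :=
      ⟨_, (Quotient.out_eq (s := idealSetoid (S.X e i)) (y.1 i)).symm⟩
    refine ⟨C ⊓ A, K.lower inf_le_right hA, FinSum.ext_iff'.2 fun j => ?_⟩
    have hj := hy j
    change y.1 j ≤ Function.update ⊥ i _ j at hj
    change y.1 j = Function.update ⊥ i _ j
    by_cases h : j = i
    · subst h
      rw [Function.update_self] at hj ⊢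
      rw [← inf_eq_left.2 hj, hC]
      rfl
    · rw [Function.update_of_ne h] at hj ⊢
      exact le_bot_iff.1 hj
  nonempty' := ⟨_, ⊥, K.bot_mem, rfl⟩
  directed' := by
    rintro _ ⟨A, hA, rfl⟩ _ ⟨A', hA', rfl⟩
    have : S.cls e i (A ⊔ A') = S.cls e i A ⊔ S.cls e i A' := FinSum.ext_iff'.2 fun j =>
      FinSum.single_op (B := S.Level e) (fun _ a b => a ⊔ b) (fun _ => sup_idem _) i
        (IdealQuotient.mk (S.X e i) A) (IdealQuotient.mk (S.X e i) A') j
    exact ⟨_, ⟨A ⊔ A', K.sup_mem hA hA', rfl⟩, this ▸ le_sup_left, this ▸ le_sup_right⟩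

/-- The action `θ^F` of the alphabet `L^F = L ∪ {b_1, b_2, …}`, where `Sum.inr n` is `b_{n+1}`:
for the letter `a = a_i` it is `[A]_i ↦ [θ_a A]_0` and `∅` on the other levels; for `b_{n+1}` it is
the quotient map `[A]_n ↦ [A]_{n+1}` and `∅` on the other levels. -/
def θF (e : L ↪ ℕ) : L ⊕ ℕ → GBAHom (S.BF e) (S.BF e)
  | Sum.inl a => FinSum.shift (e a + 1) 0
      (IdealQuotient.map (S.X e (e a + 1)) (S.X e 0) (S.θ a) (S.θ_mem_X_zero e a))
  | Sum.inr n => FinSum.shift n (n + 1)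
      (IdealQuotient.map (S.X e n) (S.X e (n + 1)) (GBAHom.id B) (S.X_mono e n))

/-- The ideals `I^F`: `[I_a]_0` for a letter `a ∈ L`, and all of `B_{n+1}` for `b_{n+1}`. -/
def IF (e : L ↪ ℕ) : L ⊕ ℕ → Order.Ideal (S.BF e)
  | Sum.inl a => S.clsIdeal e 0 (S.I a)
  | Sum.inr n => S.clsIdeal e (n + 1) ⊤

/-- The generalized Boolean dynamical system `(B^F, L^F, θ^F, I^F)`. -/
def desing (e : L ↪ ℕ) : GBDS (S.BF e) (L ⊕ ℕ) where
  θ := S.θF e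
  I := S.IF e
  mem_I := by
    rintro (a | n) A x h
    · refine (S.IF e (Sum.inl a)).lower h ?_
      obtain ⟨C, hC⟩ : ∃ C, x.1 (e a + 1) = IdealQuotient.mk (S.X e (e a + 1)) C :=
        ⟨_, (Quotient.out_eq (s := idealSetoid (S.X e (e a + 1))) (x.1 (e a + 1))).symm⟩
      refine ⟨S.θ a C, S.θ_mem_I a C, ?_⟩
      change FinSum.single (B := S.Level e) 0 (IdealQuotient.map _ _ _ _ (x.1 (e a + 1))) = _
      rw [hC]
      rfl
    · refine (S.IF e (Sum.inr n)).lower h ?_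
      obtain ⟨C, hC⟩ : ∃ C, x.1 n = IdealQuotient.mk (S.X e n) C :=
        ⟨_, (Quotient.out_eq (s := idealSetoid (S.X e n)) (x.1 n)).symm⟩
      refine ⟨C, trivial, ?_⟩
      change FinSum.single (B := S.Level e) (n + 1) (IdealQuotient.map _ _ _ _ (x.1 n)) = _
      rw [hC]
      rfl

theorem desing_θ_inl (e : L ↪ ℕ) (a : L) (A : B) :
    (S.desing e).θ (Sum.inl a) (S.cls e (e a + 1) A) = S.cls e 0 (S.θ a A) := by
  change FinSum.single (B := S.Level e) 0 (IdealQuotient.map _ _ _ _ (Function.update (⊥ : ∀ i, S.Level e i) _ _ _)) = _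
  rw [Function.update_self]
  rfl

theorem desing_θ_inr (e : L ↪ ℕ) (n : ℕ) (A : B) :
    (S.desing e).θ (Sum.inr n) (S.cls e n A) = S.cls e (n + 1) A := by
  change FinSum.single (B := S.Level e) (n + 1) (IdealQuotient.map _ _ _ _ (Function.update (⊥ : ∀ i, S.Level e i) _ _ _)) = _
  rw [Function.update_self]
  rfl

end GBDS

/-! ### Morita equivalence of non-unital algebras -/

/-- A surjective Morita context between two (not necessarily unital) `R`-algebras: an
`A`-`C`-bimodule `M` and a `C`-`A`-bimodule `N`, both unital (`A M = M = M C`, `C N = N = N A`),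
and surjective bimodule maps `φ : M ⊗_C N → A` and `ψ : N ⊗_A M → C` with
`φ(m, n) m' = m ψ(n, m')` and `ψ(n, m) n' = n φ(m, n')`. -/
structure MoritaContext (R : Type u) [CommRing R] (A : Type v) (C : Type w)
    [NonUnitalRing A] [Module R A] [IsScalarTower R A A] [SMulCommClass R A A]
    [NonUnitalRing C] [Module R C] [IsScalarTower R C C] [SMulCommClass R C C] where
  M : Type (max v w)
  N : Type (max v w)
  [addM : AddCommGroup M]
  [modM : Module R M]
  [addN : AddCommGroup N]
  [modN : Module R N]
  /-- the left action `(a, m) ↦ a m` of `A` on `M` -/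
  AM : A →ₗ[R] M →ₗ[R] M
  /-- the right action `(m, c) ↦ m c` of `C` on `M` -/
  MC : M →ₗ[R] C →ₗ[R] M
  /-- the left action `(c, n) ↦ c n` of `C` on `N` -/
  CN : C →ₗ[R] N →ₗ[R] N
  /-- the right action `(n, a) ↦ n a` of `A` on `N` -/
  NA : N →ₗ[R] A →ₗ[R] N
  AM_mul : ∀ a a' m, AM (a * a') m = AM a (AM a' m)
  MC_mul : ∀ m c c', MC m (c * c') = MC (MC m c) c'
  AM_MC : ∀ a m c, MC (AM a m) c = AM a (MC m c)
  CN_mul : ∀ c c' n, CN (c * c') n = CN c (CN c' n)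
  NA_mul : ∀ n a a', NA n (a * a') = NA (NA n a) a'
  CN_NA : ∀ c n a, NA (CN c n) a = CN c (NA n a)
  AM_unital : Submodule.span R {x | ∃ a m, x = AM a m} = ⊤
  MC_unital : Submodule.span R {x | ∃ m c, x = MC m c} = ⊤
  CN_unital : Submodule.span R {x | ∃ c n, x = CN c n} = ⊤
  NA_unital : Submodule.span R {x | ∃ n a, x = NA n a} = ⊤
  φ : M →ₗ[R] N →ₗ[R] A
  ψ : N →ₗ[R] M →ₗ[R] C
  φ_balanced : ∀ m c n, φ (MC m c) n = φ m (CN c n)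
  φ_left : ∀ a m n, φ (AM a m) n = a * φ m n
  φ_right : ∀ m n a, φ m (NA n a) = φ m n * a
  ψ_balanced : ∀ n a m, ψ (NA n a) m = ψ n (AM a m)
  ψ_left : ∀ c n m, ψ (CN c n) m = c * ψ n m
  ψ_right : ∀ n m c, ψ n (MC m c) = ψ n m * c
  φ_ψ : ∀ m n m', AM (φ m n) m' = MC m (ψ n m')
  ψ_φ : ∀ n m n', CN (ψ n m) n' = NA n (φ m n')
  φ_surjective : Submodule.span R {x | ∃ m n, x = φ m n} = ⊤
  ψ_surjective : Submodule.span R {x | ∃ n m, x = ψ n m} = ⊤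

/-- Morita equivalence of `R`-algebras, in the form used for idempotent rings and rings with local
units, where there need not be a unit: existence of a surjective Morita context. -/
def MoritaEquivalent (R : Type u) [CommRing R] (A : Type v) (C : Type w)
    [NonUnitalRing A] [Module R A] [IsScalarTower R A A] [SMulCommClass R A A]
    [NonUnitalRing C] [Module R C] [IsScalarTower R C C] [SMulCommClass R C C] : Prop :=
  Nonempty (MoritaContext.{u, v, w} R A C)

end BooleanDynamics

end

noncomputable section

namespace BooleanDynamics

universe u v w x y

namespace GBDS

variable {B : Type v} {L : Type w} [GeneralizedBooleanAlgebra B] (S : GBDS B L)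
variable (R : Type u) [CommRing R]

/-! ### Representations and the universal property -/

/-! Both algebras contain the algebra of one auxiliary system `S.min` as a full corner, and algebras
with a common full corner are Morita equivalent. In `S.min` the action is unchanged, but every ideal
is shrunk to the sets `C` that lie below some `θ_a A`. Then `p_A s_{a,C} = s_{a,C}` for such an `A`,
so the `p_D` with `D` large are local units of its algebra. In the algebra of `S` this can fail,
because `p_D s_{a,C} = s_{a, C ∩ θ_a D}`.

In the desingularization the letter `a_i` is replaced by the path `b_1 ⋯ b_i a_i`, which starts and
ends at level zero. Its label has to be some `A` with `C ⊆ θ_a A`, so the level-zero corner receives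
exactly the generators of `S.min` (`cornerRep`). The Cuntz–Krieger relation of the corner comes from
iterating `p = s_b s_b^* + s_a s_a^*` along the levels (`pc_zero_eq`). The remainder after `n` steps
vanishes on `X_n`, and the regular sets are the union of the `X_n`.

Conversely the desingularization is represented by matrices over the algebra of `S` (`matRep`):
`p_{[A]_i}` goes to the diagonal entry `p_A - ∑_{j < i} s_{a_j} s_{a_j}^*`, which depends only on
`[A]_i` by the Cuntz–Krieger relation of `S` (`gap_eq_zero`). On the corner this representation is
the map from the algebra of `S.min` to that of `S`, placed at `(0, 0)` (`matHom_cornerHom`).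

That map is injective (`minHom_injective`), since a module over the algebra of `S` can be built on
which the subalgebra acts faithfully. As the corner is full (`mem_sandwich_cornerHom`), the matrix
representation is injective too (`matHom_injective`). Now both algebras are subspaces `T` and `F` of
one unital ring and share the corner `Q`. The bimodules are `T Q F` and `F Q T`, and all maps of the
Morita context are multiplication. -/

/-- A representation of a generalized Boolean dynamical system in a non-unital ring: elements
that satisfy the defining relations of `L_R(B, L, θ, I)`. -/
structure Rep (A : Type x) [NonUnitalRing A] where
  p : B → A
  s : ∀ (a : L) (C : B), C ∈ S.I a → A
  t : ∀ (a : L) (C : B), C ∈ S.I a → A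
  p_bot : p ⊥ = 0
  p_inf : ∀ C D, p (C ⊓ D) = p C * p D
  p_sup : ∀ C D, p (C ⊔ D) = p C + p D - p (C ⊓ D)
  p_s : ∀ D a C hC, p D * s a C hC = s a C hC * p (S.θ a D)
  t_p : ∀ D a C hC, t a C hC * p D = p (S.θ a D) * t a C hC
  t_s_self : ∀ a C D hC hD, t a C hC * s a D hD = p (C ⊓ D)
  t_s_ne : ∀ a b, a ≠ b → ∀ C D hC hD, t a C hC * s b D hD = 0
  s_p : ∀ a C D hC, s a C hC * p D = s a (C ⊓ D) (S.inf_mem_I hC D)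
  p_t : ∀ a C D hC, p D * t a C hC = t a (C ⊓ D) (S.inf_mem_I hC D)
  cuntzKrieger : ∀ C ∈ S.regular, ∀ F : Finset L, (∀ a, a ∈ F ↔ a ∈ S.Δ C) →
    p C = ∑ a ∈ F, s a (S.θ a C) (S.θ_mem_I a C) * t a (S.θ a C) (S.θ_mem_I a C)

namespace Rep

variable {S} {A : Type x} [NonUnitalRing A] [Module R A] [IsScalarTower R A A]
  [SMulCommClass R A A] (ρ : S.Rep A)

/-- The image of a generator. -/
def onGen : S.Gen → A
  | .p C => ρ.p C
  | .s a C => ρ.s a C.1 C.2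
  | .sStar a C => ρ.t a C.1 C.2

/-- The extension to the free algebra. -/
def freeLift : S.FreeAlg R →ₙₐ[R] A := MonoidAlgebra.liftMagma R (FreeSemigroup.lift ρ.onGen)

theorem freeLift_single (g : S.Gen) :
    ρ.freeLift R (MonoidAlgebra.single (FreeSemigroup.of g) 1) = ρ.onGen g := by
  simp [freeLift, MonoidAlgebra.liftMagma]

theorem freeLift_fp (C : B) : ρ.freeLift R (S.fp R C) = ρ.p C := ρ.freeLift_single R _
theorem freeLift_fs (a : L) (C : B) (h) : ρ.freeLift R (S.fs R a C h) = ρ.s a C h :=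
  ρ.freeLift_single R _
theorem freeLift_fsStar (a : L) (C : B) (h) : ρ.freeLift R (S.fsStar R a C h) = ρ.t a C h :=
  ρ.freeLift_single R _

theorem freeLift_rel {x y : S.FreeAlg R} (h : S.Rel R x y) :
    ρ.freeLift R x = ρ.freeLift R y := by
  cases h <;> simp only [map_mul, map_add, map_sub, map_zero, map_sum, freeLift_fp, freeLift_fs,
    freeLift_fsStar]
  · exact ρ.p_bot
  · exact ρ.p_inf _ _
  · exact ρ.p_sup _ _
  · exact ρ.p_s _ _ _ _
  · exact ρ.t_p _ _ _ _
  · exact ρ.t_s_self _ _ _ _ _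
  · exact ρ.t_s_ne _ _ ‹_› _ _ _ _
  · exact ρ.s_p _ _ _ _
  · exact ρ.p_t _ _ _ _
  · exact ρ.cuntzKrieger _ ‹_› _ ‹_›

theorem freeLift_con {x y : S.FreeAlg R} (h : S.con R x y) :
    ρ.freeLift R x = ρ.freeLift R y := by
  change RingConGen.Rel _ _ _ at h
  induction h with
  | of x y h =>
    obtain ⟨r, x', y', h, rfl, rfl⟩ := h
    rw [map_smul, map_smul, ρ.freeLift_rel R h]
  | refl x => rfl
  | symm _ ih => exact ih.symm
  | trans _ _ ih ih' => exact ih.trans ih'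
  | add _ _ ih ih' => rw [map_add, map_add, ih, ih']
  | mul _ _ ih ih' => rw [map_mul, map_mul, ih, ih']

/-- The universal property of `L_R(B, L, θ, I)`. -/
def lift : S.Alg R →ₙₐ[R] A where
  toFun := Quotient.lift (ρ.freeLift R) (fun _ _ h => ρ.freeLift_con R h)
  map_smul' r x := by
    obtain ⟨x, rfl⟩ := S.toAlg_surjective R x
    exact map_smul (ρ.freeLift R) r x
  map_zero' := map_zero (ρ.freeLift R)
  map_add' x y := by
    obtain ⟨x, rfl⟩ := S.toAlg_surjective R x
    obtain ⟨y, rfl⟩ := S.toAlg_surjective R y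
    exact map_add (ρ.freeLift R) x y
  map_mul' x y := by
    obtain ⟨x, rfl⟩ := S.toAlg_surjective R x
    obtain ⟨y, rfl⟩ := S.toAlg_surjective R y
    exact map_mul (ρ.freeLift R) x y

end Rep

/-! ### The generators of the algebra -/

/-- The generator `p_A` of `L_R(B, L, θ, I)`. -/
def P (A : B) : S.Alg R := S.toAlg R (S.fp R A)

/-- The generator `s_{a,A}` of `L_R(B, L, θ, I)`. -/
def s (a : L) (A : B) (h : A ∈ S.I a) : S.Alg R := S.toAlg R (S.fs R a A h)

/-- The generator `s_{a,A}^*` of `L_R(B, L, θ, I)`. -/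
def t (a : L) (A : B) (h : A ∈ S.I a) : S.Alg R := S.toAlg R (S.fsStar R a A h)

theorem toAlg_sum {ι : Type*} (F : Finset ι) (f : ι → S.FreeAlg R) :
    S.toAlg R (∑ i ∈ F, f i) = ∑ i ∈ F, S.toAlg R (f i) :=
  map_sum (⟨⟨S.toAlg R, S.toAlg_zero R⟩, S.toAlg_add R⟩ : S.FreeAlg R →+ S.Alg R) f F

theorem toAlg_eq {x y : S.FreeAlg R} (h : S.Rel R x y) : S.toAlg R x = S.toAlg R y :=
  Quotient.sound (s := (S.con R).toSetoid)
    (RingConGen.Rel.of x y ⟨1, x, y, h, (one_smul _ _).symm, (one_smul _ _).symm⟩)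

/-- The generators of the algebra form a representation. -/
def univ : S.Rep (S.Alg R) where
  p := S.P R
  s := S.s R
  t := S.t R
  p_bot := S.toAlg_eq R .p_bot
  p_inf C D := S.toAlg_eq R (.p_inf C D)
  p_sup C D := S.toAlg_eq R (.p_sup C D)
  p_s D a C hC := S.toAlg_eq R (.p_s D a C hC)
  t_p D a C hC := S.toAlg_eq R (.sStar_p D a C hC)
  t_s_self a C D hC hD := S.toAlg_eq R (.sStar_s_self a C D hC hD)
  t_s_ne a b h C D hC hD := S.toAlg_eq R (.sStar_s_ne a b h C D hC hD)
  s_p a C D hC := S.toAlg_eq R (.s_p a C D hC)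
  p_t a C D hC := S.toAlg_eq R (.p_sStar a C D hC)
  cuntzKrieger C hC F hF := (S.toAlg_eq R (.cuntzKrieger C hC F hF)).trans (S.toAlg_sum R F _)

variable {R} in
@[simp] theorem Rep.lift_P {S : GBDS B L} {A : Type x} [NonUnitalRing A] [Module R A]
    [IsScalarTower R A A] [SMulCommClass R A A] (ρ : S.Rep A) (C : B) :
    ρ.lift R (S.P R C) = ρ.p C := ρ.freeLift_fp R C

variable {R} in
@[simp] theorem Rep.lift_s {S : GBDS B L} {A : Type x} [NonUnitalRing A] [Module R A]
    [IsScalarTower R A A] [SMulCommClass R A A] (ρ : S.Rep A) (a : L) (C : B) (h) :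
    ρ.lift R (S.s R a C h) = ρ.s a C h := ρ.freeLift_fs R a C h

variable {R} in
@[simp] theorem Rep.lift_t {S : GBDS B L} {A : Type x} [NonUnitalRing A] [Module R A]
    [IsScalarTower R A A] [SMulCommClass R A A] (ρ : S.Rep A) (a : L) (C : B) (h) :
    ρ.lift R (S.t R a C h) = ρ.t a C h := ρ.freeLift_fsStar R a C h

theorem P_bot : S.P R ⊥ = 0 := (S.univ R).p_bot
theorem P_mul_P (C D : B) : S.P R C * S.P R D = S.P R (C ⊓ D) := ((S.univ R).p_inf C D).symm
theorem P_sup (C D : B) : S.P R (C ⊔ D) = S.P R C + S.P R D - S.P R (C ⊓ D) :=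
  (S.univ R).p_sup C D
theorem P_mul_s (D : B) (a : L) (C : B) (hC : C ∈ S.I a) :
    S.P R D * S.s R a C hC = S.s R a (C ⊓ S.θ a D) (S.inf_mem_I hC _) :=
  ((S.univ R).p_s D a C hC).trans ((S.univ R).s_p _ _ _ _)
theorem t_mul_P (D : B) (a : L) (C : B) (hC : C ∈ S.I a) :
    S.t R a C hC * S.P R D = S.t R a (C ⊓ S.θ a D) (S.inf_mem_I hC _) :=
  ((S.univ R).t_p D a C hC).trans ((S.univ R).p_t _ _ _ _)
theorem s_mul_P (D : B) (a : L) (C : B) (hC : C ∈ S.I a) :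
    S.s R a C hC * S.P R D = S.s R a (C ⊓ D) (S.inf_mem_I hC _) := (S.univ R).s_p _ _ _ _
theorem P_mul_t (D : B) (a : L) (C : B) (hC : C ∈ S.I a) :
    S.P R D * S.t R a C hC = S.t R a (C ⊓ D) (S.inf_mem_I hC _) := (S.univ R).p_t _ _ _ _
theorem t_mul_s_self (a : L) (C D : B) (hC : C ∈ S.I a) (hD : D ∈ S.I a) :
    S.t R a C hC * S.s R a D hD = S.P R (C ⊓ D) := (S.univ R).t_s_self _ _ _ _ _
theorem t_mul_s_ne {a b : L} (h : a ≠ b) (C D : B) (hC : C ∈ S.I a) (hD : D ∈ S.I b) :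
    S.t R a C hC * S.s R b D hD = 0 := (S.univ R).t_s_ne _ _ h _ _ _ _

theorem s_congr {a : L} {C D : B} (h : C = D) (hC : C ∈ S.I a) (hD : D ∈ S.I a) :
    S.s R a C hC = S.s R a D hD := by subst h; rfl

theorem t_congr {a : L} {C D : B} (h : C = D) (hC : C ∈ S.I a) (hD : D ∈ S.I a) :
    S.t R a C hC = S.t R a D hD := by subst h; rfl

theorem s_bot (a : L) : S.s R a ⊥ (S.I a).bot_mem = 0 := by
  rw [S.s_congr R (inf_bot_eq ⊥).symm _ (S.inf_mem_I (S.I a).bot_mem _), ← s_mul_P, P_bot,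
    mul_zero]
  exact (S.I a).bot_mem

theorem t_bot (a : L) : S.t R a ⊥ (S.I a).bot_mem = 0 := by
  rw [S.t_congr R (inf_bot_eq ⊥).symm _ (S.inf_mem_I (S.I a).bot_mem _), ← P_mul_t, P_bot,
    zero_mul]
  exact (S.I a).bot_mem

theorem s_eq_zero {a : L} {C : B} (h : C = ⊥) (hC : C ∈ S.I a) : S.s R a C hC = 0 := by
  subst h; exact S.s_bot R a

theorem t_eq_zero {a : L} {C : B} (h : C = ⊥) (hC : C ∈ S.I a) : S.t R a C hC = 0 := by
  subst h; exact S.t_bot R a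

theorem s_mul_P_of_le {a : L} {C D : B} (hC : C ∈ S.I a) (h : C ≤ D) :
    S.s R a C hC * S.P R D = S.s R a C hC :=
  (S.s_mul_P R D a C hC).trans (S.s_congr R (inf_eq_left.2 h) _ _)

theorem P_mul_t_of_le {a : L} {C D : B} (hC : C ∈ S.I a) (h : C ≤ D) :
    S.P R D * S.t R a C hC = S.t R a C hC :=
  (S.P_mul_t R D a C hC).trans (S.t_congr R (inf_eq_left.2 h) _ _)

theorem P_mul_s_of_le {a : L} {C D : B} (hC : C ∈ S.I a) (h : C ≤ S.θ a D) :
    S.P R D * S.s R a C hC = S.s R a C hC :=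
  (S.P_mul_s R D a C hC).trans (S.s_congr R (inf_eq_left.2 h) _ _)

theorem t_mul_P_of_le {a : L} {C D : B} (hC : C ∈ S.I a) (h : C ≤ S.θ a D) :
    S.t R a C hC * S.P R D = S.t R a C hC :=
  (S.t_mul_P R D a C hC).trans (S.t_congr R (inf_eq_left.2 h) _ _)

theorem P_mul_P_of_le {C D : B} (h : C ≤ D) : S.P R C * S.P R D = S.P R C := by
  rw [P_mul_P, inf_eq_left.2 h]

theorem P_mul_P_of_ge {C D : B} (h : D ≤ C) : S.P R C * S.P R D = S.P R D := by
  rw [P_mul_P, inf_eq_right.2 h]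

/-- The image of a generator in the algebra. -/
def gen : S.Gen → S.Alg R
  | .p C => S.P R C
  | .s a C => S.s R a C.1 C.2
  | .sStar a C => S.t R a C.1 C.2

/-- Induction over the algebra along left multiplication by generators. -/
theorem alg_induction {motive : S.Alg R → Prop} (hp : ∀ C, motive (S.P R C))
    (hs : ∀ a C hC, motive (S.s R a C hC)) (ht : ∀ a C hC, motive (S.t R a C hC))
    (hmul : ∀ x y, motive x → motive y → motive (x * y))
    (hadd : ∀ x y, motive x → motive y → motive (x + y))
    (hsmul : ∀ (r : R) x, motive x → motive (r • x)) (z : S.Alg R) : motive z := by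
  have h0 : motive 0 := by simpa using hsmul 0 _ (hp ⊥)
  obtain ⟨z, rfl⟩ := S.toAlg_surjective R z
  induction z using MonoidAlgebra.induction_linear with
  | zero => exact h0
  | add f g hf hg => exact hadd _ _ hf hg
  | single m r =>
    have : (MonoidAlgebra.single m r : S.FreeAlg R) = r • MonoidAlgebra.single m 1 := by
      simp
    rw [this, toAlg_smul]
    clear this
    refine hsmul _ _ ?_
    have hg : ∀ g : S.Gen,
        motive (S.toAlg R (MonoidAlgebra.single (FreeSemigroup.of g) 1)) := by
      rintro (C | ⟨a, C⟩ | ⟨a, C⟩)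
      · exact hp C
      · exact hs a C.1 C.2
      · exact ht a C.1 C.2
    induction m using FreeSemigroup.recOnMul with
    | ih1 g => exact hg g
    | ih2 g m _ ih =>
      have : (MonoidAlgebra.single (FreeSemigroup.of g * m) 1 : S.FreeAlg R) =
        MonoidAlgebra.single (FreeSemigroup.of g) 1 * MonoidAlgebra.single m 1 := by
        simp [MonoidAlgebra.single_mul_single]
      rw [this, toAlg_mul]
      exact hmul _ _ (hg g) ih

/-- A submodule that contains the generators and is stable under left multiplication by them is
everything. -/
theorem mem_of_left_stable (X : Submodule R (S.Alg R)) (hg : ∀ g, S.gen R g ∈ X)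
    (hX : ∀ g, ∀ x ∈ X, S.gen R g * x ∈ X) (z : S.Alg R) : z ∈ X := by
  -- Stability is carried along with membership: for a product `x * y`, the factor `x` has to
  -- stabilize `X` while `y` lies in it.
  have key : ∀ z : S.Alg R, z ∈ X ∧ ∀ x ∈ X, z * x ∈ X := by
    intro z
    induction z using S.alg_induction R with
    | hp C => exact ⟨hg (.p C), hX (.p C)⟩
    | hs a C hC => exact ⟨hg (.s a ⟨C, hC⟩), hX (.s a ⟨C, hC⟩)⟩
    | ht a C hC => exact ⟨hg (.sStar a ⟨C, hC⟩), hX (.sStar a ⟨C, hC⟩)⟩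
    | hmul x y hx hy =>
      exact ⟨hx.2 _ hy.1, fun z hz => by rw [mul_assoc]; exact hx.2 _ (hy.2 _ hz)⟩
    | hadd x y hx hy =>
      exact ⟨X.add_mem hx.1 hy.1, fun z hz => by
        rw [add_mul]; exact X.add_mem (hx.2 _ hz) (hy.2 _ hz)⟩
    | hsmul r x hx =>
      exact ⟨X.smul_mem r hx.1, fun z hz => by
        rw [smul_mul_assoc]; exact X.smul_mem r (hx.2 _ hz)⟩
  exact (key z).1

/-! ### Local units -/

theorem commute_P_sst (A : B) (a : L) (C : B) (hC : C ∈ S.I a) :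
    S.P R A * (S.s R a C hC * S.t R a C hC) = S.s R a C hC * S.t R a C hC * S.P R A := by
  rw [mul_assoc, (S.univ R).t_p A a C hC |> (show S.t R a C hC * S.P R A = _ from ·),
    ← mul_assoc, ← mul_assoc]
  congr 1
  exact (S.univ R).p_s A a C hC

/-- The commuting idempotents `p_A` and `s_{a,C} s_{a,C}^*`. -/
def diagonal : Set (S.Alg R) :=
  {x | (∃ A, x = S.P R A) ∨ ∃ a C hC, x = S.s R a C hC * S.t R a C hC}

/-- For one letter the product of two range projections is the one of `C ∩ C'`, which is symmetric;
for distinct letters it is zero. Commutation is what allows local units to be combined. -/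
theorem diagonal_comm : ∀ x ∈ S.diagonal R, ∀ y ∈ S.diagonal R, x * y = y * x := by
  rintro _ (⟨A, rfl⟩ | ⟨a, C, hC, rfl⟩) _ (⟨A', rfl⟩ | ⟨a', C', hC', rfl⟩)
  · rw [P_mul_P, P_mul_P, inf_comm]
  · exact S.commute_P_sst R _ _ _ _
  · exact (S.commute_P_sst R _ _ _ _).symm
  · by_cases h : a = a'
    · subst h
      have : ∀ C C' (hC : C ∈ S.I a) (hC' : C' ∈ S.I a),
          S.s R a C hC * S.t R a C hC * (S.s R a C' hC' * S.t R a C' hC') =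
            S.s R a (C ⊓ C') (S.inf_mem_I hC _) * S.t R a (C ⊓ C') (S.inf_mem_I hC _) := by
        intro C C' hC hC'
        rw [mul_assoc, ← mul_assoc (S.t R a C hC), t_mul_s_self, P_mul_t,
          ← S.s_mul_P R C' a C hC, mul_assoc, P_mul_t]
        congr 1
        exact S.t_congr R (by rw [inf_comm C', inf_assoc, inf_idem]) _ _
      rw [this, this]
      congr 1
      · exact S.s_congr R (inf_comm _ _) _ _
      · exact S.t_congr R (inf_comm _ _) _ _
    · rw [mul_assoc, ← mul_assoc (S.t R a C hC), S.t_mul_s_ne R h, mul_assoc,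
        ← mul_assoc (S.t R a' C' hC'), S.t_mul_s_ne R (Ne.symm h)]
      simp

theorem closure_diagonal_comm (x y : S.Alg R)
    (hx : x ∈ NonUnitalSubring.closure (S.diagonal R))
    (hy : y ∈ NonUnitalSubring.closure (S.diagonal R)) : x * y = y * x := by
  have := NonUnitalSubring.isMulCommutative_closure (S.diagonal_comm R)
  exact congrArg Subtype.val
    (mul_comm' (⟨x, hx⟩ : NonUnitalSubring.closure (S.diagonal R)) ⟨y, hy⟩)

theorem sst_mul_s (a : L) (C : B) (hC : C ∈ S.I a) :
    S.s R a C hC * S.t R a C hC * S.s R a C hC = S.s R a C hC := by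
  rw [mul_assoc, t_mul_s_self, inf_idem, S.s_mul_P_of_le R hC le_rfl]

theorem t_mul_sst (a : L) (C : B) (hC : C ∈ S.I a) :
    S.t R a C hC * (S.s R a C hC * S.t R a C hC) = S.t R a C hC := by
  rw [← mul_assoc, t_mul_s_self, inf_idem, S.P_mul_t_of_le R hC le_rfl]

/-- Generators have local units because `s s^* s = s`. If `e` and `f` fix two elements from the left
and commute, then `e + f - f e` fixes their sum; hence the units are kept inside the commutative
subring generated by the diagonal. -/
theorem exists_local_unit (x : S.Alg R) :
    (∃ e ∈ NonUnitalSubring.closure (S.diagonal R), e * x = x) ∧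
      ∃ e ∈ NonUnitalSubring.closure (S.diagonal R), x * e = x := by
  have hP : ∀ A, S.P R A ∈ NonUnitalSubring.closure (S.diagonal R) := fun A =>
    NonUnitalSubring.subset_closure (Or.inl ⟨A, rfl⟩)
  have hst : ∀ a C hC, S.s R a C hC * S.t R a C hC ∈ NonUnitalSubring.closure (S.diagonal R) :=
    fun a C hC => NonUnitalSubring.subset_closure (Or.inr ⟨a, C, hC, rfl⟩)
  induction x using S.alg_induction R with
  | hp C =>
    exact ⟨⟨_, hP C, S.P_mul_P_of_le R le_rfl⟩, ⟨_, hP C, S.P_mul_P_of_le R le_rfl⟩⟩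
  | hs a C hC => exact ⟨⟨_, hst a C hC, S.sst_mul_s R a C hC⟩, ⟨_, hP C, S.s_mul_P_of_le R hC le_rfl⟩⟩
  | ht a C hC => exact ⟨⟨_, hP C, S.P_mul_t_of_le R hC le_rfl⟩, ⟨_, hst a C hC, S.t_mul_sst R a C hC⟩⟩
  | hmul x y hx hy =>
    obtain ⟨⟨e, he, hex⟩, -⟩ := hx
    obtain ⟨-, ⟨f, hf, hfy⟩⟩ := hy
    exact ⟨⟨e, he, by rw [← mul_assoc, hex]⟩, ⟨f, hf, by rw [mul_assoc, hfy]⟩⟩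
  | hadd x y hx hy =>
    obtain ⟨⟨e, he, hex⟩, ⟨e', he', hex'⟩⟩ := hx
    obtain ⟨⟨f, hf, hfy⟩, ⟨f', hf', hfy'⟩⟩ := hy
    refine ⟨⟨e + f - f * e, sub_mem (add_mem he hf) (mul_mem hf he), ?_⟩,
      ⟨e' + f' - e' * f', sub_mem (add_mem he' hf') (mul_mem he' hf'), ?_⟩⟩
    · have h1 : f * e * y = e * y := by
        rw [S.closure_diagonal_comm R f e hf he, mul_assoc, hfy]
      rw [mul_add, sub_mul, sub_mul, add_mul, add_mul, h1, hfy, mul_assoc, hex]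
      abel
    · have h1 : y * (e' * f') = y * e' := by
        rw [S.closure_diagonal_comm R e' f' he' hf', ← mul_assoc, hfy']
      rw [add_mul, mul_sub, mul_sub, mul_add, mul_add, h1, hfy', ← mul_assoc, hex']
      abel
  | hsmul r x hx =>
    obtain ⟨⟨e, he, hex⟩, ⟨e', he', hex'⟩⟩ := hx
    exact ⟨⟨e, he, by rw [mul_smul_comm, hex]⟩, ⟨e', he', by rw [smul_mul_assoc, hex']⟩⟩

end GBDS

namespace GBDS

variable {B : Type v} {L : Type w} [GeneralizedBooleanAlgebra B] (S : GBDS B L)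
variable (R : Type u) [CommRing R]

/-! ### The system with minimal ideals -/

theorem θ_mono (a : L) {A A' : B} (h : A ≤ A') : S.θ a A ≤ S.θ a A' := by
  rw [← inf_eq_left, ← (S.θ a).map_inf, inf_eq_left.2 h]

/-- The same action with the smallest possible ideals `{C | ∃ A, C ⊆ θ a A}`. -/
def min : GBDS B L where
  θ := S.θ
  I a :=
    { carrier := {C | ∃ A, C ≤ S.θ a A}
      lower' := fun _ _ h ⟨A, hA⟩ => ⟨A, h.trans hA⟩
      nonempty' := ⟨⊥, ⊥, bot_le⟩
      directed' := fun C ⟨A, hA⟩ C' ⟨A', hA'⟩ => ⟨C ⊔ C',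
        ⟨A ⊔ A', by rw [(S.θ a).map_sup]; exact sup_le_sup hA hA'⟩, le_sup_left, le_sup_right⟩ }
  mem_I _ _ A' h := ⟨A', h⟩

theorem mem_min_I {a : L} {A C : B} (h : C ≤ S.θ a A) : C ∈ S.min.I a := ⟨A, h⟩

theorem min_I_le {a : L} {C : B} (h : C ∈ S.min.I a) : C ∈ S.I a :=
  let ⟨A, hA⟩ := h
  S.mem_I a C A hA

/-- The representation of `S.min` in the algebra of `S`. -/
def minRep : S.min.Rep (S.Alg R) where
  p := S.P R
  s a C h := S.s R a C (S.min_I_le h)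
  t a C h := S.t R a C (S.min_I_le h)
  p_bot := S.P_bot R
  p_inf C D := (S.P_mul_P R C D).symm
  p_sup C D := S.P_sup R C D
  p_s _ _ _ _ := (S.univ R).p_s _ _ _ _
  t_p _ _ _ _ := (S.univ R).t_p _ _ _ _
  t_s_self _ _ _ _ _ := (S.univ R).t_s_self _ _ _ _ _
  t_s_ne _ _ h _ _ _ _ := (S.univ R).t_s_ne _ _ h _ _ _ _
  s_p _ _ _ _ := (S.univ R).s_p _ _ _ _
  p_t _ _ _ _ := (S.univ R).p_t _ _ _ _
  cuntzKrieger C hC F hF := (S.univ R).cuntzKrieger C hC F hF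

/-- The homomorphism `L_R(S.min) → L_R(S)`. -/
def minHom : S.min.Alg R →ₙₐ[R] S.Alg R := (S.minRep R).lift R

/-! ### A module that detects the algebra of `S.min` -/

/-- The space of families `(p_A w)_A`, `(s_{a,C}^* w)_{a,C}`, where `C` runs over all of the ideal
`I a`, with values in the algebra of `S.min`. -/
def familySubmodule : Submodule R ((B → S.min.Alg R) × (∀ a, {C // C ∈ S.I a} → S.min.Alg R)) where
  -- The conditions are the relations that `p_A w` and `s_{a,C}^* w` satisfy for a vector `w` of a
  -- module. The last one reads `s_{a,C}^* p_A = s_{a,C}^*` for `C ⊆ θ_a A`. The components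
  -- `s_{a,C}^* w` with `C` outside the minimal ideal are independent data, not determined by the
  -- `p_A w`.
  carrier := {w | (∀ A A', S.min.P R A * w.1 A' = w.1 (A' ⊓ A)) ∧
    (∀ a C A (hC : C ∈ S.I a),
      S.min.P R A * w.2 a ⟨C, hC⟩ = w.2 a ⟨C ⊓ A, S.inf_mem_I hC A⟩) ∧
    ∀ a A C (h : C ≤ S.θ a A),
      S.min.t R a C (S.mem_min_I h) * w.1 A = w.2 a ⟨C, S.mem_I a C A h⟩}
  add_mem' := by
    rintro x y ⟨h1, h2, h3⟩ ⟨h1', h2', h3'⟩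
    exact ⟨fun A A' => by simp [mul_add, h1, h1'], fun a C A hC => by simp [mul_add, h2, h2'],
      fun a A C h => (mul_add _ _ _).trans (congrArg₂ _ (h3 a A C h) (h3' a A C h))⟩
  zero_mem' := by simp
  smul_mem' := by
    rintro r x ⟨h1, h2, h3⟩
    exact ⟨fun A A' => by simp [mul_smul_comm, h1], fun a C A hC => by simp [mul_smul_comm, h2],
      fun a A C h => (mul_smul_comm _ _ _).trans (congrArg (r • ·) (h3 a A C h))⟩

/-- The space of families, as a type. -/
def FamilySpace : Type (max u v w) := S.familySubmodule R

instance : AddCommGroup (S.FamilySpace R) := inferInstanceAs (AddCommGroup (S.familySubmodule R))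
instance : Module R (S.FamilySpace R) := inferInstanceAs (Module R (S.familySubmodule R))

namespace FamilySpace

variable {S R} (w : S.FamilySpace R)

/-- The component `p_A w`. -/
def f (A : B) : S.min.Alg R := w.1.1 A

/-- The component `s_{a,C}^* w`. -/
def g (a : L) (C : B) (hC : C ∈ S.I a) : S.min.Alg R := w.1.2 a ⟨C, hC⟩

theorem P_mul_f (A A' : B) : S.min.P R A * w.f A' = w.f (A' ⊓ A) := w.2.1 A A'

theorem P_mul_g (a : L) (C A : B) (hC : C ∈ S.I a) :
    S.min.P R A * w.g a C hC = w.g a (C ⊓ A) (S.inf_mem_I hC A) := w.2.2.1 a C A hC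

theorem t_mul_f (a : L) (A C : B) (h : C ≤ S.θ a A) :
    S.min.t R a C (S.mem_min_I h) * w.f A = w.g a C (S.mem_I a C A h) := w.2.2.2 a A C h

theorem g_congr {a : L} {C D : B} (h : C = D) (hC : C ∈ S.I a) (hD : D ∈ S.I a) :
    w.g a C hC = w.g a D hD := by subst h; rfl

@[ext] theorem ext {w w' : S.FamilySpace R} (hf : ∀ A, w.f A = w'.f A)
    (hg : ∀ a C hC, w.g a C hC = w'.g a C hC) : w = w' :=
  Subtype.ext (Prod.ext (funext hf) (funext fun a => funext fun C => hg a C.1 C.2))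

@[simp] theorem add_f (w w' : S.FamilySpace R) (A : B) : (w + w').f A = w.f A + w'.f A := rfl
@[simp] theorem smul_f (r : R) (w : S.FamilySpace R) (A : B) : (r • w).f A = r • w.f A := rfl
@[simp] theorem sub_f (w w' : S.FamilySpace R) (A : B) : (w - w').f A = w.f A - w'.f A := rfl
@[simp] theorem zero_f (A : B) : (0 : S.FamilySpace R).f A = 0 := rfl
@[simp] theorem add_g (w w' : S.FamilySpace R) (a : L) (C : B) (hC : C ∈ S.I a) :
    (w + w').g a C hC = w.g a C hC + w'.g a C hC := rfl
@[simp] theorem sub_g (w w' : S.FamilySpace R) (a : L) (C : B) (hC : C ∈ S.I a) :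
    (w - w').g a C hC = w.g a C hC - w'.g a C hC := rfl
@[simp] theorem smul_g (r : R) (w : S.FamilySpace R) (a : L) (C : B) (hC : C ∈ S.I a) :
    (r • w).g a C hC = r • w.g a C hC := rfl
@[simp] theorem zero_g (a : L) (C : B) (hC : C ∈ S.I a) : (0 : S.FamilySpace R).g a C hC = 0 := rfl

theorem sum_f {ι : Type*} (F : Finset ι) (w : ι → S.FamilySpace R) (A : B) :
    (∑ i ∈ F, w i).f A = ∑ i ∈ F, (w i).f A :=
  map_sum (⟨⟨fun w => w.f A, rfl⟩, fun _ _ => rfl⟩ : S.FamilySpace R →+ S.min.Alg R) w F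

theorem sum_g {ι : Type*} (F : Finset ι) (w : ι → S.FamilySpace R) (a : L) (C : B)
    (hC : C ∈ S.I a) : (∑ i ∈ F, w i).g a C hC = ∑ i ∈ F, (w i).g a C hC :=
  map_sum (⟨⟨fun w => w.g a C hC, rfl⟩, fun _ _ => rfl⟩ : S.FamilySpace R →+ S.min.Alg R) w F

theorem f_bot : w.f ⊥ = 0 := by
  rw [← inf_bot_eq ⊥, ← P_mul_f, P_bot, zero_mul]

theorem g_eq_zero {a : L} {C : B} (h : C = ⊥) (hC : C ∈ S.I a) : w.g a C hC = 0 := by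
  subst h
  rw [w.g_congr (inf_bot_eq ⊥).symm hC (S.inf_mem_I hC _), ← w.P_mul_g a _ _ hC, P_bot,
    zero_mul]

/-- All components below `C ⊔ D` are `p_A` times the component at `C ⊔ D`, so additivity is
inherited from the projections. -/
theorem f_sup (C D : B) : w.f (C ⊔ D) = w.f C + w.f D - w.f (C ⊓ D) := by
  have h : ∀ A ≤ C ⊔ D, w.f A = S.min.P R A * w.f (C ⊔ D) := fun A h => by
    rw [P_mul_f, inf_eq_right.2 h]
  rw [h _ le_rfl, h C le_sup_left, h D le_sup_right, h _ (inf_le_left.trans le_sup_left), P_sup,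
    sub_mul, add_mul]

theorem g_sup (a : L) (C D E : B) (hC : C ∈ S.I a) :
    w.g a (C ⊓ (D ⊔ E)) (S.inf_mem_I hC _) = w.g a (C ⊓ D) (S.inf_mem_I hC _) +
      w.g a (C ⊓ E) (S.inf_mem_I hC _) - w.g a (C ⊓ (D ⊓ E)) (S.inf_mem_I hC _) := by
  rw [← w.P_mul_g a _ _ hC, ← w.P_mul_g a _ _ hC, ← w.P_mul_g a _ _ hC, ← w.P_mul_g a _ _ hC,
    P_sup, sub_mul, add_mul]

theorem inf_θ_mem_min (a : L) (C A : B) : C ⊓ S.θ a A ∈ S.min.I a :=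
  S.mem_min_I inf_le_right

/-- The action of `p_D` on families. -/
def actP (D : B) : S.FamilySpace R →ₗ[R] S.FamilySpace R where
  -- Dictated by `p_A p_D = p_{A ∩ D}` and `s_{a,C}^* p_D = s_{a, C ∩ θ_a D}^*`.
  toFun w := ⟨(fun A => w.f (A ⊓ D), fun a C => w.g a (C.1 ⊓ S.θ a D) (S.inf_mem_I C.2 _)), by
    refine ⟨fun A A' => ?_, fun a C A hC => ?_, fun a A C h => ?_⟩ <;> dsimp only
    · rw [P_mul_f, inf_right_comm]
    · rw [P_mul_g]
      exact w.g_congr (inf_right_comm _ _ _) _ _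
    · rw [← w.P_mul_f, ← mul_assoc, t_mul_P]
      refine (w.t_mul_f a A _ (inf_le_left.trans h))⟩
  map_add' _ _ := rfl
  map_smul' _ _ := rfl

open Classical in
/-- The action of `s_{a,C}` on families. -/
def actS (a : L) (C : B) (_ : C ∈ S.I a) : S.FamilySpace R →ₗ[R] S.FamilySpace R where
  -- Dictated by `p_A s_{a,C} = s_{a, C ∩ θ_a A} p_C` and `s_{b,D}^* s_{a,C} = δ p_{D ∩ C}`. The set
  -- `C ∩ θ_a A` lies in the minimal ideal even when `C` does not, so the coefficient exists in the
  -- algebra of `S.min`.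
  toFun w := ⟨(fun A => S.min.s R a (C ⊓ S.θ a A) (inf_θ_mem_min _ _ _) * w.f C,
      fun b D => if b = a then w.f (D.1 ⊓ C) else 0), by
    refine ⟨fun A A' => ?_, fun b D A hD => ?_, fun b A D h => ?_⟩ <;> dsimp only
    · rw [← mul_assoc, P_mul_s]
      congr 1
      refine S.min.s_congr R ?_ _ _
      rw [inf_assoc, (S.θ a).map_inf]
      rfl
    · split_ifs
      · rw [P_mul_f, inf_right_comm]
      · rw [mul_zero]
    · rw [← mul_assoc]
      split_ifs with hb
      · subst hb
        have hD : D = D ⊓ S.θ b A := (inf_eq_left.2 h).symm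
        rw [t_mul_s_self, P_mul_f, hD]
        congr 1
        ac_rfl
      · rw [S.min.t_mul_s_ne R hb, zero_mul]⟩
  map_add' w w' := by
    refine FamilySpace.ext (fun A => mul_add _ _ _) fun b D hD => ?_
    change (if b = a then w.f _ + w'.f _ else 0) =
      (if b = a then w.f _ else 0) + (if b = a then w'.f _ else 0)
    split_ifs
    · rfl
    · rw [add_zero]
  map_smul' r w := by
    refine FamilySpace.ext (fun A => ?_) fun b D hD => ?_
    · change _ * r • w.f C = r • (_ * w.f C)
      rw [mul_smul_comm]
    · change (if b = a then r • w.f _ else 0) = r • (if b = a then w.f _ else 0)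
      split_ifs
      · rfl
      · rw [smul_zero]

/-- The action of `s_{a,C}^*` on families. -/
def actT (a : L) (C : B) (hC : C ∈ S.I a) : S.FamilySpace R →ₗ[R] S.FamilySpace R where
  -- Dictated by `p_A s_{a,C}^* = s_{a, C ∩ A}^*` and `s_{b,D}^* s_{a,C}^* = s_{b,D}^* p_C s_{a,C}^*
  -- = s_{b, D ∩ θ_b C}^* s_{a,C}^*`.
  toFun w := ⟨(fun A => w.g a (C ⊓ A) (S.inf_mem_I hC _),
      fun b D => S.min.t R b (D.1 ⊓ S.θ b C) (inf_θ_mem_min _ _ _) * w.g a C hC), by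
    refine ⟨fun A A' => ?_, fun b D A hD => ?_, fun b A D h => ?_⟩ <;> dsimp only
    · rw [P_mul_g]
      exact w.g_congr (inf_assoc _ _ _) _ _
    · rw [← mul_assoc, P_mul_t]
      congr 1
      exact S.min.t_congr R (inf_right_comm _ _ _) _ _
    · rw [w.g_congr (show C ⊓ A = C ⊓ (C ⊓ A) by rw [← inf_assoc, inf_idem]) _
        (S.inf_mem_I hC _), ← w.P_mul_g a _ _ hC, ← mul_assoc, t_mul_P]
      congr 1
      refine S.min.t_congr R ?_ _ _
      change D ⊓ S.θ b (C ⊓ A) = _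
      rw [(S.θ b).map_inf, inf_left_comm, inf_eq_left.2 h, inf_comm]⟩
  map_add' w w' := by
    ext
    · rfl
    · exact mul_add _ _ _
  map_smul' r w := by
    ext
    · rfl
    · exact mul_smul_comm r _ _

@[simp] theorem actP_f (D A : B) : (actP D w).f A = w.f (A ⊓ D) := rfl
@[simp] theorem actP_g (D : B) (a : L) (C : B) (hC : C ∈ S.I a) :
    (actP D w).g a C hC = w.g a (C ⊓ S.θ a D) (S.inf_mem_I hC _) := rfl
@[simp] theorem actS_f (a : L) (C : B) (hC : C ∈ S.I a) (A : B) : (actS a C hC w).f A =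
    S.min.s R a (C ⊓ S.θ a A) (inf_θ_mem_min _ _ _) * w.f C := rfl
@[simp] theorem actS_g_self (a : L) (C D : B) (hC : C ∈ S.I a) (hD : D ∈ S.I a) :
    (actS a C hC w).g a D hD = w.f (D ⊓ C) := if_pos rfl
theorem actS_g_ne {a b : L} (h : b ≠ a) (C D : B) (hC : C ∈ S.I a) (hD : D ∈ S.I b) :
    (actS a C hC w).g b D hD = 0 := if_neg h
@[simp] theorem actT_f (a : L) (C : B) (hC : C ∈ S.I a) (A : B) : (actT a C hC w).f A =
    w.g a (C ⊓ A) (S.inf_mem_I hC _) := rfl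
@[simp] theorem actT_g (a : L) (C : B) (hC : C ∈ S.I a) (b : L) (D : B) (hD : D ∈ S.I b) :
    (actT a C hC w).g b D hD =
      S.min.t R b (D ⊓ S.θ b C) (inf_θ_mem_min _ _ _) * w.g a C hC := rfl

end FamilySpace

open FamilySpace in
/-- The representation of `S` on families. -/
def familyRep : S.Rep (Module.End R (S.FamilySpace R)) where
  p := actP
  s := actS
  t := actT
  p_bot := by
    refine LinearMap.ext fun w => FamilySpace.ext (fun A => ?_) fun b E hE => ?_
    · simp [f_bot]
    · simp only [actP_g, LinearMap.zero_apply, zero_g]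
      exact w.g_eq_zero (by rw [(S.θ _).map_bot, inf_bot_eq]) _
  p_inf C D := by
    refine LinearMap.ext fun w => FamilySpace.ext (fun A => ?_) fun b E hE => ?_
    · simp [inf_assoc]
    · simp only [actP_g, Module.End.mul_apply]
      exact w.g_congr (by rw [(S.θ _).map_inf, inf_assoc]) _ _
  p_sup C D := by
    refine LinearMap.ext fun w => FamilySpace.ext (fun A => ?_) fun b E hE => ?_
    · simp only [actP_f, LinearMap.add_apply, LinearMap.sub_apply, add_f, sub_f]
      rw [inf_sup_left, f_sup, ← inf_inf_distrib_left]
    · simp only [actP_g, LinearMap.add_apply, LinearMap.sub_apply, add_g, sub_g]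
      simp only [(S.θ _).map_sup, (S.θ _).map_inf, w.g_sup _ _ _ _ hE]
  p_s D a C hC := by
    refine LinearMap.ext fun w => FamilySpace.ext (fun A => ?_) fun b E hE => ?_
    · simp only [Module.End.mul_apply, actP_f, actS_f]
      rw [← w.P_mul_f, ← mul_assoc, s_mul_P]
      congr 1
      refine S.min.s_congr R ?_ _ _
      rw [(S.θ a).map_inf, inf_assoc]
    · simp only [Module.End.mul_apply, actP_g]
      by_cases h : b = a
      · subst h
        simp [inf_right_comm, inf_assoc]
      · rw [actS_g_ne _ h, actS_g_ne _ h]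
  t_p D a C hC := by
    refine LinearMap.ext fun w => FamilySpace.ext (fun A => ?_) fun b E hE => ?_
    · simp only [Module.End.mul_apply, actP_f, actT_f, actP_g]
      exact w.g_congr (inf_assoc _ _ _) _ _
    · simp only [Module.End.mul_apply, actP_g, actT_g]
      rw [← w.P_mul_g _ _ _ hC, ← mul_assoc, t_mul_P]
      congr 1
      exact S.min.t_congr R (inf_right_comm _ _ _) _ _
  t_s_self a C D hC hD := by
    refine LinearMap.ext fun w => FamilySpace.ext (fun A => ?_) fun b E hE => ?_
    · simp only [Module.End.mul_apply, actT_f, actS_g_self, actP_f]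
      congr 1
      ac_rfl
    · simp only [Module.End.mul_apply, actP_g, actT_g, actS_g_self]
      rw [← w.t_mul_f b (C ⊓ D) (E ⊓ S.θ b (C ⊓ D)) inf_le_right]
      conv_lhs => rw [← inf_idem (C ⊓ D), ← w.P_mul_f, ← mul_assoc, t_mul_P]
      congr 1
      refine S.min.t_congr R ?_ _ _
      change E ⊓ S.θ b C ⊓ S.θ b (C ⊓ D) = E ⊓ S.θ b (C ⊓ D)
      rw [(S.θ b).map_inf]
      ac_rfl
  t_s_ne a b h C D hC hD := by
    refine LinearMap.ext fun w => FamilySpace.ext (fun A => ?_) fun b E hE => ?_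
    · simp only [Module.End.mul_apply, actT_f]
      exact actS_g_ne w h _ _ _ _
    · simp only [Module.End.mul_apply, actT_g]
      rw [actS_g_ne w h, mul_zero]
      rfl
  s_p a C D hC := by
    refine LinearMap.ext fun w => FamilySpace.ext (fun A => ?_) fun b E hE => ?_
    · simp only [Module.End.mul_apply, actP_f, actS_f]
      conv_lhs => rw [← inf_idem D, ← inf_assoc, ← w.P_mul_f, ← mul_assoc, s_mul_P]
      congr 1
      exact S.min.s_congr R (inf_right_comm _ _ _) _ _
    · simp only [Module.End.mul_apply]
      by_cases h : b = a
      · subst h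
        simp [inf_assoc]
      · rw [actS_g_ne _ h, actS_g_ne _ h]
  p_t a C D hC := by
    refine LinearMap.ext fun w => FamilySpace.ext (fun A => ?_) fun b E hE => ?_
    · simp only [Module.End.mul_apply, actP_f, actT_f]
      exact w.g_congr (by ac_rfl) _ _
    · simp only [Module.End.mul_apply, actP_g, actT_g]
      rw [← w.P_mul_g _ _ _ hC, ← mul_assoc, t_mul_P]
      congr 1
      refine S.min.t_congr R ?_ _ _
      change E ⊓ S.θ b D ⊓ S.θ b C = E ⊓ S.θ b (C ⊓ D) ⊓ S.θ b D
      rw [(S.θ b).map_inf]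
      ac_rfl
  cuntzKrieger C hC F hF := by
    refine LinearMap.ext fun w => FamilySpace.ext (fun A => ?_) fun b E hE => ?_
    · rw [LinearMap.sum_apply, sum_f]
      simp only [Module.End.mul_apply, actP_f, actT_f, actS_f]
      -- Regularity depends only on `θ`, so `C` is also regular for `S.min`. Its relation is
      -- multiplied by `p_A` on the left and applied to the component at `C`.
      have h1 := (S.min.univ R).cuntzKrieger C hC F hF
      have h2 := congrArg (fun z => S.min.P R A * z * w.f C) h1
      rw [Finset.mul_sum, Finset.sum_mul] at h2
      change S.min.P R A * S.min.P R C * w.f C = _ at h2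
      rw [P_mul_P, P_mul_f, ← inf_assoc, inf_right_comm, inf_idem, inf_comm] at h2
      rw [h2]
      refine Finset.sum_congr rfl fun a _ => ?_
      change S.min.P R A * (S.min.s R a (S.θ a C) (S.mem_min_I le_rfl) *
        S.min.t R a (S.θ a C) (S.mem_min_I le_rfl)) * w.f C = _
      rw [mul_assoc, mul_assoc, w.t_mul_f a C (S.θ a C) le_rfl, ← mul_assoc, P_mul_s]
      congr 1
      exact w.g_congr (inf_idem _).symm _ _
    -- Here `s_{b,E}^*` annihilates every summand except that of `b`. If `b` is not in `F`, then
    -- `θ_b C = ∅` and both sides vanish.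
    · rw [LinearMap.sum_apply, sum_g]
      simp only [Module.End.mul_apply, actP_g]
      by_cases hb : b ∈ F
      · rw [Finset.sum_eq_single b]
        · simp only [actS_g_self, actT_f]
          exact w.g_congr (by rw [inf_left_comm, inf_idem]) _ _
        · intro a _ ha
          exact actS_g_ne _ ha.symm _ _ _ _
        · exact fun h => (h hb).elim
      · rw [w.g_eq_zero, Finset.sum_eq_zero]
        · rintro a ha
          exact actS_g_ne _ (fun h => hb (by rwa [h])) _ _ _ _
        · rw [hF, Δ, Set.mem_ofPred_eq, not_not] at hb
          rw [hb, inf_bot_eq]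

/-- The family of `p_D`. -/
def familyP (D : B) : S.FamilySpace R :=
  ⟨(fun A => S.min.P R (A ⊓ D),
    fun a C => S.min.t R a (C.1 ⊓ S.θ a D) (S.mem_min_I inf_le_right)), by
    refine ⟨fun A A' => ?_, fun a C A hC => ?_, fun a A C h => ?_⟩ <;> dsimp only
    · rw [P_mul_P]
      congr 1
      ac_rfl
    · rw [P_mul_t]
      exact S.min.t_congr R (inf_right_comm _ _ _) _ _
    · rw [t_mul_P]
      refine S.min.t_congr R ?_ _ _
      change C ⊓ S.θ a (A ⊓ D) = _
      rw [(S.θ a).map_inf, ← inf_assoc, inf_eq_left.2 h]⟩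

theorem familyP_f (D A : B) : (S.familyP R D).f A = S.min.P R (A ⊓ D) := rfl

theorem minHom_P (C : B) : S.minHom R (S.min.P R C) = S.P R C := (S.minRep R).lift_P C
theorem minHom_s (a : L) (C : B) (h : C ∈ S.min.I a) :
    S.minHom R (S.min.s R a C h) = S.s R a C (S.min_I_le h) := (S.minRep R).lift_s a C h
theorem minHom_t (a : L) (C : B) (h : C ∈ S.min.I a) :
    S.minHom R (S.min.t R a C h) = S.t R a C (S.min_I_le h) := (S.minRep R).lift_t a C h

/-- The elements `p_D`, with `D` large enough, are local units of the algebra of `S.min`, and the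
algebra of `S.min` acts on families through left multiplication. -/
theorem min_local_unit (v : S.min.Alg R) : ∃ D₀, ∀ D, D₀ ≤ D →
    S.min.P R D * v = v ∧ v * S.min.P R D = v ∧ ∀ (w : S.FamilySpace R) A,
      ((S.familyRep R).lift R (S.minHom R v) w).f A = S.min.P R A * v * w.f D := by
  induction v using S.min.alg_induction R with
  | hp C =>
    refine ⟨C, fun D h => ⟨S.min.P_mul_P_of_ge R h, S.min.P_mul_P_of_le R h, fun w A => ?_⟩⟩
    rw [minHom_P, Rep.lift_P, P_mul_P, FamilySpace.P_mul_f]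
    change w.f (A ⊓ C) = _
    congr 1
    rw [inf_left_comm, inf_eq_right.2 h]
  | hs a C hC =>
    -- `C` serves as a unit on the right of `s_{a,C}`, and `A₀` with `C ⊆ θ_a A₀` on its left. The
    -- existence of `A₀` is the reason for the minimal ideals.
    obtain ⟨A₀, hA₀⟩ := id hC
    refine ⟨A₀ ⊔ C, fun D h => ?_⟩
    have h1 := S.min.P_mul_s_of_le R hC (hA₀.trans (S.θ_mono a (le_sup_left.trans h)))
    have h2 := S.min.s_mul_P_of_le R (C := C) hC (le_sup_right.trans h)
    refine ⟨h1, h2, fun w A => ?_⟩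
    rw [minHom_s, Rep.lift_s]
    change S.min.s R a (C ⊓ S.θ a A) _ * w.f C = _
    rw [P_mul_s, show w.f C = S.min.P R C * w.f D by
      rw [w.P_mul_f, inf_eq_right.2 (le_sup_right.trans h)], ← mul_assoc,
      S.min.s_mul_P_of_le R _ inf_le_left]
    rfl
  | ht a C hC =>
    obtain ⟨A₀, hA₀⟩ := id hC
    refine ⟨A₀ ⊔ C, fun D h => ?_⟩
    have h3 := hA₀.trans (S.θ_mono a (le_sup_left.trans h))
    have h1 := S.min.t_mul_P_of_le R hC h3
    have h2 := S.min.P_mul_t_of_le R (C := C) hC (le_sup_right.trans h)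
    refine ⟨h2, h1, fun w A => ?_⟩
    rw [minHom_t, Rep.lift_t]
    change w.g a (C ⊓ A) _ = _
    rw [P_mul_t]
    exact (w.t_mul_f a D (C ⊓ A) (inf_le_left.trans h3)).symm
  | hmul x y hx hy =>
    obtain ⟨D₁, h₁⟩ := hx
    obtain ⟨D₂, h₂⟩ := hy
    refine ⟨D₁ ⊔ D₂, fun D h => ?_⟩
    obtain ⟨a1, a2, a3⟩ := h₁ D (le_sup_left.trans h)
    obtain ⟨b1, b2, b3⟩ := h₂ D (le_sup_right.trans h)
    refine ⟨by rw [← mul_assoc, a1], by rw [mul_assoc, b2], fun w A => ?_⟩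
    rw [map_mul, map_mul, Module.End.mul_apply, a3, b3, b1, mul_assoc, mul_assoc, mul_assoc]
  | hadd x y hx hy =>
    obtain ⟨D₁, h₁⟩ := hx
    obtain ⟨D₂, h₂⟩ := hy
    refine ⟨D₁ ⊔ D₂, fun D h => ?_⟩
    obtain ⟨a1, a2, a3⟩ := h₁ D (le_sup_left.trans h)
    obtain ⟨b1, b2, b3⟩ := h₂ D (le_sup_right.trans h)
    refine ⟨by rw [mul_add, a1, b1], by rw [add_mul, a2, b2], fun w A => ?_⟩
    rw [map_add, map_add, LinearMap.add_apply, FamilySpace.add_f, a3, b3, mul_add, add_mul]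
  | hsmul r x hx =>
    obtain ⟨D₁, h₁⟩ := hx
    refine ⟨D₁, fun D h => ?_⟩
    obtain ⟨a1, a2, a3⟩ := h₁ D h
    refine ⟨by rw [mul_smul_comm, a1], by rw [smul_mul_assoc, a2], fun w A => ?_⟩
    rw [map_smul, map_smul, LinearMap.smul_apply, FamilySpace.smul_f, a3, mul_smul_comm,
      smul_mul_assoc]

/-- Let `D` be a local unit for `v`. The image of `v`, applied to the family of `p_D`, has component
`p_D v p_D = v` at `D`, so `v` can be read off from its image. -/
theorem minHom_injective : Function.Injective (S.minHom R) := by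
  rw [injective_iff_map_eq_zero]
  intro v hv
  obtain ⟨D, hD⟩ := S.min_local_unit R v
  obtain ⟨h1, h2, h3⟩ := hD D le_rfl
  have := h3 (S.familyP R D) D
  rw [hv, map_zero, LinearMap.zero_apply, FamilySpace.zero_f, familyP_f, inf_idem, h1, h2] at this
  exact this.symm

end GBDS

/-! ### Matrices over a non-unital algebra, acting on columns over its unitization -/

section Columns

variable (R : Type u) [CommRing R] (A : Type x) [NonUnitalRing A] [Module R A]
  [IsScalarTower R A A] [SMulCommClass R A A]

/-- Endomorphisms of the module of columns with entries in the unitization. -/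
abbrev ColEnd : Type (max u x) := Module.End R (ℕ → Unitization R A)

variable {A}

/-- The diagonal matrix with entries `d i`. -/
def ColEnd.diag (d : ℕ → A) : ColEnd R A where
  toFun y i := (d i : Unitization R A) * y i
  map_add' _ _ := funext fun _ => mul_add _ _ _
  map_smul' r y := funext fun i => mul_smul_comm r (d i : Unitization R A) (y i)

/-- The matrix with the single entry `c` at place `(i, j)`. -/
def ColEnd.unit (i j : ℕ) : A →ₗ[R] ColEnd R A where
  toFun c :=
    { toFun := fun y => Pi.single i ((c : Unitization R A) * y j)
      map_add' := fun y z => by rw [← Pi.single_add, Pi.add_apply, mul_add]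
      map_smul' := fun r y => by
        rw [Pi.smul_apply, mul_smul_comm, RingHom.id_apply, Pi.single_smul] }
  map_add' c d := LinearMap.ext fun y => by
    change (Pi.single i (((c + d : A) : Unitization R A) * y j) : ℕ → Unitization R A) =
      Pi.single i _ + Pi.single i _
    rw [← Pi.single_add, Unitization.inr_add, add_mul]
  map_smul' r c := LinearMap.ext fun y => by
    change (Pi.single i (((r • c : A) : Unitization R A) * y j) : ℕ → Unitization R A) =
      r • Pi.single i _
    rw [← Pi.single_smul, Unitization.inr_smul, smul_mul_assoc]

namespace ColEnd

variable {R}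

theorem diag_apply (d : ℕ → A) (y : ℕ → Unitization R A) (i : ℕ) :
    diag R d y i = (d i : Unitization R A) * y i := rfl

theorem unit_apply (i j : ℕ) (c : A) (y : ℕ → Unitization R A) :
    unit R i j c y = Pi.single i ((c : Unitization R A) * y j) := rfl

theorem unit_mul_unit (i j k : ℕ) (c d : A) : unit R i j c * unit R j k d = unit R i k (c * d) := by
  ext1 y
  rw [Module.End.mul_apply, unit_apply, unit_apply, unit_apply, Pi.single_eq_same, ← mul_assoc,
    Unitization.inr_mul]

theorem unit_mul_unit_of_ne {i j k l : ℕ} (h : j ≠ k) (c d : A) :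
    unit R i j c * unit R k l d = 0 := by
  ext1 y
  rw [Module.End.mul_apply, unit_apply, unit_apply, Pi.single_eq_of_ne h, mul_zero,
    Pi.single_zero, LinearMap.zero_apply]

theorem diag_mul_diag (c d : ℕ → A) : diag R c * diag R d = diag R fun i => c i * d i := by
  ext1 y
  funext i
  rw [Module.End.mul_apply, diag_apply, diag_apply, diag_apply, ← mul_assoc, Unitization.inr_mul]

theorem diag_mul_unit (d : ℕ → A) (i j : ℕ) (c : A) :
    diag R d * unit R i j c = unit R i j (d i * c) := by
  ext1 y
  funext k
  rw [Module.End.mul_apply, diag_apply, unit_apply, unit_apply]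
  by_cases h : k = i
  · subst h
    rw [Pi.single_eq_same, Pi.single_eq_same, ← mul_assoc, Unitization.inr_mul]
  · rw [Pi.single_eq_of_ne h, Pi.single_eq_of_ne h, mul_zero]

theorem unit_mul_diag (d : ℕ → A) (i j : ℕ) (c : A) :
    unit R i j c * diag R d = unit R i j (c * d j) := by
  ext1 y
  rw [Module.End.mul_apply, unit_apply, unit_apply, diag_apply, ← mul_assoc, Unitization.inr_mul]

theorem unit_injective (i j : ℕ) : Function.Injective (unit (A := A) R i j) := by
  intro c d h
  -- The constant column `1` exists because the entries are taken in the unitization; it recovers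
  -- `c` even if `c` annihilates the algebra from the left.
  have := congrFun (LinearMap.congr_fun h 1) i
  rw [unit_apply, unit_apply, Pi.single_eq_same, Pi.single_eq_same, Pi.one_apply, mul_one,
    mul_one] at this
  exact Unitization.inr_injective this

end ColEnd

end Columns

namespace GBDS

variable {B : Type v} {L : Type w} [GeneralizedBooleanAlgebra B] (S : GBDS B L)
variable (R : Type u) [CommRing R]

/-! ### Gap projections -/

/-- The range projection `s_{a,θ_a A} s_{a,θ_a A}^*`. -/
def rangeProj (a : L) (A : B) : S.Alg R :=
  S.s R a (S.θ a A) (S.θ_mem_I a A) * S.t R a (S.θ a A) (S.θ_mem_I a A)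

theorem s_inf_mul_t (a : L) (C D : B) (hC : C ∈ S.I a) :
    S.s R a (C ⊓ D) (S.inf_mem_I hC D) * S.t R a C hC =
      S.s R a (C ⊓ D) (S.inf_mem_I hC D) * S.t R a (C ⊓ D) (S.inf_mem_I hC D) := by
  rw [← S.s_mul_P_of_le R (S.inf_mem_I hC D) inf_le_right, mul_assoc, P_mul_t, mul_assoc,
    S.P_mul_t_of_le R _ inf_le_right]

theorem s_mul_t_inf (a : L) (C D : B) (hC : C ∈ S.I a) :
    S.s R a C hC * S.t R a (C ⊓ D) (S.inf_mem_I hC D) =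
      S.s R a (C ⊓ D) (S.inf_mem_I hC D) * S.t R a (C ⊓ D) (S.inf_mem_I hC D) := by
  rw [← S.P_mul_t_of_le R (S.inf_mem_I hC D) inf_le_right, ← mul_assoc, s_mul_P,
    S.P_mul_t_of_le R _ inf_le_right]

theorem P_mul_rangeProj (a : L) (A D : B) :
    S.P R D * S.rangeProj R a A = S.rangeProj R a (A ⊓ D) := by
  rw [rangeProj, ← mul_assoc, P_mul_s, s_inf_mul_t]
  simp only [rangeProj, (S.θ a).map_inf]

theorem rangeProj_mul_P (a : L) (A D : B) :
    S.rangeProj R a A * S.P R D = S.rangeProj R a (A ⊓ D) := by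
  rw [rangeProj, mul_assoc, t_mul_P, s_mul_t_inf]
  simp only [rangeProj, (S.θ a).map_inf]

theorem rangeProj_mul_s (a : L) (A C : B) (hC : C ∈ S.I a) :
    S.rangeProj R a A * S.s R a C hC = S.s R a (C ⊓ S.θ a A) (S.inf_mem_I hC _) := by
  rw [rangeProj, mul_assoc, t_mul_s_self, s_mul_P]
  exact S.s_congr R (by ac_rfl) _ _

theorem t_mul_rangeProj (a : L) (A C : B) (hC : C ∈ S.I a) :
    S.t R a C hC * S.rangeProj R a A = S.t R a (C ⊓ S.θ a A) (S.inf_mem_I hC _) := by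
  rw [rangeProj, ← mul_assoc, t_mul_s_self, P_mul_t]
  exact S.t_congr R (by ac_rfl) _ _

theorem rangeProj_mul_s_ne {a b : L} (h : a ≠ b) (A C : B) (hC : C ∈ S.I b) :
    S.rangeProj R a A * S.s R b C hC = 0 := by
  rw [rangeProj, mul_assoc, S.t_mul_s_ne R h, mul_zero]

theorem t_mul_rangeProj_ne {a b : L} (h : b ≠ a) (A C : B) (hC : C ∈ S.I b) :
    S.t R b C hC * S.rangeProj R a A = 0 := by
  rw [rangeProj, ← mul_assoc, S.t_mul_s_ne R h, zero_mul]

theorem rangeProj_mul_self (a : L) (A D : B) :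
    S.rangeProj R a A * S.rangeProj R a D = S.rangeProj R a (A ⊓ D) := by
  conv_lhs => rw [rangeProj.eq_1 S R a D, ← mul_assoc, rangeProj_mul_s, s_inf_mul_t]
  simp only [rangeProj, ← (S.θ a).map_inf, inf_comm D A]

theorem rangeProj_mul_ne {a b : L} (h : a ≠ b) (A D : B) :
    S.rangeProj R a A * S.rangeProj R b D = 0 := by
  conv_lhs => rw [rangeProj.eq_1 S R b D, ← mul_assoc, S.rangeProj_mul_s_ne R h, zero_mul]

theorem rangeProj_eq_zero {a : L} {A : B} (h : S.θ a A = ⊥) : S.rangeProj R a A = 0 := by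
  rw [rangeProj, S.s_eq_zero R h, zero_mul]

/-- Letters outside `Δ A` contribute zero, so any finite set containing `Δ A` may be used. Callers
then need only an upper bound for `Δ A`. -/
theorem P_eq_sum_rangeProj {A : B} (hA : A ∈ S.regular) (F : Finset L) (hF : S.Δ A ⊆ F) :
    S.P R A = ∑ a ∈ F, S.rangeProj R a A := by
  classical
  refine ((S.univ R).cuntzKrieger A hA (F.filter fun a => a ∈ S.Δ A) fun a => ?_).trans ?_
  · rw [Finset.mem_filter]
    exact ⟨fun h => h.2, fun h => ⟨hF h, h⟩⟩
  · refine Finset.sum_subset (Finset.filter_subset _ _) fun a ha ha' => ?_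
    rw [Finset.mem_filter, not_and] at ha'
    exact S.rangeProj_eq_zero R (not_not.1 (ha' ha))

variable (e : L ↪ ℕ)

theorem finite_lettersBelow (i : ℕ) : {a : L | e a + 1 < i}.Finite :=
  ((Set.finite_lt_nat i).preimage e.injective.injOn).subset fun _ h =>
    (Nat.lt_succ_self _).trans h

/-- The letters `a_j` with `j < i`. -/
def lettersBelow (i : ℕ) : Finset L := (finite_lettersBelow e i).toFinset

theorem mem_lettersBelow {i : ℕ} {a : L} : a ∈ lettersBelow e i ↔ e a + 1 < i :=
  Set.Finite.mem_toFinset _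

/-- The projection `p_A - ∑_{j < i} s_{a_j,θ A} s_{a_j,θ A}^*`. -/
def gap (i : ℕ) (A : B) : S.Alg R := S.P R A - ∑ a ∈ lettersBelow e i, S.rangeProj R a A

theorem gap_zero (A : B) : S.gap R e 0 A = S.P R A := by
  rw [gap, Finset.sum_eq_zero, sub_zero]
  exact fun a ha => absurd ((mem_lettersBelow e).1 ha) (Nat.not_lt_zero _)

theorem P_mul_gap (i : ℕ) (A D : B) : S.P R D * S.gap R e i A = S.gap R e i (A ⊓ D) := by
  simp only [gap, mul_sub, P_mul_P, Finset.mul_sum, P_mul_rangeProj, inf_comm D A]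

theorem gap_mul_P (i : ℕ) (A D : B) : S.gap R e i A * S.P R D = S.gap R e i (A ⊓ D) := by
  simp only [gap, sub_mul, P_mul_P, Finset.sum_mul, rangeProj_mul_P]

theorem rangeProj_mul_gap {i : ℕ} {a : L} (h : e a + 1 < i) (A D : B) :
    S.rangeProj R a A * S.gap R e i D = 0 := by
  rw [gap, mul_sub, rangeProj_mul_P, Finset.mul_sum,
    Finset.sum_eq_single a (fun b _ hb => S.rangeProj_mul_ne R hb.symm _ _)
      (fun h' => (h' ((mem_lettersBelow e).2 h)).elim), rangeProj_mul_self, sub_self]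

theorem gap_mul_rangeProj {i : ℕ} {a : L} (h : e a + 1 < i) (A D : B) :
    S.gap R e i D * S.rangeProj R a A = 0 := by
  rw [gap, sub_mul, P_mul_rangeProj, Finset.sum_mul,
    Finset.sum_eq_single a (fun b _ hb => S.rangeProj_mul_ne R hb _ _)
      (fun h' => (h' ((mem_lettersBelow e).2 h)).elim), rangeProj_mul_self, inf_comm, sub_self]

/-- Gaps shrink as the index grows: the range projections subtracted at index `i` are already
orthogonal to the gap at `j ≥ i`, so the larger index survives. -/
theorem gap_mul_gap {i j : ℕ} (h : i ≤ j) (A D : B) :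
    S.gap R e i A * S.gap R e j D = S.gap R e j (A ⊓ D) := by
  rw [gap.eq_1 S R e i A, sub_mul, P_mul_gap, Finset.sum_mul, Finset.sum_eq_zero, sub_zero, inf_comm]
  exact fun a ha => S.rangeProj_mul_gap R e (((mem_lettersBelow e).1 ha).trans_le h) _ _

theorem gap_mul_gap' {i j : ℕ} (h : i ≤ j) (A D : B) :
    S.gap R e j D * S.gap R e i A = S.gap R e j (D ⊓ A) := by
  rw [gap.eq_1 S R e i A, mul_sub, gap_mul_P, Finset.mul_sum, Finset.sum_eq_zero, sub_zero]
  exact fun a ha => S.gap_mul_rangeProj R e (((mem_lettersBelow e).1 ha).trans_le h) _ _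

/-- The letter `a` has number `e a + 1`, and the gap at `i` removes the numbers strictly below `i`.
Thus the gap at the source level `e a + 1` of `a` still lets `s_{a,C}` through, as in `gap_mul_s`,
and the gap at the next level annihilates it. -/
theorem gap_mul_s_of_lt {i : ℕ} {a : L} (h : e a + 1 < i) (A C : B) (hC : C ∈ S.I a) :
    S.gap R e i A * S.s R a C hC = 0 := by
  rw [gap, sub_mul, P_mul_s, Finset.sum_mul,
    Finset.sum_eq_single a (fun b _ hb => S.rangeProj_mul_s_ne R hb _ _ _)
      (fun h' => (h' ((mem_lettersBelow e).2 h)).elim), rangeProj_mul_s, sub_self]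

theorem t_mul_gap_of_lt {i : ℕ} {a : L} (h : e a + 1 < i) (A C : B) (hC : C ∈ S.I a) :
    S.t R a C hC * S.gap R e i A = 0 := by
  rw [gap, mul_sub, t_mul_P, Finset.mul_sum,
    Finset.sum_eq_single a (fun b _ hb => S.t_mul_rangeProj_ne R hb.symm _ _ _)
      (fun h' => (h' ((mem_lettersBelow e).2 h)).elim), t_mul_rangeProj, sub_self]

theorem gap_mul_s {i : ℕ} {a : L} (h : i ≤ e a + 1) (A C : B) (hC : C ∈ S.I a) :
    S.gap R e i A * S.s R a C hC = S.s R a (C ⊓ S.θ a A) (S.inf_mem_I hC _) := by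
  rw [gap, sub_mul, P_mul_s, Finset.sum_mul, Finset.sum_eq_zero, sub_zero]
  refine fun b hb => S.rangeProj_mul_s_ne R ?_ _ _ _
  rintro rfl
  exact absurd ((mem_lettersBelow e).1 hb) h.not_gt

theorem t_mul_gap {i : ℕ} {a : L} (h : i ≤ e a + 1) (A C : B) (hC : C ∈ S.I a) :
    S.t R a C hC * S.gap R e i A = S.t R a (C ⊓ S.θ a A) (S.inf_mem_I hC _) := by
  rw [gap, mul_sub, t_mul_P, Finset.mul_sum, Finset.sum_eq_zero, sub_zero]
  refine fun b hb => S.t_mul_rangeProj_ne R ?_ _ _ _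
  rintro rfl
  exact absurd ((mem_lettersBelow e).1 hb) h.not_gt

theorem gap_bot (i : ℕ) : S.gap R e i ⊥ = 0 := by
  rw [← inf_bot_eq ⊥, ← gap_mul_P, P_bot, mul_zero]

theorem gap_sup (i : ℕ) (A D : B) :
    S.gap R e i (A ⊔ D) = S.gap R e i A + S.gap R e i D - S.gap R e i (A ⊓ D) := by
  have h : ∀ C ≤ A ⊔ D, S.gap R e i C = S.P R C * S.gap R e i (A ⊔ D) := fun C h => by
    rw [P_mul_gap, inf_eq_right.2 h]
  rw [h _ le_rfl, h A le_sup_left, h D le_sup_right, h _ (inf_le_left.trans le_sup_left), P_sup,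
    sub_mul, add_mul]

open Classical in
theorem lettersBelow_succ_of_letter {i : ℕ} {a : L} (h : e a + 1 = i) :
    lettersBelow e (i + 1) = insert a (lettersBelow e i) := by
  ext b
  rw [Finset.mem_insert, mem_lettersBelow, mem_lettersBelow, Nat.lt_succ_iff_lt_or_eq, or_comm,
    ← h, Nat.succ_inj, e.injective.eq_iff]

theorem lettersBelow_succ_of_no_letter {i : ℕ} (h : ∀ a, e a + 1 ≠ i) :
    lettersBelow e (i + 1) = lettersBelow e i := by
  ext b
  rw [mem_lettersBelow, mem_lettersBelow, Nat.lt_succ_iff_lt_or_eq, or_iff_left (h b)]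

theorem gap_succ_of_letter {i : ℕ} {a : L} (h : e a + 1 = i) (A : B) :
    S.gap R e i A = S.gap R e (i + 1) A + S.rangeProj R a A := by
  classical
  rw [gap, gap, lettersBelow_succ_of_letter e h, Finset.sum_insert]
  · abel
  · rw [mem_lettersBelow, h]
    exact lt_irrefl _

/-- Such levels occur: level `0` always, since numbering starts at `1`, and others because `e` need
not be surjective. -/
theorem gap_succ_of_no_letter {i : ℕ} (h : ∀ a, e a + 1 ≠ i) (A : B) :
    S.gap R e i A = S.gap R e (i + 1) A := by
  rw [gap, gap, lettersBelow_succ_of_no_letter e h]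

theorem Δ_mono {A A' : B} (h : A ≤ A') : S.Δ A ⊆ S.Δ A' := fun a ha h' =>
  ha (le_bot_iff.1 ((S.θ_mono a h).trans h'.le))

/-- A nonempty subset with empty `Δ` would be a sink meeting `U`. With `exists_mem_X_of_regular`
this shows that the regular sets are the union of the ideals `X_i`. -/
theorem regular_of_mem_X {i : ℕ} {U : B} (h : U ∈ S.X e i) : U ∈ S.regular := by
  refine fun A hA hA' => ⟨?_, (finite_lettersBelow e i).subset fun a ha => h.2 a (S.Δ_mono hA ha)⟩
  rw [Set.nonempty_iff_ne_empty]
  exact fun h' => hA' ((inf_eq_right.2 hA).symm.trans (h.1 A h'))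

/-- The ideal `X_i` consists of the regular sets on which only letters with number below `i` act;
for these the Cuntz–Krieger sum is the whole of what the gap subtracts. This lets the gap descend to
`B / X_i`. -/
theorem gap_eq_zero {i : ℕ} {U : B} (h : U ∈ S.X e i) : S.gap R e i U = 0 := by
  rw [gap, sub_eq_zero]
  exact S.P_eq_sum_rangeProj R (S.regular_of_mem_X e h) _ fun a ha =>
    (mem_lettersBelow e).2 (h.2 a ha)

/-- The gap projection as a function on `B / X_i`. -/
def gapBar (i : ℕ) : S.Level e i → S.Alg R := Quotient.lift (S.gap R e i) (by
  rintro A A' ⟨U, hU, h⟩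
  -- The correction terms are the gaps of `U` and of `A ⊓ U`; the latter is the product of the gaps
  -- of `A` and `U`, hence zero.
  have key : ∀ A, S.gap R e i (A ⊔ U) = S.gap R e i A := fun A => by
    rw [gap_sup, S.gap_eq_zero R e hU, ← gap_mul_gap _ _ _ le_rfl, S.gap_eq_zero R e hU, mul_zero,
      sub_zero, add_zero]
  rw [← key A, h, key])

theorem gapBar_mk (i : ℕ) (A : B) :
    S.gapBar R e i (IdealQuotient.mk (S.X e i) A) = S.gap R e i A := rfl

theorem gapBar_bot (i : ℕ) : S.gapBar R e i ⊥ = 0 := S.gap_bot R e i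

theorem gapBar_inf (i : ℕ) (x y : S.Level e i) :
    S.gapBar R e i (x ⊓ y) = S.gapBar R e i x * S.gapBar R e i y := by
  obtain ⟨A⟩ := x
  obtain ⟨D⟩ := y
  exact (S.gap_mul_gap R e le_rfl A D).symm

theorem gapBar_sup (i : ℕ) (x y : S.Level e i) : S.gapBar R e i (x ⊔ y) =
    S.gapBar R e i x + S.gapBar R e i y - S.gapBar R e i (x ⊓ y) := by
  obtain ⟨A⟩ := x
  obtain ⟨D⟩ := y
  exact S.gap_sup R e i A D

/-- The identification of `B / X_0` with `B`. -/
def levelZero : S.Level e 0 → B := Quotient.lift id (by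
  rintro A A' ⟨U, hU, h⟩
  rwa [S.mem_X_zero.1 hU, sup_bot_eq, sup_bot_eq] at h)

theorem levelZero_mk (A : B) : S.levelZero e (IdealQuotient.mk (S.X e 0) A) = A := rfl

theorem gapBar_zero (x : S.Level e 0) : S.gapBar R e 0 x = S.P R (S.levelZero e x) := by
  obtain ⟨A⟩ := x
  exact S.gap_zero R e A

theorem levelZero_inf (x y : S.Level e 0) :
    S.levelZero e (x ⊓ y) = S.levelZero e x ⊓ S.levelZero e y := by
  obtain ⟨A⟩ := x
  obtain ⟨D⟩ := y
  rfl

theorem exists_rep {i : ℕ} (x : S.Level e i) : ∃ A, x = IdealQuotient.mk (S.X e i) A := by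
  obtain ⟨A⟩ := x
  exact ⟨A, rfl⟩

theorem cls_val_self (i : ℕ) (A : B) : (S.cls e i A).1 i = IdealQuotient.mk (S.X e i) A :=
  Function.update_self _ _ _

theorem cls_val_ne {i j : ℕ} (h : j ≠ i) (A : B) : (S.cls e i A).1 j = ⊥ :=
  Function.update_of_ne h _ _

theorem levelZero_mem {a : L} {x : S.BF e} (h : x ∈ (S.desing e).I (Sum.inl a)) :
    S.levelZero e (x.1 0) ∈ S.I a := by
  obtain ⟨A, hA, rfl⟩ := h
  rw [cls_val_self]
  exact hA

theorem θF_inl_val (a : L) (x : S.BF e) {A : B}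
    (h : x.1 (e a + 1) = IdealQuotient.mk (S.X e (e a + 1)) A) :
    (S.desing e).θ (Sum.inl a) x = S.cls e 0 (S.θ a A) := by
  change FinSum.single (B := S.Level e) 0 (IdealQuotient.map _ _ _ _ (x.1 (e a + 1))) = _
  rw [h]
  rfl

theorem θF_inr_val (n : ℕ) (x : S.BF e) {A : B} (h : x.1 n = IdealQuotient.mk (S.X e n) A) :
    (S.desing e).θ (Sum.inr n) x = S.cls e (n + 1) A := by
  change FinSum.single (B := S.Level e) (n + 1) (IdealQuotient.map _ _ _ _ (x.1 n)) = _
  rw [h]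
  rfl

theorem cls_eq_bot {i : ℕ} {A : B} : S.cls e i A = ⊥ ↔ A ∈ S.X e i := by
  have h1 : S.cls e i A = ⊥ ↔ IdealQuotient.mk (S.X e i) A = ⊥ := by
    refine ⟨fun h => ?_, fun h => FinSum.ext_iff'.2 fun j => ?_⟩
    · rw [← cls_val_self, h]
      rfl
    · by_cases hj : j = i
      · subst hj
        rw [cls_val_self, h]
        rfl
      · rw [S.cls_val_ne e hj]
        rfl
  rw [h1]
  refine (IdealQuotient.mk_eq (A' := ⊥)).trans ⟨?_, fun h => ⟨A, h, by simp⟩⟩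
  rintro ⟨U, hU, h⟩
  rw [bot_sup_eq, sup_eq_right] at h
  exact (S.X e i).lower h hU

/-! ### Every set of the desingularization is regular -/

/-- On level `i` only `b_{i+1}` and the letter numbered `i`, if there is one, can act, and `x` has
finitely many nonempty levels; this gives finiteness. For existence take `[A]_i ≠ ∅`. If `b_{i+1}`
kills it, then `A` lies in `X_{i+1}` but not in `X_i`, so the letter numbered `i` acts nontrivially
on `A`. -/
theorem regular_desing : (S.desing e).regular = Set.univ := by
  refine Set.eq_univ_of_forall fun y x _ hx => ?_
  choose A hA using fun i => S.exists_rep e (x.1 i)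
  have hin : ∀ a, Sum.inl a ∈ (S.desing e).Δ x ↔ S.θ a (A (e a + 1)) ≠ ⊥ := fun a => by
    change (S.desing e).θ (Sum.inl a) x ≠ ⊥ ↔ _
    rw [S.θF_inl_val e a x (hA _), Ne, cls_eq_bot, mem_X_zero]
  have hir : ∀ n, Sum.inr n ∈ (S.desing e).Δ x ↔ A n ∉ S.X e (n + 1) := fun n => by
    change (S.desing e).θ (Sum.inr n) x ≠ ⊥ ↔ _
    rw [S.θF_inr_val e n x (hA _), Ne, cls_eq_bot]
  have hbot : ∀ i, A i ∈ S.X e i ↔ x.1 i = ⊥ := fun i => by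
    rw [← cls_eq_bot, hA i]
    exact ⟨fun h => by rw [← cls_val_self, h]; rfl, fun h => FinSum.ext_iff'.2 fun j => by
      by_cases hj : j = i
      · subst hj; rw [cls_val_self, h]; rfl
      · rw [S.cls_val_ne e hj]; rfl⟩
  constructor
  · obtain ⟨i, hi⟩ : ∃ i, x.1 i ≠ ⊥ := by
      by_contra! h
      exact hx (FinSum.ext_iff'.2 h)
    by_cases h : A i ∈ S.X e (i + 1)
    · rw [Ne, ← hbot] at hi
      have : ∃ a ∈ S.Δ (A i), ¬ e a + 1 < i := by
        by_contra! h'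
        exact hi ⟨h.1, h'⟩
      obtain ⟨a, ha, ha'⟩ := this
      have hai : e a + 1 = i := le_antisymm (Nat.lt_succ_iff.1 (h.2 a ha)) (not_lt.1 ha')
      subst hai
      exact ⟨Sum.inl a, (hin a).2 ha⟩
    · exact ⟨Sum.inr i, (hir i).2 h⟩
  · have hfin : {i | x.1 i ≠ ⊥}.Finite := x.2
    have h1 : (Sum.inl '' ((fun a => e a + 1) ⁻¹' {i | x.1 i ≠ ⊥}) : Set (L ⊕ ℕ)).Finite :=
      (hfin.preimage (Function.Injective.injOn fun a b h =>
        e.injective (Nat.succ_injective h))).image _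
    refine (h1.union (hfin.image Sum.inr)).subset ?_
    rintro (a | n) h
    · refine Or.inl ⟨a, fun h' => (hin a).1 h ?_, rfl⟩
      exact S.mem_X_zero.1 (S.θ_mem_X_zero e a _ ((hbot _).2 h'))
    · exact Or.inr ⟨n, fun h' => (hir n).1 h (S.X_mono e n _ ((hbot _).2 h')), rfl⟩

end GBDS

namespace GBDS

variable {B : Type v} {L : Type w} [GeneralizedBooleanAlgebra B] (S : GBDS B L)
variable (R : Type u) [CommRing R] (e : L ↪ ℕ)

/-! ### The algebra of the desingularization as matrices over the original algebra -/

/-- The matrix of `s_{l,x}`. -/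
def matS : ∀ (l : L ⊕ ℕ) (x : S.BF e), x ∈ (S.desing e).I l → ColEnd R (S.Alg R)
  | Sum.inl a, x, h =>
    ColEnd.unit R (e a + 1) 0 (S.s R a (S.levelZero e (x.1 0)) (S.levelZero_mem e h))
  | Sum.inr n, x, _ => ColEnd.unit R n (n + 1) (S.gapBar R e (n + 1) (x.1 (n + 1)))

/-- The matrix of `s_{l,x}^*`. -/
def matT : ∀ (l : L ⊕ ℕ) (x : S.BF e), x ∈ (S.desing e).I l → ColEnd R (S.Alg R)
  | Sum.inl a, x, h =>
    ColEnd.unit R 0 (e a + 1) (S.t R a (S.levelZero e (x.1 0)) (S.levelZero_mem e h))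
  | Sum.inr n, x, _ => ColEnd.unit R (n + 1) n (S.gapBar R e (n + 1) (x.1 (n + 1)))

theorem matS_inl (a : L) (x : S.BF e) (h : x ∈ (S.desing e).I (Sum.inl a)) :
    S.matS R e (Sum.inl a) x h =
      ColEnd.unit R (e a + 1) 0 (S.s R a (S.levelZero e (x.1 0)) (S.levelZero_mem e h)) := rfl

theorem matS_inr (n : ℕ) (x : S.BF e) (h : x ∈ (S.desing e).I (Sum.inr n)) :
    S.matS R e (Sum.inr n) x h =
      ColEnd.unit R n (n + 1) (S.gapBar R e (n + 1) (x.1 (n + 1))) := rfl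

theorem matT_inl (a : L) (x : S.BF e) (h : x ∈ (S.desing e).I (Sum.inl a)) :
    S.matT R e (Sum.inl a) x h =
      ColEnd.unit R 0 (e a + 1) (S.t R a (S.levelZero e (x.1 0)) (S.levelZero_mem e h)) := rfl

theorem matT_inr (n : ℕ) (x : S.BF e) (h : x ∈ (S.desing e).I (Sum.inr n)) :
    S.matT R e (Sum.inr n) x h =
      ColEnd.unit R (n + 1) n (S.gapBar R e (n + 1) (x.1 (n + 1))) := rfl

/-- The matrix of `p_x`. -/
def matP (x : S.BF e) : ColEnd R (S.Alg R) := ColEnd.diag R fun i => S.gapBar R e i (x.1 i)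

theorem inf_val (x y : S.BF e) (i : ℕ) : (x ⊓ y).1 i = x.1 i ⊓ y.1 i := rfl
theorem sup_val (x y : S.BF e) (i : ℕ) : (x ⊔ y).1 i = x.1 i ⊔ y.1 i := rfl

/-- All four products are the gap at `n + 1` of the intersection. This is the commutation of `p`
with `s_b` and `s_b^*` in matrix form. -/
theorem gapBar_mul_gapBar {n : ℕ} (A : B) (y : S.Level e (n + 1)) :
    S.gap R e n A * S.gapBar R e (n + 1) y =
      S.gapBar R e (n + 1) y * S.gap R e (n + 1) A ∧
    S.gapBar R e (n + 1) y * S.gap R e n A =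
      S.gap R e (n + 1) A * S.gapBar R e (n + 1) y := by
  obtain ⟨D, rfl⟩ := S.exists_rep e y
  rw [gapBar_mk, S.gap_mul_gap R e n.le_succ, S.gap_mul_gap' R e n.le_succ,
    S.gap_mul_gap R e le_rfl, S.gap_mul_gap R e le_rfl, inf_comm D A]
  exact ⟨rfl, rfl⟩

theorem inf_cls (x : S.BF e) {i : ℕ} {A : B} (h : x.1 i = IdealQuotient.mk (S.X e i) A) (D : B) :
    x ⊓ S.cls e i D = S.cls e i (A ⊓ D) := by
  refine FinSum.ext_iff'.2 fun j => ?_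
  rw [inf_val]
  by_cases hj : j = i
  · subst hj
    rw [cls_val_self, cls_val_self, h]
    rfl
  · rw [S.cls_val_ne e hj, S.cls_val_ne e hj]
    exact inf_bot_eq _

theorem cls_inf_cls (i : ℕ) (A D : B) : S.cls e i A ⊓ S.cls e i D = S.cls e i (A ⊓ D) :=
  S.inf_cls e _ (S.cls_val_self e i A) D

theorem matP_cls (i : ℕ) (A : B) :
    S.matP R e (S.cls e i A) = ColEnd.unit R i i (S.gap R e i A) := by
  refine LinearMap.ext fun y => funext fun j => ?_
  rw [matP, ColEnd.diag_apply, ColEnd.unit_apply]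
  by_cases h : j = i
  · subst h
    rw [cls_val_self, Pi.single_eq_same]
    rfl
  · rw [S.cls_val_ne e h, gapBar_bot, Pi.single_eq_of_ne h, Unitization.inr_zero, zero_mul]

/-- The value at `A` of `s_l s_l^*`, an idempotent in the corner of the source of `l`. -/
def letterProj (A : ℕ → B) : L ⊕ ℕ → S.Alg R
  | Sum.inl a => S.rangeProj R a (A (e a + 1))
  | Sum.inr n => S.gap R e (n + 1) (A n)

/-- The level on which the letter `l` acts. -/
def letterSource : L ⊕ ℕ → ℕ
  | Sum.inl a => e a + 1
  | Sum.inr n => n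

open Classical in
-- Only `b_{i+1}` and possibly the letter numbered `i` have source `i`, and their projections add up
-- to the gap at `i` by the recursion for gaps. This is the Cuntz–Krieger relation at the place `(i,
-- i)`.
theorem sum_letterProj (A : ℕ → B) (F : Finset (L ⊕ ℕ))
    (hF : ∀ l ∉ F, S.letterProj R e A l = 0) (i : ℕ) :
    (∑ l ∈ F, if letterSource e l = i then S.letterProj R e A l else 0) = S.gap R e i (A i) := by
  set g : L ⊕ ℕ → S.Alg R := fun l => if letterSource e l = i then S.letterProj R e A l else 0
    with hg
  -- Summing over all letters removes the dependence on `F`, which need not contain the two letters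
  -- of level `i`.
  have h1 : ∑ᶠ l, g l = ∑ l ∈ F, g l := finsum_eq_sum_of_support_subset _ fun l hl => by
    by_contra h
    refine hl ?_
    rw [hg]
    dsimp only
    rw [hF l h, ite_self]
  rw [← h1]
  have hr : g (Sum.inr i) = S.gap R e (i + 1) (A i) := if_pos rfl
  have hr' : ∀ n, n ≠ i → g (Sum.inr n) = 0 := fun n hn => if_neg hn
  by_cases h : ∃ a, e a + 1 = i
  · obtain ⟨a, ha⟩ := h
    have hl : g (Sum.inl a) = S.rangeProj R a (A i) := (if_pos ha).trans (by subst ha; rfl)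
    rw [finsum_eq_sum_of_support_subset (s := {Sum.inr i, Sum.inl a}), Finset.sum_pair (by simp),
      hr, hl, ← S.gap_succ_of_letter R e ha]
    rintro (b | n) hb
    · have : e b + 1 = i := by
        by_contra h
        exact hb (if_neg h)
      have : b = a := e.injective (Nat.succ_injective (this.trans ha.symm))
      simp [this]
    · have : n = i := by
        by_contra h
        exact hb (hr' n h)
      simp [this]
  · push Not at h
    rw [finsum_eq_single g (Sum.inr i), hr, ← S.gap_succ_of_no_letter R e h]
    rintro (b | n) hb
    · exact if_neg (h b)
    · exact hr' n (fun h => hb (by rw [h]))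

/-- The representation of the desingularization by matrices. -/
def matRep : (S.desing e).Rep (ColEnd R (S.Alg R)) where
  p := S.matP R e
  s := S.matS R e
  t := S.matT R e
  p_bot := by
    refine LinearMap.ext fun y => funext fun i => ?_
    change ((S.gapBar R e i ⊥ : S.Alg R) : Unitization R (S.Alg R)) * y i = 0
    rw [gapBar_bot, Unitization.inr_zero, zero_mul]
  p_inf x y := by
    rw [matP, matP, matP, ColEnd.diag_mul_diag]
    simp only [inf_val, gapBar_inf]
  p_sup x y := by
    refine LinearMap.ext fun z => funext fun i => ?_
    change ((S.gapBar R e i _ : S.Alg R) : Unitization R (S.Alg R)) * z i =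
      (S.gapBar R e i _ : S.Alg R) * z i + (S.gapBar R e i _ : S.Alg R) * z i -
        (S.gapBar R e i _ : S.Alg R) * z i
    rw [sup_val, gapBar_sup, inf_val, Unitization.inr_sub, Unitization.inr_add, sub_mul, add_mul]
  p_s x l y hy := by
    rcases l with a | n
    · obtain ⟨A, hA⟩ := S.exists_rep e (x.1 (e a + 1))
      rw [matS_inl, matP, matP, ColEnd.diag_mul_unit, ColEnd.unit_mul_diag, S.θF_inl_val e a x hA,
        cls_val_self, gapBar_mk, gap_zero, hA, gapBar_mk, S.gap_mul_s R e le_rfl, s_mul_P]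
    · obtain ⟨A, hA⟩ := S.exists_rep e (x.1 n)
      rw [matS_inr, matP, matP, ColEnd.diag_mul_unit, ColEnd.unit_mul_diag, S.θF_inr_val e n x hA,
        cls_val_self, hA, gapBar_mk, gapBar_mk, (S.gapBar_mul_gapBar R e _ _).1]
  t_p x l y hy := by
    rcases l with a | n
    · obtain ⟨A, hA⟩ := S.exists_rep e (x.1 (e a + 1))
      rw [matT_inl, matP, matP, ColEnd.diag_mul_unit, ColEnd.unit_mul_diag, S.θF_inl_val e a x hA,
        cls_val_self, gapBar_mk, gap_zero, hA, gapBar_mk, S.t_mul_gap R e le_rfl, P_mul_t]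
    · obtain ⟨A, hA⟩ := S.exists_rep e (x.1 n)
      rw [matT_inr, matP, matP, ColEnd.diag_mul_unit, ColEnd.unit_mul_diag, S.θF_inr_val e n x hA,
        cls_val_self, hA, gapBar_mk, gapBar_mk, (S.gapBar_mul_gapBar R e _ _).2]
  t_s_self l x y hx hy := by
    rcases l with a | n
    · obtain ⟨C, hC, rfl⟩ := id hx
      obtain ⟨D, hD, rfl⟩ := id hy
      rw [matT_inl, matS_inl, ColEnd.unit_mul_unit, t_mul_s_self, cls_inf_cls, matP_cls, gap_zero,
        cls_val_self, cls_val_self, levelZero_mk, levelZero_mk]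
    · obtain ⟨C, hC, rfl⟩ := id hx
      obtain ⟨D, hD, rfl⟩ := id hy
      rw [matT_inr, matS_inr, ColEnd.unit_mul_unit, cls_inf_cls, matP_cls, cls_val_self,
        cls_val_self, gapBar_mk, gapBar_mk, S.gap_mul_gap R e le_rfl]
  t_s_ne l l' h x y hx hy := by
    rcases l with a | n <;> rcases l' with b | m
    · rw [matT_inl, matS_inl]
      exact ColEnd.unit_mul_unit_of_ne (fun h' => h (congrArg _
        (e.injective (Nat.succ_injective h')))) _ _
    · rw [matT_inl, matS_inr]
      -- The places fit only if both letters start on the same level. Then the gap is the one at `e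
      -- a + 2`, where `a` has already been removed.
      by_cases h' : e a + 1 = m
      · subst h'
        obtain ⟨A, hA⟩ := S.exists_rep e (y.1 (e a + 1 + 1))
        rw [ColEnd.unit_mul_unit, hA, gapBar_mk, S.t_mul_gap_of_lt R e (Nat.lt_succ_self _),
          map_zero]
      · exact ColEnd.unit_mul_unit_of_ne h' _ _
    · rw [matT_inr, matS_inl]
      by_cases h' : e b + 1 = n
      · subst h'
        obtain ⟨A, hA⟩ := S.exists_rep e (x.1 (e b + 1 + 1))
        rw [ColEnd.unit_mul_unit, hA, gapBar_mk, S.gap_mul_s_of_lt R e (Nat.lt_succ_self _),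
          map_zero]
      · exact ColEnd.unit_mul_unit_of_ne (Ne.symm h') _ _
    · rw [matT_inr, matS_inr]
      exact ColEnd.unit_mul_unit_of_ne (fun h' => h (by rw [h'])) _ _
  s_p l x y hx := by
    rcases l with a | n
    · rw [matS_inl, matS_inl, matP, ColEnd.unit_mul_diag, gapBar_zero, s_mul_P]
      exact congrArg _ (S.s_congr R (S.levelZero_inf e _ _).symm _ _)
    · rw [matS_inr, matS_inr, matP, ColEnd.unit_mul_diag, ← gapBar_inf]
      rfl
  p_t l x y hx := by
    rcases l with a | n
    · rw [matT_inl, matT_inl, matP, ColEnd.diag_mul_unit, gapBar_zero, P_mul_t]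
      exact congrArg _ (S.t_congr R (S.levelZero_inf e _ _).symm _ _)
    · rw [matT_inr, matT_inr, matP, ColEnd.diag_mul_unit, ← gapBar_inf, inf_comm]
      rfl
  cuntzKrieger x hx F hF := by
    classical
    choose A hA using fun i => S.exists_rep e (x.1 i)
    have hF' : ∀ l ∉ F, S.letterProj R e A l = 0 := by
      rintro (a | n) h
      · rw [hF, Δ, Set.mem_ofPred_eq, not_not, S.θF_inl_val e a x (hA _), cls_eq_bot,
          mem_X_zero] at h
        exact S.rangeProj_eq_zero R h
      · rw [hF, Δ, Set.mem_ofPred_eq, not_not, S.θF_inr_val e n x (hA _), cls_eq_bot] at h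
        exact S.gap_eq_zero R e h
    have hterm : ∀ l, S.matS R e l _ ((S.desing e).θ_mem_I l x) *
        S.matT R e l _ ((S.desing e).θ_mem_I l x) =
        ColEnd.unit R (letterSource e l) (letterSource e l) (S.letterProj R e A l) := by
      rintro (a | n)
      · rw [matS_inl, matT_inl, ColEnd.unit_mul_unit]
        simp only [S.θF_inl_val e a x (hA _), cls_val_self, levelZero_mk]
        rfl
      · rw [matS_inr, matT_inr, ColEnd.unit_mul_unit, S.θF_inr_val e n x (hA _),
          cls_val_self, gapBar_mk, S.gap_mul_gap R e le_rfl, inf_idem]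
        rfl
    rw [Finset.sum_congr rfl fun l _ => hterm l]
    refine LinearMap.ext fun y => funext fun i => ?_
    rw [LinearMap.sum_apply, Finset.sum_apply, matP, ColEnd.diag_apply, hA, gapBar_mk,
      ← S.sum_letterProj R e A F hF']
    have : ∀ c : S.Alg R, (c : Unitization R (S.Alg R)) * y i =
      ((LinearMap.mulRight R (y i)).comp (Unitization.inrHom R R (S.Alg R))) c := fun _ => rfl
    rw [this, map_sum]
    refine Finset.sum_congr rfl fun l _ => ?_
    rw [ColEnd.unit_apply]
    split_ifs with h
    · subst h
      rw [Pi.single_eq_same]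
      rfl
    · rw [map_zero, Pi.single_eq_of_ne (Ne.symm h)]

end GBDS

namespace GBDS

variable {B : Type v} {L : Type w} [GeneralizedBooleanAlgebra B] (S : GBDS B L)
variable (R : Type u) [CommRing R] (e : L ↪ ℕ)

/-! ### Generators of the algebra of the desingularization -/

theorem cls_mem_inr (n : ℕ) (A : B) : S.cls e (n + 1) A ∈ (S.desing e).I (Sum.inr n) :=
  ⟨A, trivial, rfl⟩

theorem cls_mem_inl {a : L} {C : B} (hC : C ∈ S.I a) :
    S.cls e 0 C ∈ (S.desing e).I (Sum.inl a) := ⟨C, hC, rfl⟩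

/-- `p_{[A]_i}` -/
def pc (i : ℕ) (A : B) : (S.desing e).Alg R := (S.desing e).P R (S.cls e i A)

/-- `s_{b_{n+1},[A]_{n+1}}` -/
def sb (n : ℕ) (A : B) : (S.desing e).Alg R :=
  (S.desing e).s R (Sum.inr n) (S.cls e (n + 1) A) (S.cls_mem_inr e n A)

/-- `s_{b_{n+1},[A]_{n+1}}^*` -/
def tb (n : ℕ) (A : B) : (S.desing e).Alg R :=
  (S.desing e).t R (Sum.inr n) (S.cls e (n + 1) A) (S.cls_mem_inr e n A)

/-- `s_{a,[C]_0}` -/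
def sa (a : L) (C : B) (hC : C ∈ S.I a) : (S.desing e).Alg R :=
  (S.desing e).s R (Sum.inl a) (S.cls e 0 C) (S.cls_mem_inl e hC)

/-- `s_{a,[C]_0}^*` -/
def ta (a : L) (C : B) (hC : C ∈ S.I a) : (S.desing e).Alg R :=
  (S.desing e).t R (Sum.inl a) (S.cls e 0 C) (S.cls_mem_inl e hC)

theorem cls_bot (i : ℕ) : S.cls e i ⊥ = ⊥ := (S.cls_eq_bot e).2 (S.X e i).bot_mem

theorem cls_inf_cls_ne {i j : ℕ} (h : i ≠ j) (A D : B) : S.cls e i A ⊓ S.cls e j D = ⊥ := by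
  rw [S.inf_cls e _ (A := ⊥) ?_, bot_inf_eq, cls_bot]
  exact S.cls_val_ne e h.symm A

theorem cls_sup_cls (i : ℕ) (A D : B) : S.cls e i A ⊔ S.cls e i D = S.cls e i (A ⊔ D) :=
  (FinSum.ext_iff'.2 fun j => FinSum.single_op (B := S.Level e) (fun _ a b => a ⊔ b)
    (fun _ => sup_idem _) i (IdealQuotient.mk (S.X e i) A) (IdealQuotient.mk (S.X e i) D) j).symm

theorem θ_inl_cls_ne {i : ℕ} {a : L} (h : i ≠ e a + 1) (A : B) :
    (S.desing e).θ (Sum.inl a) (S.cls e i A) = ⊥ := by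
  rw [S.θF_inl_val e a _ (A := ⊥) (S.cls_val_ne e h.symm A), (S.θ a).map_bot, cls_bot]

theorem θ_inr_cls_ne {i n : ℕ} (h : i ≠ n) (A : B) :
    (S.desing e).θ (Sum.inr n) (S.cls e i A) = ⊥ := by
  rw [S.θF_inr_val e n _ (A := ⊥) (S.cls_val_ne e h.symm A), cls_bot]

theorem pc_mul_pc (i : ℕ) (A D : B) : S.pc R e i A * S.pc R e i D = S.pc R e i (A ⊓ D) := by
  rw [pc, pc, P_mul_P, cls_inf_cls, pc]

theorem pc_mul_pc_ne {i j : ℕ} (h : i ≠ j) (A D : B) : S.pc R e i A * S.pc R e j D = 0 := by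
  rw [pc, pc, P_mul_P, S.cls_inf_cls_ne e h, P_bot]

theorem pc_eq_zero {i : ℕ} {A : B} (h : A ∈ S.X e i) : S.pc R e i A = 0 := by
  rw [pc, (S.cls_eq_bot e).2 h, P_bot]

theorem pc_mul_sb (n : ℕ) (A C : B) : S.pc R e n A * S.sb R e n C = S.sb R e n (C ⊓ A) := by
  rw [pc, sb, P_mul_s]
  exact s_congr _ R (by rw [desing_θ_inr, cls_inf_cls]) _ _

theorem tb_mul_pc (n : ℕ) (A C : B) : S.tb R e n C * S.pc R e n A = S.tb R e n (C ⊓ A) := by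
  rw [pc, tb, t_mul_P]
  exact t_congr _ R (by rw [desing_θ_inr, cls_inf_cls]) _ _

theorem tb_mul_pc_ne {i n : ℕ} (h : i ≠ n) (A C : B) : S.tb R e n C * S.pc R e i A = 0 := by
  rw [pc, tb, t_mul_P]
  exact t_eq_zero _ R (by rw [S.θ_inr_cls_ne e h, inf_bot_eq]) _

theorem sb_mul_pc (n : ℕ) (A C : B) : S.sb R e n C * S.pc R e (n + 1) A = S.sb R e n (C ⊓ A) := by
  rw [pc, sb, s_mul_P]
  exact s_congr _ R (S.cls_inf_cls e _ _ _) _ _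

theorem pc_mul_tb (n : ℕ) (A C : B) : S.pc R e (n + 1) A * S.tb R e n C = S.tb R e n (C ⊓ A) := by
  rw [pc, tb, P_mul_t]
  exact t_congr _ R (S.cls_inf_cls e _ _ _) _ _

theorem sb_mul_pc_ne {i n : ℕ} (h : i ≠ n + 1) (A C : B) : S.sb R e n C * S.pc R e i A = 0 := by
  rw [pc, sb, s_mul_P]
  exact s_eq_zero _ R (S.cls_inf_cls_ne e h.symm _ _) _

theorem tb_mul_sb (n : ℕ) (A C : B) : S.tb R e n A * S.sb R e n C = S.pc R e (n + 1) (A ⊓ C) := by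
  rw [tb, sb, t_mul_s_self, cls_inf_cls, pc]

theorem pc_mul_sa (a : L) (A C : B) (hC : C ∈ S.I a) :
    S.pc R e (e a + 1) A * S.sa R e a C hC = S.sa R e a (C ⊓ S.θ a A) (S.inf_mem_I hC _) := by
  rw [pc, sa, P_mul_s]
  exact s_congr _ R (by rw [desing_θ_inl, cls_inf_cls]) _ _

theorem ta_mul_pc (a : L) (A C : B) (hC : C ∈ S.I a) :
    S.ta R e a C hC * S.pc R e (e a + 1) A = S.ta R e a (C ⊓ S.θ a A) (S.inf_mem_I hC _) := by
  rw [pc, ta, t_mul_P]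
  exact t_congr _ R (by rw [desing_θ_inl, cls_inf_cls]) _ _

theorem pc_mul_sa_ne {i : ℕ} {a : L} (h : i ≠ e a + 1) (A C : B) (hC : C ∈ S.I a) :
    S.pc R e i A * S.sa R e a C hC = 0 := by
  rw [pc, sa, P_mul_s]
  exact s_eq_zero _ R (by rw [S.θ_inl_cls_ne e h, inf_bot_eq]) _

theorem ta_mul_pc_ne {i : ℕ} {a : L} (h : i ≠ e a + 1) (A C : B) (hC : C ∈ S.I a) :
    S.ta R e a C hC * S.pc R e i A = 0 := by
  rw [pc, ta, t_mul_P]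
  exact t_eq_zero _ R (by rw [S.θ_inl_cls_ne e h, inf_bot_eq]) _

theorem sa_mul_pc (a : L) (A C : B) (hC : C ∈ S.I a) :
    S.sa R e a C hC * S.pc R e 0 A = S.sa R e a (C ⊓ A) (S.inf_mem_I hC _) := by
  rw [pc, sa, s_mul_P]
  exact s_congr _ R (S.cls_inf_cls e _ _ _) _ _

theorem pc_mul_ta (a : L) (A C : B) (hC : C ∈ S.I a) :
    S.pc R e 0 A * S.ta R e a C hC = S.ta R e a (C ⊓ A) (S.inf_mem_I hC _) := by
  rw [pc, ta, P_mul_t]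
  exact t_congr _ R (S.cls_inf_cls e _ _ _) _ _

theorem sa_mul_pc_ne {i : ℕ} (h : i ≠ 0) (a : L) (A C : B) (hC : C ∈ S.I a) :
    S.sa R e a C hC * S.pc R e i A = 0 := by
  rw [pc, sa, s_mul_P]
  exact s_eq_zero _ R (S.cls_inf_cls_ne e h.symm _ _) _

theorem ta_mul_sa (a : L) (C D : B) (hC : C ∈ S.I a) (hD : D ∈ S.I a) :
    S.ta R e a C hC * S.sa R e a D hD = S.pc R e 0 (C ⊓ D) := by
  rw [ta, sa, t_mul_s_self, cls_inf_cls, pc]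

theorem ta_mul_sa_ne {a b : L} (h : a ≠ b) (C D : B) (hC : C ∈ S.I a) (hD : D ∈ S.I b) :
    S.ta R e a C hC * S.sa R e b D hD = 0 :=
  t_mul_s_ne _ R (fun h' => h (Sum.inl_injective h')) _ _ _ _

theorem ta_mul_sb (a : L) (C : B) (hC : C ∈ S.I a) (n : ℕ) (D : B) :
    S.ta R e a C hC * S.sb R e n D = 0 := t_mul_s_ne _ R Sum.inl_ne_inr _ _ _ _

theorem tb_mul_sa (a : L) (C : B) (hC : C ∈ S.I a) (n : ℕ) (D : B) :
    S.tb R e n D * S.sa R e a C hC = 0 := t_mul_s_ne _ R Sum.inr_ne_inl _ _ _ _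

theorem sa_congr {a : L} {C D : B} (h : C = D) (hC : C ∈ S.I a) (hD : D ∈ S.I a) :
    S.sa R e a C hC = S.sa R e a D hD := by subst h; rfl

theorem ta_congr {a : L} {C D : B} (h : C = D) (hC : C ∈ S.I a) (hD : D ∈ S.I a) :
    S.ta R e a C hC = S.ta R e a D hD := by subst h; rfl

theorem rangeProj_inr (n : ℕ) (A : B) :
    (S.desing e).rangeProj R (Sum.inr n) (S.cls e n A) = S.sb R e n A * S.tb R e n A := by
  rw [rangeProj, sb, tb]
  congr 1
  · exact s_congr _ R (S.desing_θ_inr e n A) _ _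
  · exact t_congr _ R (S.desing_θ_inr e n A) _ _

theorem rangeProj_inl (a : L) (A : B) :
    (S.desing e).rangeProj R (Sum.inl a) (S.cls e (e a + 1) A) =
      S.sa R e a (S.θ a A) (S.θ_mem_I a A) * S.ta R e a (S.θ a A) (S.θ_mem_I a A) := by
  rw [rangeProj, sa, ta]
  congr 1
  · exact s_congr _ R (S.desing_θ_inl e a A) _ _
  · exact t_congr _ R (S.desing_θ_inl e a A) _ _

/-- The class `[A]_i` is regular, and at most `b_{i+1}` and the letter numbered `i` act on it, so
the Cuntz–Krieger relation has these two terms. -/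
theorem pc_eq_of_letter (a : L) (A : B) : S.pc R e (e a + 1) A =
    S.sb R e (e a + 1) A * S.tb R e (e a + 1) A +
      S.sa R e a (S.θ a A) (S.θ_mem_I a A) * S.ta R e a (S.θ a A) (S.θ_mem_I a A) := by
  classical
  rw [pc, P_eq_sum_rangeProj (S.desing e) R (S.regular_desing e ▸ Set.mem_univ _)
    {Sum.inr (e a + 1), Sum.inl a}, Finset.sum_pair (by simp), rangeProj_inr, rangeProj_inl]
  rintro (b | n) h
  · have : e b + 1 = e a + 1 := by
      by_contra h'
      exact h (S.θ_inl_cls_ne e (Ne.symm h') A)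
    have : b = a := e.injective (Nat.succ_injective this)
    simp [this]
  · have : n = e a + 1 := by
      by_contra h'
      exact h (S.θ_inr_cls_ne e (Ne.symm h') A)
    simp [this]

theorem pc_eq_of_no_letter {n : ℕ} (hn : ∀ a, e a + 1 ≠ n) (A : B) :
    S.pc R e n A = S.sb R e n A * S.tb R e n A := by
  rw [pc, P_eq_sum_rangeProj (S.desing e) R (S.regular_desing e ▸ Set.mem_univ _)
    {Sum.inr n}, Finset.sum_singleton, rangeProj_inr]
  rintro (b | m) h
  · exact (h (S.θ_inl_cls_ne e (hn b).symm A)).elim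
  · have : m = n := by
      by_contra h'
      exact h (S.θ_inr_cls_ne e (Ne.symm h') A)
    simp [this]

/-! ### Paths along the new letters -/

/-- `s_{b_1,A} ⋯ s_{b_n,A}` -/
def path (A : B) : ℕ → (S.desing e).Alg R
  | 0 => S.pc R e 0 A
  | n + 1 => path A n * S.sb R e n A

/-- `s_{b_n,A}^* ⋯ s_{b_1,A}^*` -/
def pathStar (A : B) : ℕ → (S.desing e).Alg R
  | 0 => S.pc R e 0 A
  | n + 1 => S.tb R e n A * pathStar A n

theorem path_succ (A : B) (n : ℕ) : S.path R e A (n + 1) = S.path R e A n * S.sb R e n A := rfl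
theorem pathStar_succ (A : B) (n : ℕ) :
    S.pathStar R e A (n + 1) = S.tb R e n A * S.pathStar R e A n := rfl

/-- The new letters act by quotient maps, which keep representatives. A projection can therefore be
moved along the path, and only the intersection of the labels matters. -/
theorem path_mul_pc (n : ℕ) (A D : B) :
    S.path R e A n * S.pc R e n D = S.path R e (A ⊓ D) n := by
  induction n generalizing D with
  | zero => exact S.pc_mul_pc R e 0 A D
  | succ n ih =>
    rw [path_succ, path_succ, ← ih, mul_assoc, mul_assoc, sb_mul_pc, pc_mul_sb, inf_assoc, inf_idem]

theorem pc_mul_pathStar (n : ℕ) (A D : B) :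
    S.pc R e n D * S.pathStar R e A n = S.pathStar R e (A ⊓ D) n := by
  induction n generalizing D with
  | zero => exact (S.pc_mul_pc R e 0 D A).trans (by rw [inf_comm]; rfl)
  | succ n ih =>
    rw [pathStar_succ, pathStar_succ, ← ih, ← mul_assoc, ← mul_assoc, pc_mul_tb, tb_mul_pc,
      inf_assoc, inf_idem]

theorem pc_mul_path (n : ℕ) (A D : B) :
    S.pc R e 0 D * S.path R e A n = S.path R e (A ⊓ D) n := by
  induction n with
  | zero => exact (S.pc_mul_pc R e 0 D A).trans (by rw [inf_comm]; rfl)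
  | succ n ih =>
    rw [path_succ, path_succ, ← mul_assoc, ih, ← path_mul_pc, mul_assoc, mul_assoc, pc_mul_sb,
      pc_mul_sb, inf_assoc, inf_idem]

theorem pathStar_mul_pc (n : ℕ) (A D : B) :
    S.pathStar R e A n * S.pc R e 0 D = S.pathStar R e (A ⊓ D) n := by
  induction n with
  | zero => exact S.pc_mul_pc R e 0 A D
  | succ n ih =>
    rw [pathStar_succ, pathStar_succ, mul_assoc, ih, ← pc_mul_pathStar, ← mul_assoc, ← mul_assoc,
      tb_mul_pc, tb_mul_pc, inf_assoc, inf_idem]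

theorem path_mul_pc_ne {n i : ℕ} (h : i ≠ n) (A D : B) : S.path R e A n * S.pc R e i D = 0 := by
  rw [← inf_idem A, ← path_mul_pc, mul_assoc, S.pc_mul_pc_ne R e h.symm, mul_zero]

theorem pc_mul_pathStar_ne {n i : ℕ} (h : i ≠ n) (A D : B) :
    S.pc R e i D * S.pathStar R e A n = 0 := by
  rw [← inf_idem A, ← pc_mul_pathStar, ← mul_assoc, S.pc_mul_pc_ne R e h, zero_mul]

theorem pathStar_mul_path (n : ℕ) (A D : B) :
    S.pathStar R e A n * S.path R e D n = S.pc R e n (A ⊓ D) := by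
  induction n with
  | zero => exact S.pc_mul_pc R e 0 A D
  | succ n ih =>
    rw [pathStar_succ, path_succ, mul_assoc, ← mul_assoc (S.pathStar R e A n), ih, pc_mul_sb,
      tb_mul_sb]
    congr 1
    ac_rfl

/-- A longer path continues a shorter one by a letter `b`. This gives the orthogonality of the
corner generators of distinct letters. -/
theorem exists_path_eq {i j : ℕ} (h : i < j) (A : B) :
    ∃ z, S.path R e A j = S.path R e A i * S.sb R e i A * z := by
  obtain ⟨k, rfl⟩ := Nat.exists_eq_add_of_lt h
  induction k with
  | zero =>
    refine ⟨S.pc R e (i + 1) A, ?_⟩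
    rw [mul_assoc, sb_mul_pc, inf_idem]
    rfl
  | succ k ih =>
    obtain ⟨z, hz⟩ := ih (by omega)
    refine ⟨z * S.sb R e (i + k + 1) A, ?_⟩
    rw [← mul_assoc, ← hz]
    rfl

theorem exists_pathStar_eq {i j : ℕ} (h : i < j) (A : B) :
    ∃ z, S.pathStar R e A j = z * (S.tb R e i A * S.pathStar R e A i) := by
  obtain ⟨k, rfl⟩ := Nat.exists_eq_add_of_lt h
  induction k with
  | zero =>
    refine ⟨S.pc R e (i + 1) A, ?_⟩
    rw [← mul_assoc, pc_mul_tb, inf_idem]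
    rfl
  | succ k ih =>
    obtain ⟨z, hz⟩ := ih (by omega)
    refine ⟨S.tb R e (i + k + 1) A * z, ?_⟩
    rw [mul_assoc, ← hz]
    rfl

/-! ### The corner of level zero -/

/-- The element `s_{b_1} ⋯ s_{b_i} s_{a,C}`, for `a = a_i` and `C ⊆ θ_a A` with some `A`. -/
def cornerS (a : L) (C : B) (h : C ∈ S.min.I a) : (S.desing e).Alg R :=
  S.path R e h.choose (e a + 1) * S.sa R e a C (S.min_I_le h)

/-- The element `s_{a,C}^* s_{b_i}^* ⋯ s_{b_1}^*`. -/
def cornerT (a : L) (C : B) (h : C ∈ S.min.I a) : (S.desing e).Alg R :=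
  S.ta R e a C (S.min_I_le h) * S.pathStar R e h.choose (e a + 1)

theorem pc_mul_sa_of_le {a : L} {A C : B} (hC : C ∈ S.I a) (h : C ≤ S.θ a A) :
    S.pc R e (e a + 1) A * S.sa R e a C hC = S.sa R e a C hC :=
  (S.pc_mul_sa R e a A C hC).trans (S.sa_congr R e (inf_eq_left.2 h) _ _)

theorem ta_mul_pc_of_le {a : L} {A C : B} (hC : C ∈ S.I a) (h : C ≤ S.θ a A) :
    S.ta R e a C hC * S.pc R e (e a + 1) A = S.ta R e a C hC :=
  (S.ta_mul_pc R e a A C hC).trans (S.ta_congr R e (inf_eq_left.2 h) _ _)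

/-- Independence of the label: two admissible labels can both be replaced by their intersection,
because `p_A` and `p_{A'}` both fix `s_{a,C}`. -/
theorem cornerS_eq {a : L} {A C : B} (hC : C ≤ S.θ a A) (h : C ∈ S.min.I a) :
    S.cornerS R e a C h = S.path R e A (e a + 1) * S.sa R e a C (S.min_I_le h) := by
  have h' : C ≤ S.θ a h.choose := h.choose_spec
  conv_lhs => rw [cornerS, ← S.pc_mul_sa_of_le R e _ hC, ← mul_assoc, path_mul_pc]
  conv_rhs => rw [← S.pc_mul_sa_of_le R e _ h', ← mul_assoc, path_mul_pc, inf_comm]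

theorem cornerT_eq {a : L} {A C : B} (hC : C ≤ S.θ a A) (h : C ∈ S.min.I a) :
    S.cornerT R e a C h = S.ta R e a C (S.min_I_le h) * S.pathStar R e A (e a + 1) := by
  have h' : C ≤ S.θ a h.choose := h.choose_spec
  conv_lhs => rw [cornerT, ← S.ta_mul_pc_of_le R e _ hC, mul_assoc, pc_mul_pathStar]
  conv_rhs => rw [← S.ta_mul_pc_of_le R e _ h', mul_assoc, pc_mul_pathStar, inf_comm]

theorem exists_mem_X_of_regular {A : B} (h : A ∈ S.regular) : ∃ n, A ∈ S.X e n := by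
  have hfin : (S.Δ A).Finite := by
    by_cases hA : A = ⊥
    · refine Set.finite_empty.subset fun a ha => ha ?_
      rw [hA, (S.θ a).map_bot]
    · exact (h A le_rfl hA).2
  -- One more than the largest number of a letter in `Δ A`, since membership in `X_n` requires the
  -- numbers to be strictly below `n`.
  refine ⟨hfin.toFinset.sup (fun a => e a + 1) + 1, fun V hV => ?_, fun a ha => ?_⟩
  · by_contra h'
    obtain ⟨a, ha⟩ := (h (A ⊓ V) inf_le_left h').1
    have := S.Δ_mono inf_le_right ha
    rw [show S.Δ V = ∅ from hV] at this
    exact this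
  · exact Nat.lt_succ_of_le (Finset.le_sup (f := fun a => e a + 1) (hfin.mem_toFinset.2 ha))

/-- Each step splits the projection at the end of the path into the part that continues along `b`
and the part that leaves by the letter of that level, if there is one. -/
theorem pc_zero_eq (A : B) (n : ℕ) : S.pc R e 0 A = S.path R e A n * S.pathStar R e A n +
    ∑ a ∈ lettersBelow e n, S.cornerS R e a (S.θ a A) (S.mem_min_I le_rfl) *
      S.cornerT R e a (S.θ a A) (S.mem_min_I le_rfl) := by
  classical
  induction n with
  | zero =>
    rw [Finset.sum_eq_zero fun a ha => absurd ((mem_lettersBelow e).1 ha) (Nat.not_lt_zero _),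
      add_zero]
    exact ((S.pc_mul_pc R e 0 A A).trans (by rw [inf_idem])).symm
  | succ n ih =>
    have h1 : S.path R e A n * S.pathStar R e A n =
        S.path R e A n * S.pc R e n A * S.pathStar R e A n := by
      rw [path_mul_pc, inf_idem]
    rw [ih, h1]
    by_cases h : ∃ a, e a + 1 = n
    · obtain ⟨a, rfl⟩ := h
      rw [lettersBelow_succ_of_letter e rfl, Finset.sum_insert, pc_eq_of_letter,
        S.cornerS_eq R e le_rfl, S.cornerT_eq R e le_rfl,
        S.path_succ R e A (e a + 1), S.pathStar_succ R e A (e a + 1)]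
      · simp only [mul_add, add_mul, mul_assoc, add_assoc]
      · rw [mem_lettersBelow]
        exact lt_irrefl _
    · push Not at h
      rw [lettersBelow_succ_of_no_letter e h, S.pc_eq_of_no_letter R e h, path_succ, pathStar_succ]
      simp only [mul_assoc]

/-- The representation of `S.min` in the corner of level zero. -/
def cornerRep : S.min.Rep ((S.desing e).Alg R) where
  p := S.pc R e 0
  s := S.cornerS R e
  t := S.cornerT R e
  p_bot := S.pc_eq_zero R e (S.X e 0).bot_mem
  p_inf C D := (S.pc_mul_pc R e 0 C D).symm
  p_sup C D := by
    rw [pc, ← cls_sup_cls, P_sup, cls_inf_cls]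
    rfl
  p_s D a C hC := by
    obtain ⟨A, hA⟩ := id hC
    rw [S.cornerS_eq R e hA, ← mul_assoc, pc_mul_path, ← path_mul_pc, mul_assoc, mul_assoc,
      pc_mul_sa, sa_mul_pc]
    rfl
  t_p D a C hC := by
    obtain ⟨A, hA⟩ := id hC
    rw [S.cornerT_eq R e hA, mul_assoc, pathStar_mul_pc, ← pc_mul_pathStar, ← mul_assoc,
      ← mul_assoc, ta_mul_pc, pc_mul_ta]
    rfl
  t_s_self a C D hC hD := by
    obtain ⟨A, hA⟩ := id hC
    obtain ⟨A', hA'⟩ := id hD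
    rw [S.cornerT_eq R e hA, S.cornerS_eq R e hA', mul_assoc, ← mul_assoc (S.pathStar R e A _),
      pathStar_mul_path, ← pc_mul_pc, mul_assoc, S.pc_mul_sa_of_le R e _ hA', ← mul_assoc,
      S.ta_mul_pc_of_le R e _ hA, ta_mul_sa]
  t_s_ne a b h C D hC hD := by
    obtain ⟨A, hA⟩ := id hC
    obtain ⟨A', hA'⟩ := id hD
    rw [S.cornerT_eq R e hA, S.cornerS_eq R e hA']
    -- The longer path leaves the end level of the shorter one along a letter `b_k`, where the
    -- shorter one exits by a letter of `L`; ranges of distinct letters are orthogonal.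
    rcases lt_trichotomy (e a + 1) (e b + 1) with h' | h' | h'
    · obtain ⟨z, hz⟩ := S.exists_path_eq R e h' A'
      rw [hz, mul_assoc, mul_assoc, mul_assoc, ← mul_assoc (S.pathStar R e A _),
        pathStar_mul_path, ← mul_assoc (S.pc R e _ _), pc_mul_sb, ← mul_assoc, ta_mul_sb,
        zero_mul]
    · exact (h (e.injective (Nat.succ_injective h'))).elim
    · obtain ⟨z, hz⟩ := S.exists_pathStar_eq R e h' A
      rw [hz, mul_assoc, mul_assoc, mul_assoc, ← mul_assoc (S.pathStar R e A _),
        pathStar_mul_path, pc_mul_sa, tb_mul_sa, mul_zero, mul_zero]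
  s_p a C D hC := by
    obtain ⟨A, hA⟩ := id hC
    rw [S.cornerS_eq R e hA, S.cornerS_eq R e (inf_le_left.trans hA), mul_assoc, sa_mul_pc]
  p_t a C D hC := by
    obtain ⟨A, hA⟩ := id hC
    rw [S.cornerT_eq R e hA, S.cornerT_eq R e (inf_le_left.trans hA), ← mul_assoc, pc_mul_ta]
  cuntzKrieger C hC F hF := by
    obtain ⟨n, hn⟩ := S.exists_mem_X_of_regular e hC
    -- The remainder ends in `p_{[C]_n}`, which is zero because `C` lies in `X_n`.
    have h0 : S.path R e C n = 0 := by
      rw [← inf_idem C, ← path_mul_pc, S.pc_eq_zero R e hn, mul_zero]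
    rw [S.pc_zero_eq R e C n, h0, zero_mul, zero_add]
    symm
    refine Finset.sum_subset (fun a ha => (mem_lettersBelow e).2 (hn.2 a ((hF a).1 ha)))
      fun a _ ha => ?_
    rw [hF] at ha
    have h0 : S.θ a C = ⊥ := not_not.1 ha
    have : S.sa R e a (S.θ a C) (S.θ_mem_I a C) = 0 :=
      s_eq_zero _ R (by rw [h0, cls_bot]) _
    change S.cornerS R e a (S.θ a C) (S.mem_min_I le_rfl) * _ = 0
    rw [S.cornerS_eq R e le_rfl, this, mul_zero, zero_mul]

/-! ### Comparison of the corner with the matrices -/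

/-- The homomorphism from the algebra of `S.min` to the corner of level zero. -/
def cornerHom : S.min.Alg R →ₙₐ[R] (S.desing e).Alg R := (S.cornerRep R e).lift R

/-- The homomorphism from the algebra of the desingularization to matrices. -/
def matHom : (S.desing e).Alg R →ₙₐ[R] ColEnd R (S.Alg R) := (S.matRep R e).lift R

theorem matHom_pc (i : ℕ) (A : B) :
    S.matHom R e (S.pc R e i A) = ColEnd.unit R i i (S.gap R e i A) :=
  ((S.matRep R e).lift_P _).trans (S.matP_cls R e i A)

theorem matHom_sb (n : ℕ) (A : B) :
    S.matHom R e (S.sb R e n A) = ColEnd.unit R n (n + 1) (S.gap R e (n + 1) A) := by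
  refine ((S.matRep R e).lift_s _ _ _).trans ((S.matS_inr R e _ _ (S.cls_mem_inr e n A)).trans ?_)
  rw [cls_val_self, gapBar_mk]

theorem matHom_tb (n : ℕ) (A : B) :
    S.matHom R e (S.tb R e n A) = ColEnd.unit R (n + 1) n (S.gap R e (n + 1) A) := by
  refine ((S.matRep R e).lift_t _ _ _).trans ((S.matT_inr R e _ _ (S.cls_mem_inr e n A)).trans ?_)
  rw [cls_val_self, gapBar_mk]

theorem matHom_sa (a : L) (C : B) (hC : C ∈ S.I a) :
    S.matHom R e (S.sa R e a C hC) = ColEnd.unit R (e a + 1) 0 (S.s R a C hC) :=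
  ((S.matRep R e).lift_s _ _ (S.cls_mem_inl e hC)).trans ((S.matS_inl R e _ _ (S.cls_mem_inl e hC)).trans
    (congrArg _ (S.s_congr R (by rw [cls_val_self, levelZero_mk]) (S.levelZero_mem e (S.cls_mem_inl e hC)) hC)))

theorem matHom_ta (a : L) (C : B) (hC : C ∈ S.I a) :
    S.matHom R e (S.ta R e a C hC) = ColEnd.unit R 0 (e a + 1) (S.t R a C hC) :=
  ((S.matRep R e).lift_t _ _ (S.cls_mem_inl e hC)).trans ((S.matT_inl R e _ _ (S.cls_mem_inl e hC)).trans
    (congrArg _ (S.t_congr R (by rw [cls_val_self, levelZero_mk]) (S.levelZero_mem e (S.cls_mem_inl e hC)) hC)))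

theorem matHom_path (A : B) (n : ℕ) :
    S.matHom R e (S.path R e A n) = ColEnd.unit R 0 n (S.gap R e n A) := by
  induction n with
  | zero => exact S.matHom_pc R e 0 A
  | succ n ih =>
    rw [path_succ, map_mul, ih, matHom_sb, ColEnd.unit_mul_unit, S.gap_mul_gap R e n.le_succ,
      inf_idem]

theorem matHom_pathStar (A : B) (n : ℕ) :
    S.matHom R e (S.pathStar R e A n) = ColEnd.unit R n 0 (S.gap R e n A) := by
  induction n with
  | zero => exact S.matHom_pc R e 0 A
  | succ n ih =>
    rw [pathStar_succ, map_mul, ih, matHom_tb, ColEnd.unit_mul_unit, S.gap_mul_gap' R e n.le_succ,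
      inf_idem]

theorem cornerHom_P (A : B) : S.cornerHom R e (S.min.P R A) = S.pc R e 0 A :=
  (S.cornerRep R e).lift_P A
theorem cornerHom_s (a : L) (C : B) (h : C ∈ S.min.I a) :
    S.cornerHom R e (S.min.s R a C h) = S.cornerS R e a C h := (S.cornerRep R e).lift_s a C h
theorem cornerHom_t (a : L) (C : B) (h : C ∈ S.min.I a) :
    S.cornerHom R e (S.min.t R a C h) = S.cornerT R e a C h := (S.cornerRep R e).lift_t a C h

/-- It suffices to compare generators. A path to level `e a + 1` becomes the gap at that index,
which does not alter `s_{a,C}` for `C ⊆ θ_a A`. -/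
theorem matHom_cornerHom (v : S.min.Alg R) :
    S.matHom R e (S.cornerHom R e v) = ColEnd.unit R 0 0 (S.minHom R v) := by
  induction v using S.min.alg_induction R with
  | hp C => rw [cornerHom_P, matHom_pc, minHom_P, gap_zero]
  | hs a C hC =>
    obtain ⟨A, hA⟩ := id hC
    rw [cornerHom_s, S.cornerS_eq R e hA, map_mul, matHom_path, matHom_sa, minHom_s,
      ColEnd.unit_mul_unit, S.gap_mul_s R e le_rfl]
    exact congrArg _ (S.s_congr R (inf_eq_left.2 hA) _ _)
  | ht a C hC =>
    obtain ⟨A, hA⟩ := id hC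
    rw [cornerHom_t, S.cornerT_eq R e hA, map_mul, matHom_pathStar, matHom_ta, minHom_t,
      ColEnd.unit_mul_unit, S.t_mul_gap R e le_rfl]
    exact congrArg _ (S.t_congr R (inf_eq_left.2 hA) _ _)
  | hmul x y hx hy => rw [map_mul, map_mul, hx, hy, ColEnd.unit_mul_unit, ← map_mul (S.minHom R)]
  | hadd x y hx hy => rw [map_add, map_add, hx, hy, map_add, map_add]
  | hsmul r x hx => rw [map_smul, map_smul, hx, map_smul, map_smul]

theorem cornerHom_eq_zero {v : S.min.Alg R} (h : S.matHom R e (S.cornerHom R e v) = 0) : v = 0 := by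
  rw [matHom_cornerHom] at h
  exact (map_eq_zero_iff _ (S.minHom_injective R)).1
    ((map_eq_zero_iff _ (ColEnd.unit_injective 0 0)).1 h)

end GBDS

namespace GBDS

variable {B : Type v} {L : Type w} [GeneralizedBooleanAlgebra B] (S : GBDS B L)
variable (R : Type u) [CommRing R] (e : L ↪ ℕ)

/-! ### Spanning sets relative to a corner -/

section Span

variable {S} {R} {Q : Type x} [NonUnitalRing Q] [Module R Q]
  (c : Q →ₙₐ[R] S.Alg R) (X Y : Set (S.Alg R))

/-- The span of the products `l c(v) r` with `l ∈ X` and `r ∈ Y`. -/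
def sandwich : Submodule R (S.Alg R) :=
  Submodule.span R {z | ∃ l ∈ X, ∃ v, ∃ r ∈ Y, z = l * c v * r}

/-- The span of the products `l c(v)` with `l ∈ X`. -/
def leftSpan : Submodule R (S.Alg R) := Submodule.span R {z | ∃ l ∈ X, ∃ v, z = l * c v}

variable {c X Y}

theorem mem_sandwich {l r : S.Alg R} (hl : l ∈ X) (v : Q) (hr : r ∈ Y) :
    l * c v * r ∈ sandwich c X Y := Submodule.subset_span ⟨l, hl, v, r, hr, rfl⟩

theorem mem_leftSpan {l : S.Alg R} (hl : l ∈ X) (v : Q) : l * c v ∈ leftSpan c X :=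
  Submodule.subset_span ⟨l, hl, v, rfl⟩

/-- The sandwich is then a left ideal containing the generators. Multiplying by a generator may
create a new factor `c v'` behind `l`, and it is absorbed into `c v`; the right factors are never
touched. -/
theorem mem_sandwich_of_left_stable (hg : ∀ g, S.gen R g ∈ sandwich c X Y)
    (hX : ∀ g, ∀ l ∈ X, S.gen R g * l ∈ leftSpan c X) (z : S.Alg R) : z ∈ sandwich c X Y := by
  refine S.mem_of_left_stable R _ hg (fun g x hx => ?_) z
  refine Submodule.span_induction ?_ ?_ (fun x y _ _ hx hy => ?_) (fun t x _ hx => ?_) hx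
  · rintro _ ⟨l, hl, v, r, hr, rfl⟩
    have key : ∀ y ∈ leftSpan c X, y * c v * r ∈ sandwich c X Y := by
      intro y hy
      refine Submodule.span_induction ?_ ?_ (fun x y _ _ hx hy => ?_) (fun t x _ hx => ?_) hy
      · rintro _ ⟨l, hl, v', rfl⟩
        rw [mul_assoc l, ← map_mul]
        exact mem_sandwich hl _ hr
      · simp
      · rw [add_mul, add_mul]
        exact add_mem hx hy
      · rw [smul_mul_assoc, smul_mul_assoc]
        exact Submodule.smul_mem _ _ hx
    rw [← mul_assoc, ← mul_assoc]
    exact key _ (hX g l hl)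
  · simp
  · rw [mul_add]
    exact add_mem hx hy
  · rw [mul_smul_comm]
    exact Submodule.smul_mem _ _ hx

/-- If `p l` and `r q` are themselves in the image of `c`, so is `p l c(v) r q`. -/
theorem corner_mem_range {p q : S.Alg R} (hp : ∀ l ∈ X, p * l ∈ Set.range c)
    (hq : ∀ r ∈ Y, r * q ∈ Set.range c) {x : S.Alg R} (hx : x ∈ sandwich c X Y) :
    p * x * q ∈ Set.range c := by
  refine Submodule.span_induction ?_ ?_ (fun x y _ _ hx hy => ?_) (fun t x _ hx => ?_) hx
  · rintro _ ⟨l, hl, v, r, hr, rfl⟩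
    obtain ⟨a, ha⟩ := hp l hl
    obtain ⟨b, hb⟩ := hq r hr
    refine ⟨a * v * b, ?_⟩
    rw [map_mul, map_mul, ha, hb]
    simp only [mul_assoc]
  · exact ⟨0, by simp⟩
  · obtain ⟨a, ha⟩ := hx
    obtain ⟨b, hb⟩ := hy
    exact ⟨a + b, by rw [map_add, ha, hb, mul_add, add_mul]⟩
  · obtain ⟨a, ha⟩ := hx
    exact ⟨t • a, by rw [map_smul, ha, mul_smul_comm, smul_mul_assoc]⟩

end Span

/-! ### The algebra of `S` -/

/-- The elements `p_A` and `s_{a,C}`. -/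
def leftGens : Set (S.Alg R) := {z | (∃ A, z = S.P R A) ∨ ∃ a C hC, z = S.s R a C hC}

/-- The elements `p_A` and `s_{a,C}^*`. -/
def rightGens : Set (S.Alg R) := {z | (∃ A, z = S.P R A) ∨ ∃ a C hC, z = S.t R a C hC}

/-- Fullness of the image of `S.min`. The critical products become admissible by inserting
projections: `s_{a,C} s_{b,D} = s_{a,C} s_{b, D ∩ θ_b C}` and `s_{a,C}^* p_A = s_{a, C ∩ θ_a A}^*`,
whose last labels lie in the minimal ideals. -/
theorem mem_sandwich_minHom (z : S.Alg R) :
    z ∈ sandwich (S.minHom R) (S.leftGens R) (S.rightGens R) := by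
  have hs : ∀ a C hC, S.s R a C hC ∈ leftSpan (S.minHom R) (S.leftGens R) := fun a C hC => by
    rw [← S.s_mul_P_of_le R hC le_rfl, ← minHom_P]
    exact mem_leftSpan (Or.inr ⟨a, C, hC, rfl⟩) _
  have hP : ∀ A, S.P R A ∈ leftSpan (S.minHom R) (S.leftGens R) := fun A => by
    rw [← S.P_mul_P_of_le R (le_refl A)]
    nth_rw 2 [← minHom_P]
    exact mem_leftSpan (Or.inl ⟨A, rfl⟩) _
  refine mem_sandwich_of_left_stable ?_ ?_ z
  · rintro (C | ⟨a, C, hC⟩ | ⟨a, C, hC⟩)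
    · have := mem_sandwich (c := S.minHom R) (X := S.leftGens R) (Y := S.rightGens R)
        (Or.inl ⟨C, rfl⟩) (S.min.P R C) (Or.inl ⟨C, rfl⟩)
      rwa [minHom_P, P_mul_P, P_mul_P, inf_idem, inf_idem] at this
    · have := mem_sandwich (c := S.minHom R) (X := S.leftGens R) (Y := S.rightGens R)
        (Or.inr ⟨a, C, hC, rfl⟩) (S.min.P R C) (Or.inl ⟨C, rfl⟩)
      rwa [minHom_P, S.s_mul_P_of_le R hC le_rfl, S.s_mul_P_of_le R hC le_rfl] at this
    · have := mem_sandwich (c := S.minHom R) (X := S.leftGens R) (Y := S.rightGens R)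
        (Or.inl ⟨C, rfl⟩) (S.min.P R C) (Or.inr ⟨a, C, hC, rfl⟩)
      rwa [minHom_P, P_mul_P, inf_idem, S.P_mul_t_of_le R hC le_rfl] at this
  · rintro (C | ⟨a, C, hC⟩ | ⟨a, C, hC⟩) _ (⟨A, rfl⟩ | ⟨b, D, hD, rfl⟩)
    · change S.P R C * _ ∈ _
      rw [P_mul_P]
      exact hP _
    · change S.P R C * _ ∈ _
      rw [P_mul_s]
      exact hs _ _ _
    · change S.s R a C hC * _ ∈ _
      rw [← minHom_P]
      exact mem_leftSpan (Or.inr ⟨a, C, hC, rfl⟩) _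
    · change S.s R a C hC * _ ∈ _
      rw [← S.s_mul_P_of_le R hC le_rfl, mul_assoc, P_mul_s,
        ← S.minHom_s R b _ (S.mem_min_I inf_le_right)]
      exact mem_leftSpan (Or.inr ⟨a, C, hC, rfl⟩) _
    · change S.t R a C hC * _ ∈ _
      rw [t_mul_P, ← S.P_mul_t_of_le R _ le_rfl, ← S.minHom_t R a _ (S.mem_min_I inf_le_right)]
      exact mem_leftSpan (Or.inl ⟨_, rfl⟩) _
    · change S.t R a C hC * _ ∈ _
      by_cases h : a = b
      · subst h
        rw [t_mul_s_self]
        exact hP _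
      · rw [S.t_mul_s_ne R h]
        exact zero_mem _

/-- Compression by `p_A` and `p_D` cuts the labels down to `C ∩ θ_a A` and `C ∩ θ_a D`, which belong
to the minimal ideals. -/
theorem P_mul_mul_P_mem (A D : B) (z : S.Alg R) :
    S.P R A * z * S.P R D ∈ Set.range (S.minHom R) := by
  refine corner_mem_range ?_ ?_ (S.mem_sandwich_minHom R z)
  · rintro _ (⟨C, rfl⟩ | ⟨a, C, hC, rfl⟩)
    · exact ⟨S.min.P R (A ⊓ C), by rw [minHom_P, P_mul_P]⟩
    · exact ⟨S.min.s R a (C ⊓ S.θ a A) (S.mem_min_I inf_le_right), by rw [minHom_s, P_mul_s]⟩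
  · rintro _ (⟨C, rfl⟩ | ⟨a, C, hC, rfl⟩)
    · exact ⟨S.min.P R (C ⊓ D), by rw [minHom_P, P_mul_P]⟩
    · exact ⟨S.min.t R a (C ⊓ S.θ a D) (S.mem_min_I inf_le_right), by rw [minHom_t, t_mul_P]⟩

/-! ### The algebra of the desingularization -/

/-- The elements `s_{b_i,A}^* ⋯ s_{b_1,A}^*` and `s_{a,C}`. -/
def leftPaths : Set ((S.desing e).Alg R) :=
  {z | (∃ A i, z = S.pathStar R e A i) ∨ ∃ a C hC, z = S.sa R e a C hC}

/-- The elements `s_{b_1,A} ⋯ s_{b_i,A}` and `s_{a,C}^*`. -/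
def rightPaths : Set ((S.desing e).Alg R) :=
  {z | (∃ A i, z = S.path R e A i) ∨ ∃ a C hC, z = S.ta R e a C hC}

theorem pathStar_mul_cornerHom (A : B) (i : ℕ) :
    S.pathStar R e A i * S.cornerHom R e (S.min.P R A) = S.pathStar R e A i := by
  rw [cornerHom_P, pathStar_mul_pc, inf_idem]

theorem pathStar_mem_leftSpan (A : B) (i : ℕ) :
    S.pathStar R e A i ∈ leftSpan (S.cornerHom R e) (S.leftPaths R e) := by
  rw [← pathStar_mul_cornerHom]
  exact mem_leftSpan (Or.inl ⟨A, i, rfl⟩) _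

theorem sa_mul_cornerHom (a : L) (C : B) (hC : C ∈ S.I a) :
    S.sa R e a C hC * S.cornerHom R e (S.min.P R C) = S.sa R e a C hC := by
  rw [cornerHom_P, sa_mul_pc]
  exact S.sa_congr R e (inf_idem _) _ _

theorem sa_mem_leftSpan (a : L) (C : B) (hC : C ∈ S.I a) :
    S.sa R e a C hC ∈ leftSpan (S.cornerHom R e) (S.leftPaths R e) := by
  rw [← sa_mul_cornerHom]
  exact mem_leftSpan (Or.inr ⟨a, C, hC, rfl⟩) _

theorem ta_mul_pathStar (a : L) (C D : B) (hC : C ∈ S.I a) :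
    S.ta R e a C hC * S.pathStar R e D (e a + 1) =
      S.cornerHom R e (S.min.t R a (C ⊓ S.θ a D) (S.mem_min_I inf_le_right)) := by
  rw [cornerHom_t, S.cornerT_eq R e inf_le_right, ← S.ta_mul_pc R e a D C hC, mul_assoc,
    pc_mul_pathStar, inf_idem]

theorem ta_mul_pathStar_ne {i : ℕ} {a : L} (h : i ≠ e a + 1) (C D : B) (hC : C ∈ S.I a) :
    S.ta R e a C hC * S.pathStar R e D i = 0 := by
  rw [← inf_idem D, ← pc_mul_pathStar, ← mul_assoc, S.ta_mul_pc_ne R e h, zero_mul]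

theorem sb_mul_tb (n : ℕ) (A D : B) :
    S.sb R e n A * S.tb R e n D = S.sb R e n (A ⊓ D) * S.tb R e n (A ⊓ D) := by
  conv_rhs => rw [← sb_mul_pc, mul_assoc, pc_mul_tb]
  conv_lhs => rw [← inf_idem A, ← sb_mul_pc, mul_assoc, pc_mul_tb]
  congr 2
  ac_rfl

theorem tb_mul_pathStar (n : ℕ) (A D : B) :
    S.tb R e n A * S.pathStar R e D n = S.pathStar R e (D ⊓ A) (n + 1) := by
  rw [← pc_mul_pathStar, pathStar_succ, ← mul_assoc, pc_mul_tb, inf_comm D A, ← tb_mul_pc,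
    mul_assoc, pc_mul_pathStar, inf_idem]

/-- The Cuntz–Krieger relation turns `s_b s_b^*` into `p - s_a s_a^*`. The term with `p` is again a
path, and in the other one `s_a^*` completes the path to a corner element. -/
theorem sb_mul_pathStar_mem (n : ℕ) (A D : B) :
    S.sb R e n A * S.pathStar R e D (n + 1) ∈ leftSpan (S.cornerHom R e) (S.leftPaths R e) := by
  rw [pathStar_succ, ← mul_assoc, sb_mul_tb]
  by_cases h : ∃ a, e a + 1 = n
  · obtain ⟨a, rfl⟩ := h
    rw [eq_sub_of_add_eq (S.pc_eq_of_letter R e a (A ⊓ D)).symm, sub_mul, pc_mul_pathStar,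
      mul_assoc, ta_mul_pathStar]
    exact sub_mem (S.pathStar_mem_leftSpan R e _ _) (mem_leftSpan (Or.inr ⟨a, _, _, rfl⟩) _)
  · push Not at h
    rw [← S.pc_eq_of_no_letter R e h, pc_mul_pathStar]
    exact S.pathStar_mem_leftSpan R e _ _

/-- The product is nonzero only if `b` ends where `a` starts. Routing `s_b` through level zero then
produces a full path followed by `a`, a corner generator. -/
theorem sb_mul_sa_mem (n : ℕ) (A : B) (a : L) (C : B) (hC : C ∈ S.I a) :
    S.sb R e n A * S.sa R e a C hC ∈ leftSpan (S.cornerHom R e) (S.leftPaths R e) := by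
  by_cases h : n + 1 = e a + 1
  · obtain rfl : n = e a := Nat.succ_injective h
    have h1 : S.sb R e (e a) A = S.pathStar R e A (e a) * S.path R e A (e a + 1) := by
      rw [path_succ, ← mul_assoc, pathStar_mul_path, pc_mul_sb, inf_idem, inf_idem]
    rw [h1, mul_assoc, ← inf_idem A, ← path_mul_pc, mul_assoc, pc_mul_sa,
      ← S.cornerS_eq R e inf_le_right (S.mem_min_I inf_le_right), ← cornerHom_s]
    exact mem_leftSpan (Or.inl ⟨_, _, rfl⟩) _
  · rw [← inf_idem A, ← sb_mul_pc, mul_assoc, S.pc_mul_sa_ne R e h, mul_zero]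
    exact zero_mem _

/-- The level-zero corner is full because every level is joined to level zero by a path: `p_{[A]_i}`
is a starred path times a path, and the other generators factor similarly. -/
theorem mem_sandwich_cornerHom (z : (S.desing e).Alg R) :
    z ∈ sandwich (S.cornerHom R e) (S.leftPaths R e) (S.rightPaths R e) := by
  refine mem_sandwich_of_left_stable ?_ ?_ z
  · rintro (x | ⟨a | n, _, C, hC, rfl⟩ | ⟨a | n, _, C, hC, rfl⟩)
    · change (S.desing e).P R x ∈ _
      have hpc : ∀ i A, S.pc R e i A ∈
          sandwich (S.cornerHom R e) (S.leftPaths R e) (S.rightPaths R e) := fun i A => by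
        rw [← inf_idem A, ← pathStar_mul_path, ← S.pathStar_mul_cornerHom R e]
        exact mem_sandwich (Or.inl ⟨A, i, rfl⟩) _ (Or.inl ⟨A, i, rfl⟩)
      -- A general `p_x` is a finite sum of projections `p_{[A]_i}`; the induction splits off the
      -- highest level that may be nonempty.
      have key : ∀ (N : ℕ) (x : S.BF e), (∀ i, N ≤ i → x.1 i = ⊥) → (S.desing e).P R x ∈
          sandwich (S.cornerHom R e) (S.leftPaths R e) (S.rightPaths R e) := by
        intro N
        induction N with
        | zero =>
          intro x hx
          rw [show x = ⊥ from FinSum.ext_iff'.2 fun i => hx i (Nat.zero_le i), P_bot]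
          exact zero_mem _
        | succ N ih =>
          intro x hx
          obtain ⟨A, hA⟩ := S.exists_rep e (x.1 N)
          have h1 : (S.desing e).P R x =
              S.pc R e N (A ⊓ A) + (S.desing e).P R (x \ S.cls e N A) := by
            conv_lhs => rw [← sup_inf_sdiff x (S.cls e N A), P_sup, inf_inf_sdiff, P_bot, sub_zero,
              S.inf_cls e x hA]
            rfl
          rw [h1]
          refine add_mem (hpc _ _) (ih _ fun i hi => ?_)
          change x.1 i \ (S.cls e N A).1 i = ⊥
          rcases hi.eq_or_lt with rfl | hi
          · rw [cls_val_self, hA]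
            exact sdiff_self
          · rw [hx i hi]
            exact bot_sdiff
      obtain ⟨N, hN⟩ := Set.Finite.bddAbove (show {i | x.1 i ≠ ⊥}.Finite from x.2)
      refine key (N + 1) x fun i hi => ?_
      by_contra h
      exact absurd (hN h) (Nat.not_le_of_lt hi)
    · change S.sa R e a C hC ∈ _
      have := mem_sandwich (c := S.cornerHom R e) (X := S.leftPaths R e) (Y := S.rightPaths R e)
        (Or.inr ⟨a, C, hC, rfl⟩) (S.min.P R C) (Or.inl ⟨C, 0, rfl⟩)
      rw [sa_mul_cornerHom] at this
      rwa [← S.sa_mul_cornerHom R e a C hC, cornerHom_P]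
    · change S.sb R e n C ∈ _
      have h1 : S.sb R e n C = S.pathStar R e C n * S.path R e C (n + 1) := by
        rw [path_succ, ← mul_assoc, pathStar_mul_path, pc_mul_sb, inf_idem, inf_idem]
      rw [h1, ← pathStar_mul_cornerHom]
      exact mem_sandwich (Or.inl ⟨_, _, rfl⟩) _ (Or.inl ⟨_, _, rfl⟩)
    · change S.ta R e a C hC ∈ _
      have := mem_sandwich (c := S.cornerHom R e) (X := S.leftPaths R e) (Y := S.rightPaths R e)
        (Or.inl ⟨C, 0, rfl⟩) (S.min.P R C) (Or.inr ⟨a, C, hC, rfl⟩)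
      rw [pathStar_mul_cornerHom] at this
      have h1 : S.pathStar R e C 0 * S.ta R e a C hC = S.ta R e a C hC :=
        (S.pc_mul_ta R e a C C hC).trans (S.ta_congr R e (inf_idem _) _ _)
      rwa [h1] at this
    · change S.tb R e n C ∈ _
      have h1 : S.tb R e n C = S.pathStar R e C (n + 1) * S.path R e C n := by
        rw [pathStar_succ, mul_assoc, pathStar_mul_path, tb_mul_pc, inf_idem, inf_idem]
      rw [h1, ← pathStar_mul_cornerHom]
      exact mem_sandwich (Or.inl ⟨_, _, rfl⟩) _ (Or.inl ⟨_, _, rfl⟩)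
  · rintro (x | ⟨a | n, _, C, hC, rfl⟩ | ⟨a | n, _, C, hC, rfl⟩) _ (⟨A, i, rfl⟩ | ⟨b, D, hD, rfl⟩)
    · change (S.desing e).P R x * _ ∈ _
      obtain ⟨D, hD⟩ := S.exists_rep e (x.1 i)
      rw [← inf_idem A, ← pc_mul_pathStar, ← mul_assoc, pc, P_mul_P, S.inf_cls e x hD, ← pc,
        pc_mul_pathStar]
      exact S.pathStar_mem_leftSpan R e _ _
    · change (S.desing e).P R x * _ ∈ _
      obtain ⟨A, hA⟩ := S.exists_rep e (x.1 (e b + 1))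
      have : (S.desing e).P R x * S.sa R e b D hD = S.sa R e b (D ⊓ S.θ b A) (S.inf_mem_I hD _) := by
        rw [sa, P_mul_s]
        exact s_congr _ R (by rw [S.θF_inl_val e b x hA, cls_inf_cls]) _ _
      rw [this]
      exact S.sa_mem_leftSpan R e _ _ _
    · change S.sa R e a C hC * _ ∈ _
      by_cases h : i = 0
      · subst h
        change _ * S.pc R e 0 A ∈ _
        rw [sa_mul_pc]
        exact S.sa_mem_leftSpan R e _ _ _
      · rw [← inf_idem A, ← pc_mul_pathStar, ← mul_assoc, S.sa_mul_pc_ne R e h, zero_mul]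
        exact zero_mem _
    · change S.sa R e a C hC * _ ∈ _
      rw [← sa_mul_cornerHom, cornerHom_P, mul_assoc, S.pc_mul_sa_ne R e (Nat.succ_ne_zero _).symm,
        mul_zero]
      exact zero_mem _
    · change S.sb R e n C * _ ∈ _
      by_cases h : i = n + 1
      · subst h
        exact S.sb_mul_pathStar_mem R e _ _ _
      · rw [← inf_idem A, ← pc_mul_pathStar, ← mul_assoc, S.sb_mul_pc_ne R e h, zero_mul]
        exact zero_mem _
    · exact S.sb_mul_sa_mem R e n C b D hD
    · change S.ta R e a C hC * _ ∈ _
      by_cases h : i = e a + 1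
      · subst h
        have h1 : S.ta R e a C hC = S.pathStar R e C 0 * S.ta R e a C hC :=
          ((S.pc_mul_ta R e a C C hC).trans (S.ta_congr R e (inf_idem _) _ _)).symm
        rw [h1, mul_assoc, ta_mul_pathStar]
        exact mem_leftSpan (Or.inl ⟨_, _, rfl⟩) _
      · rw [S.ta_mul_pathStar_ne R e h]
        exact zero_mem _
    · change S.ta R e a C hC * _ ∈ _
      by_cases h : a = b
      · subst h
        rw [ta_mul_sa]
        exact S.pathStar_mem_leftSpan R e _ 0
      · rw [S.ta_mul_sa_ne R e h]
        exact zero_mem _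
    · change S.tb R e n C * _ ∈ _
      by_cases h : i = n
      · subst h
        rw [tb_mul_pathStar]
        exact S.pathStar_mem_leftSpan R e _ _
      · rw [← inf_idem A, ← pc_mul_pathStar, ← mul_assoc, S.tb_mul_pc_ne R e h, zero_mul]
        exact zero_mem _
    · change S.tb R e n C * _ ∈ _
      rw [tb_mul_sa]
      exact zero_mem _

/-- Every letter of `L` starts on a level `e a + 1 ≠ 0`, so `p_{[A]_0}` annihilates all left factors
except paths of length zero; symmetrically on the right. -/
theorem pc_mul_mul_pc_mem (A D : B) (z : (S.desing e).Alg R) :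
    S.pc R e 0 A * z * S.pc R e 0 D ∈ Set.range (S.cornerHom R e) := by
  refine corner_mem_range ?_ ?_ (S.mem_sandwich_cornerHom R e z)
  · rintro _ (⟨C, i, rfl⟩ | ⟨a, C, hC, rfl⟩)
    · by_cases h : i = 0
      · subst h
        exact ⟨S.min.P R (A ⊓ C), (S.cornerHom_P R e _).trans (S.pc_mul_pc R e 0 A C).symm⟩
      · exact ⟨0, by rw [map_zero, S.pc_mul_pathStar_ne R e (Ne.symm h)]⟩
    · exact ⟨0, by rw [map_zero, S.pc_mul_sa_ne R e (Nat.succ_ne_zero _).symm]⟩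
  · rintro _ (⟨C, i, rfl⟩ | ⟨a, C, hC, rfl⟩)
    · by_cases h : i = 0
      · subst h
        exact ⟨S.min.P R (C ⊓ D), (S.cornerHom_P R e _).trans (S.pc_mul_pc R e 0 C D).symm⟩
      · exact ⟨0, by rw [map_zero, S.path_mul_pc_ne R e (Ne.symm h)]⟩
    · exact ⟨0, by rw [map_zero, S.ta_mul_pc_ne R e (Nat.succ_ne_zero _).symm]⟩

/-! ### Products in the corner -/

theorem minHom_mul_mul_mem (v v' : S.min.Alg R) (z : S.Alg R) :
    S.minHom R v * z * S.minHom R v' ∈ Set.range (S.minHom R) := by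
  obtain ⟨D, hD⟩ := S.min_local_unit R v
  obtain ⟨D', hD'⟩ := S.min_local_unit R v'
  obtain ⟨y, hy⟩ := S.P_mul_mul_P_mem R D D' z
  refine ⟨v * y * v', ?_⟩
  conv_rhs => rw [← (hD D le_rfl).2.1, ← (hD' D' le_rfl).1]
  simp only [map_mul, hy, minHom_P, mul_assoc]

theorem cornerHom_mul_mul_mem (v v' : S.min.Alg R) (z : (S.desing e).Alg R) :
    S.cornerHom R e v * z * S.cornerHom R e v' ∈ Set.range (S.cornerHom R e) := by
  obtain ⟨D, hD⟩ := S.min_local_unit R v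
  obtain ⟨D', hD'⟩ := S.min_local_unit R v'
  obtain ⟨y, hy⟩ := S.pc_mul_mul_pc_mem R e D D' z
  refine ⟨v * y * v', ?_⟩
  conv_rhs => rw [← (hD D le_rfl).2.1, ← (hD' D' le_rfl).1]
  simp only [map_mul, hy, cornerHom_P, mul_assoc]

/-- The kernel is an ideal that meets the corner trivially, by `cornerHom_eq_zero`. Since the corner
is full, `u x w = 0` for all `u`, `w` and every `x` in the kernel, and local units give `x = 0`. -/
theorem matHom_injective : Function.Injective (S.matHom R e) := by
  rw [injective_iff_map_eq_zero]
  intro x hx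
  have h0 : ∀ v v' y z, S.cornerHom R e v * (y * x * z) * S.cornerHom R e v' = 0 := by
    intro v v' y z
    obtain ⟨w, hw⟩ := S.cornerHom_mul_mul_mem R e v v' (y * x * z)
    have : w = 0 := S.cornerHom_eq_zero R e (by
      rw [hw, map_mul, map_mul, map_mul, map_mul, hx]
      simp)
    rw [← hw, this, map_zero]
  have h1 : ∀ u z v', u * (x * z) * S.cornerHom R e v' = 0 := by
    intro u z v'
    refine Submodule.span_induction ?_ ?_ (fun x y _ _ hx hy => ?_) (fun t x _ hx => ?_)
      (S.mem_sandwich_cornerHom R e u)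
    · rintro _ ⟨l, -, v, r, -, rfl⟩
      have := h0 v v' r z
      calc l * S.cornerHom R e v * r * (x * z) * S.cornerHom R e v' =
          l * (S.cornerHom R e v * (r * x * z) * S.cornerHom R e v') := by simp only [mul_assoc]
        _ = 0 := by rw [this, mul_zero]
    · simp
    · rw [add_mul, add_mul, hx, hy, add_zero]
    · rw [smul_mul_assoc, smul_mul_assoc, hx, smul_zero]
  have h2 : ∀ u w, u * x * w = 0 := by
    intro u w
    refine Submodule.span_induction ?_ ?_ (fun x y _ _ hx hy => ?_) (fun t x _ hx => ?_)
      (S.mem_sandwich_cornerHom R e w)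
    · rintro _ ⟨l, -, v, r, -, rfl⟩
      have := h1 u l v
      calc u * x * (l * S.cornerHom R e v * r) =
          u * (x * l) * S.cornerHom R e v * r := by simp only [mul_assoc]
        _ = 0 := by rw [this, zero_mul]
    · simp
    · rw [mul_add, hx, hy, add_zero]
    · rw [mul_smul_comm, hx, smul_zero]
  obtain ⟨⟨u, -, hu⟩, ⟨w, -, hw⟩⟩ := (S.desing e).exists_local_unit R x
  rw [← hw, ← hu]
  exact h2 u w

end GBDS

/-! ### Morita contexts inside a common unital ring -/

section Morita

variable {R : Type u} [CommRing R] {K : Type x} [Ring K] [Algebra R K]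

/-- Surjectivity and unitality conditions of a Morita context become equalities of products of
subspaces of `K`; this lemma translates them back. -/
theorem span_eq_top_of_mul {V : Type y} [AddCommGroup V] [Module R V] {f : V →ₗ[R] K}
    (hf : Function.Injective f) {X Y : Submodule R K} (h : LinearMap.range f ≤ X * Y) {s : Set V}
    (hs : ∀ x ∈ X, ∀ y ∈ Y, ∃ z ∈ s, f z = x * y) : Submodule.span R s = ⊤ := by
  refine eq_top_iff.2 fun v _ => ?_
  have key : X * Y ≤ (Submodule.span R s).map f := Submodule.mul_le.2 fun x hx y hy => by
    obtain ⟨z, hz, h⟩ := hs x hx y hy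
    exact ⟨z, Submodule.subset_span hz, h⟩
  obtain ⟨v', hv', h'⟩ := key (h ⟨v, rfl⟩)
  exact hf h' ▸ hv'

variable {A : Type x} [NonUnitalRing A] [Module R A]

/-- Left multiplication on a subspace `W` with `j(A) W ⊆ W`. -/
def leftAction (j : A →ₗ[R] K) (W : Submodule R K) (h : LinearMap.range j * W ≤ W) :
    A →ₗ[R] W →ₗ[R] W :=
  LinearMap.mk₂ R (fun a m => ⟨j a * m, h (Submodule.mul_mem_mul ⟨a, rfl⟩ m.2)⟩)
    (fun _ _ _ => Subtype.ext (by simp [add_mul])) (fun _ _ _ => Subtype.ext (by simp))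
    (fun _ _ _ => Subtype.ext (by simp [mul_add])) (fun _ _ _ => Subtype.ext (by simp))

/-- Right multiplication on a subspace `W` with `W j(A) ⊆ W`. -/
def rightAction (j : A →ₗ[R] K) (W : Submodule R K) (h : W * LinearMap.range j ≤ W) :
    W →ₗ[R] A →ₗ[R] W :=
  LinearMap.mk₂ R (fun m a => ⟨m * j a, h (Submodule.mul_mem_mul m.2 ⟨a, rfl⟩)⟩)
    (fun _ _ _ => Subtype.ext (by simp [add_mul])) (fun _ _ _ => Subtype.ext (by simp))
    (fun _ _ _ => Subtype.ext (by simp [mul_add])) (fun _ _ _ => Subtype.ext (by simp))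

/-- The product of two subspaces whose product lies in the image of the injective map `j`. -/
def mulPairing (j : A →ₗ[R] K) (hj : Function.Injective j) (V W : Submodule R K)
    (h : V * W ≤ LinearMap.range j) : V →ₗ[R] W →ₗ[R] A :=
  LinearMap.mk₂ R (fun m n => (LinearEquiv.ofInjective j hj).symm
      ⟨m * n, h (Submodule.mul_mem_mul m.2 n.2)⟩)
    (fun _ _ _ => by rw [← map_add]; exact congrArg _ (Subtype.ext (by simp [add_mul])))
    (fun _ _ _ => by rw [← map_smul]; exact congrArg _ (Subtype.ext (by simp)))
    (fun _ _ _ => by rw [← map_add]; exact congrArg _ (Subtype.ext (by simp [mul_add])))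
    (fun _ _ _ => by rw [← map_smul]; exact congrArg _ (Subtype.ext (by simp)))

theorem map_mulPairing (j : A →ₗ[R] K) (hj : Function.Injective j) (V W : Submodule R K)
    (h : V * W ≤ LinearMap.range j) (m : V) (n : W) : j (mulPairing j hj V W h m n) = m * n :=
  congrArg Subtype.val ((LinearEquiv.ofInjective j hj).apply_symm_apply
    ⟨m * n, h (Submodule.mul_mem_mul m.2 n.2)⟩)

variable [IsScalarTower R A A] [SMulCommClass R A A]
variable {C : Type x} [NonUnitalRing C] [Module R C] [IsScalarTower R C C] [SMulCommClass R C C]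

/-- With all actions and pairings given by multiplication in `K`, the identities of a Morita context
reduce to associativity there, and the injections carry the pairings back to the algebras. -/
theorem moritaEquivalent_of_mul_eq (j : A →ₙₐ[R] K) (k : C →ₙₐ[R] K) (hj : Function.Injective j)
    (hk : Function.Injective k) {T F M N : Submodule R K}
    (hT : LinearMap.range (j : A →ₗ[R] K) = T) (hF : LinearMap.range (k : C →ₗ[R] K) = F)
    (hTM : T * M = M) (hMF : M * F = M) (hFN : F * N = N) (hNT : N * T = N)
    (hMN : M * N = T) (hNM : N * M = F) : MoritaEquivalent R A C := by
  subst hT hF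
  refine ⟨{ M := M, N := N
            AM := leftAction (j : A →ₗ[R] K) M hTM.le
            MC := rightAction (k : C →ₗ[R] K) M hMF.le
            CN := leftAction (k : C →ₗ[R] K) N hFN.le
            NA := rightAction (j : A →ₗ[R] K) N hNT.le
            φ := mulPairing (j : A →ₗ[R] K) hj M N hMN.le
            ψ := mulPairing (k : C →ₗ[R] K) hk N M hNM.le
            AM_mul := fun a a' m => Subtype.ext ?_
            MC_mul := fun m c c' => Subtype.ext ?_
            AM_MC := fun a m c => Subtype.ext (mul_assoc _ _ _)
            CN_mul := fun c c' n => Subtype.ext ?_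
            NA_mul := fun n a a' => Subtype.ext ?_
            CN_NA := fun c n a => Subtype.ext (mul_assoc _ _ _)
            AM_unital := ?_
            MC_unital := ?_
            CN_unital := ?_
            NA_unital := ?_
            φ_balanced := fun m c n => hj ?_
            φ_left := fun a m n => hj ?_
            φ_right := fun m n a => hj ?_
            ψ_balanced := fun n a m => hk ?_
            ψ_left := fun c n m => hk ?_
            ψ_right := fun n m c => hk ?_
            φ_ψ := fun m n m' => Subtype.ext ?_
            ψ_φ := fun n m n' => Subtype.ext ?_
            φ_surjective := ?_
            ψ_surjective := ?_ }⟩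
  · exact (congrArg (· * (m : K)) (map_mul j a a')).trans (mul_assoc _ _ _)
  · exact (congrArg ((m : K) * ·) (map_mul k c c')).trans (mul_assoc _ _ _).symm
  · exact (congrArg (· * (n : K)) (map_mul k c c')).trans (mul_assoc _ _ _)
  · exact (congrArg ((n : K) * ·) (map_mul j a a')).trans (mul_assoc _ _ _).symm
  · refine span_eq_top_of_mul M.injective_subtype (M.range_subtype.le.trans hTM.ge) ?_
    rintro _ ⟨a, rfl⟩ m hm
    exact ⟨_, ⟨a, ⟨m, hm⟩, rfl⟩, rfl⟩
  · refine span_eq_top_of_mul M.injective_subtype (M.range_subtype.le.trans hMF.ge) ?_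
    rintro m hm _ ⟨c, rfl⟩
    exact ⟨_, ⟨⟨m, hm⟩, c, rfl⟩, rfl⟩
  · refine span_eq_top_of_mul N.injective_subtype (N.range_subtype.le.trans hFN.ge) ?_
    rintro _ ⟨c, rfl⟩ n hn
    exact ⟨_, ⟨c, ⟨n, hn⟩, rfl⟩, rfl⟩
  · refine span_eq_top_of_mul N.injective_subtype (N.range_subtype.le.trans hNT.ge) ?_
    rintro n hn _ ⟨a, rfl⟩
    exact ⟨_, ⟨⟨n, hn⟩, a, rfl⟩, rfl⟩
  · exact (map_mulPairing (j : A →ₗ[R] K) hj M N hMN.le _ _).trans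
      ((mul_assoc _ _ _).trans (map_mulPairing (j : A →ₗ[R] K) hj M N hMN.le m
        (leftAction (k : C →ₗ[R] K) N hFN.le c n)).symm)
  · exact (map_mulPairing (j : A →ₗ[R] K) hj M N hMN.le _ _).trans ((mul_assoc _ _ _).trans
      ((congrArg (j a * ·) (map_mulPairing (j : A →ₗ[R] K) hj M N hMN.le m n).symm).trans
        (map_mul j _ _).symm))
  · exact (map_mulPairing (j : A →ₗ[R] K) hj M N hMN.le _ _).trans ((mul_assoc _ _ _).symm.trans
      ((congrArg (· * j a) (map_mulPairing (j : A →ₗ[R] K) hj M N hMN.le m n).symm).trans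
        (map_mul j _ _).symm))
  · exact (map_mulPairing (k : C →ₗ[R] K) hk N M hNM.le _ _).trans
      ((mul_assoc _ _ _).trans (map_mulPairing (k : C →ₗ[R] K) hk N M hNM.le n
        (leftAction (j : A →ₗ[R] K) M hTM.le a m)).symm)
  · exact (map_mulPairing (k : C →ₗ[R] K) hk N M hNM.le _ _).trans ((mul_assoc _ _ _).trans
      ((congrArg (k c * ·) (map_mulPairing (k : C →ₗ[R] K) hk N M hNM.le n m).symm).trans
        (map_mul k _ _).symm))
  · exact (map_mulPairing (k : C →ₗ[R] K) hk N M hNM.le _ _).trans ((mul_assoc _ _ _).symm.trans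
      ((congrArg (· * k c) (map_mulPairing (k : C →ₗ[R] K) hk N M hNM.le n m).symm).trans
        (map_mul k _ _).symm))
  · exact (congrArg (· * (m' : K)) (map_mulPairing (j : A →ₗ[R] K) hj M N hMN.le m n)).trans
      ((mul_assoc _ _ _).trans (congrArg ((m : K) * ·)
        (map_mulPairing (k : C →ₗ[R] K) hk N M hNM.le n m')).symm)
  · exact (congrArg (· * (n' : K)) (map_mulPairing (k : C →ₗ[R] K) hk N M hNM.le n m)).trans
      ((mul_assoc _ _ _).trans (congrArg ((n : K) * ·)
        (map_mulPairing (j : A →ₗ[R] K) hj M N hMN.le m n')).symm)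
  · refine span_eq_top_of_mul (f := (j : A →ₗ[R] K)) hj hMN.ge fun m hm n hn => ?_
    exact ⟨_, ⟨⟨m, hm⟩, ⟨n, hn⟩, rfl⟩,
      map_mulPairing (j : A →ₗ[R] K) hj M N hMN.le ⟨m, hm⟩ ⟨n, hn⟩⟩
  · refine span_eq_top_of_mul (f := (k : C →ₗ[R] K)) hk hNM.ge fun n hn m hm => ?_
    exact ⟨_, ⟨⟨n, hn⟩, ⟨m, hm⟩, rfl⟩,
      map_mulPairing (k : C →ₗ[R] K) hk N M hNM.le ⟨n, hn⟩ ⟨m, hm⟩⟩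

/-- Two subalgebras that share a common full corner `Q` are Morita equivalent. -/
theorem moritaEquivalent_of_common_corner (j : A →ₙₐ[R] K) (k : C →ₙₐ[R] K)
    (hj : Function.Injective j) (hk : Function.Injective k) {T F Q : Submodule R K}
    (hT : LinearMap.range (j : A →ₗ[R] K) = T) (hF : LinearMap.range (k : C →ₗ[R] K) = F)
    (hTT : T * T = T) (hFF : F * F = F) (hTQT : T * Q * T = T) (hFQF : F * Q * F = F)
    (hQTQ : Q * T * Q = Q) (hQFQ : Q * F * Q = Q) : MoritaEquivalent R A C := by
  -- Every passage between `T` and `F` goes through `Q`, since neither has to contain the other.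
  refine moritaEquivalent_of_mul_eq j k hj hk hT hF (M := T * Q * F) (N := F * Q * T)
    ?_ ?_ ?_ ?_ ?_ ?_
  · simp only [← mul_assoc, hTT]
  · simp only [mul_assoc, hFF]
  · simp only [← mul_assoc, hFF]
  · simp only [mul_assoc, hTT]
  · calc T * Q * F * (F * Q * T) = T * (Q * (F * F) * Q) * T := by simp only [mul_assoc]
      _ = T := by rw [hFF, hQFQ, hTQT]
  · calc F * Q * T * (T * Q * F) = F * (Q * (T * T) * Q) * F := by simp only [mul_assoc]
      _ = F := by rw [hTT, hQTQ, hFQF]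

end Morita

/-! ### Assembly of the Morita equivalence -/

namespace GBDS

variable {B : Type v} {L : Type w} [GeneralizedBooleanAlgebra B] (S : GBDS B L)
variable (R : Type u) [CommRing R] (e : L ↪ ℕ)

theorem exists_eq_mul_mul (v : S.min.Alg R) : ∃ p q, v = p * v * q := by
  obtain ⟨D, hD⟩ := S.min_local_unit R v
  exact ⟨_, _, by rw [(hD D le_rfl).1, (hD D le_rfl).2.1]⟩

section FullCorner

variable {S R} {Q : Type x} [NonUnitalRing Q] [Module R Q] {K : Type y} [Ring K] [Algebra R K]

/-- A corner that spans the algebra is full: its image `Q` and the image `T` of the algebra satisfy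
`T T = T`, `T Q T = T` and `Q T Q = Q`. -/
theorem mul_eq_of_full_corner (c : Q →ₙₐ[R] S.Alg R) (j : S.Alg R →ₙₐ[R] K) {X Y : Set (S.Alg R)}
    (hfull : ∀ z, z ∈ sandwich c X Y) (hcorner : ∀ v v' z, c v * z * c v' ∈ Set.range c)
    (hQ : ∀ v : Q, ∃ p q, v = p * v * q) {T U : Submodule R K}
    (hT : LinearMap.range (j : S.Alg R →ₗ[R] K) = T)
    (hU : LinearMap.range ((j : S.Alg R →ₗ[R] K) ∘ₗ (c : Q →ₗ[R] S.Alg R)) = U) :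
    T * T = T ∧ T * U * T = T ∧ U * T * U = U := by
  have hT' : ∀ z, j z ∈ T := fun z => hT ▸ ⟨z, rfl⟩
  have hU' : ∀ v, j (c v) ∈ U := fun v => hU ▸ ⟨v, rfl⟩
  have hUT : U ≤ T := by
    subst hU
    rintro _ ⟨v, rfl⟩
    exact hT' _
  have hTT : T * T ≤ T := by
    subst hT
    refine Submodule.mul_le.2 ?_
    rintro _ ⟨y, rfl⟩ _ ⟨z, rfl⟩
    exact ⟨y * z, map_mul j y z⟩
  have hTUT : T ≤ T * U * T := by
    subst hT
    rintro _ ⟨z, rfl⟩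
    have : sandwich c X Y ≤ (LinearMap.range (j : S.Alg R →ₗ[R] K) * U *
        LinearMap.range (j : S.Alg R →ₗ[R] K)).comap (j : S.Alg R →ₗ[R] K) := by
      refine Submodule.span_le.2 ?_
      rintro _ ⟨l, -, v, r, -, rfl⟩
      change j (l * c v * r) ∈ LinearMap.range (j : S.Alg R →ₗ[R] K) * U *
        LinearMap.range (j : S.Alg R →ₗ[R] K)
      rw [map_mul, map_mul]
      exact Submodule.mul_mem_mul (Submodule.mul_mem_mul ⟨l, rfl⟩ (hU' v)) ⟨r, rfl⟩
    exact this (hfull z)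
  -- Idempotence of `T` comes from fullness, through `T ⊆ T U T ⊆ T T ⊆ T`.
  have hUTT : T * U * T ≤ T * T := mul_le_mul' ((mul_le_mul' le_rfl hUT).trans hTT) le_rfl
  refine ⟨hTT.antisymm (hTUT.trans hUTT), (hUTT.trans hTT).antisymm hTUT, le_antisymm ?_ ?_⟩
  · subst hT hU
    rw [mul_assoc]
    refine Submodule.mul_le.2 ?_
    rintro _ ⟨v, rfl⟩ w hw
    induction hw using Submodule.mul_induction_on' with
    | mem_mul_mem z hz v' hv' =>
      obtain ⟨z, rfl⟩ := hz
      obtain ⟨v', rfl⟩ := hv'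
      obtain ⟨u, hu⟩ := hcorner v v' z
      refine ⟨u, ?_⟩
      change j (c u) = j (c v) * (j z * j (c v'))
      rw [hu, map_mul, map_mul, mul_assoc]
    | add x _ y _ hx hy => rw [mul_add]; exact add_mem hx hy
  · subst hU
    rintro _ ⟨v, rfl⟩
    -- In place of a unit, the factorization `v = p v q` exhibits the image of `v` in `U T U`.
    obtain ⟨p, q, h⟩ := hQ v
    change j (c v) ∈ LinearMap.range _ * T * LinearMap.range _
    rw [h, map_mul, map_mul, map_mul, map_mul]
    exact Submodule.mul_mem_mul (Submodule.mul_mem_mul (hU' p) (hT' _)) (hU' q)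

end FullCorner

/-- The embedding of the algebra as the matrices supported at the place `(0, 0)`. -/
def unitHom : S.Alg R →ₙₐ[R] ColEnd R (S.Alg R) where
  __ := ColEnd.unit R 0 0
  map_zero' := map_zero (ColEnd.unit R 0 0)
  map_mul' c d := (ColEnd.unit_mul_unit 0 0 0 c d).symm

/-- The algebra of `S` enters the matrices at the place `(0, 0)`. There its subalgebra from `S.min`
coincides with the level-zero corner of the desingularization, which makes `Q` common to both. -/
theorem moritaEquivalent_desing : MoritaEquivalent R (S.Alg R) ((S.desing e).Alg R) := by
  have hQ : (S.matHom R e : (S.desing e).Alg R →ₗ[R] ColEnd R (S.Alg R)) ∘ₗ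
      (S.cornerHom R e : S.min.Alg R →ₗ[R] (S.desing e).Alg R) =
        (S.unitHom R : S.Alg R →ₗ[R] ColEnd R (S.Alg R)) ∘ₗ
          (S.minHom R : S.min.Alg R →ₗ[R] S.Alg R) :=
    LinearMap.ext fun v => S.matHom_cornerHom R e v
  obtain ⟨h1, h2, h3⟩ := mul_eq_of_full_corner (S.minHom R) (S.unitHom R)
    (S.mem_sandwich_minHom R) (S.minHom_mul_mul_mem R) (S.exists_eq_mul_mul R) rfl rfl
  obtain ⟨h4, h5, h6⟩ := mul_eq_of_full_corner (S.cornerHom R e) (S.matHom R e)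
    (S.mem_sandwich_cornerHom R e) (S.cornerHom_mul_mul_mem R e) (S.exists_eq_mul_mul R) rfl
    (congrArg LinearMap.range hQ)
  exact moritaEquivalent_of_common_corner (S.unitHom R) (S.matHom R e)
    (ColEnd.unit_injective 0 0) (S.matHom_injective R e) rfl rfl h1 h4 h2 h5 h3 h6

end GBDS

end BooleanDynamics

end

/-- Desingularization: for a generalized Boolean dynamical system `S = (B, L, θ, I)` whose alphabet
is countable, with enumeration `e`, all sets of `S.desing e = (B^F, L^F, θ^F, I^F)` are regular, and
the algebras of the two systems are Morita equivalent. -/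
theorem mainTheorem7 (R : Type*) [CommRing R] {B : Type*} [GeneralizedBooleanAlgebra B]
    {L : Type*} (S : BooleanDynamics.GBDS B L) (e : L ↪ ℕ) :
    (S.desing e).regular = Set.univ ∧
      BooleanDynamics.MoritaEquivalent R (S.Alg R) ((S.desing e).Alg R) :=
  ⟨S.regular_desing e, S.moritaEquivalent_desing R e⟩
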